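/- **Setting.** Let $m<M$, $\lambda,\delta,k>0$. Let $c:[m,M]\to(0,\infty)$ be non-increasing and Lipschitz, $G:[m,M]\to[0,\infty)$ continuous and increasing, $H:[m,M]\to\mathbb{R}$ continuous and increasing ("increasing" in the weak sense), and let $F$ be a probability distribution on $[0,\infty)$ whose support contains $[0,M-m]$. On a probability space $(\Omega,\mathcal F,\mathbb P)$ let $N$ be a homogeneous Poisson process with intensity $\lambda$ and $(S_i)_{i\ge1}$ an i.i.d. sequence with law $F$, independent of $N$. Extend $c$ to $\mathbb{R}$ by $c(x)=c(m)$ for $x<m$ and $c(x)=c(M)$ for $x>M$. For $r\in[m,M]$ let $R$ solve $R_t=r-\int_0^tc(R_s)\,ds-\sum_{i=1}^{N_t}S_i$, and put $\mathcal F_t=\sigma(R_s:s\le t)$. An *impulse control* is a sequence $\nu=\{(\tau_i,\zeta_i)\}_{i\ge1}$ of $[0,\infty]$-valued $(\mathcal F_t)$-stopping times with $\tau_i\le\tau_{i+1}$ and $\tau_i\to\infty$ a.s., and $\mathcal F_{\tau_i}$-measurable real random variables $\zeta_i$. The controlled process is the solution of $$R^\nu_t=r-\int_0^tc(R^\nu_s)\,ds-\sum_{i=1}^{N_t}S_i+\sum_{\tau_i<t}\zeta_i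 ,$$ and $\tau^\nu=\inf\{t\ge0: R^\nu_t<m\}$ is the time of total failure. Let $\rho_i=R^\nu_{\tau_i}+\sum_{j<i,\ \tau_j=\tau_i}\zeta_j$ be the level found by the $i$-th intervention (equal to $R^\nu_{\tau_i}$ unless earlier interventions take place at the same time). The control is *admissible*, $\nu\in\mathcal I$, if a.s. $\zeta_i\in[0,M-\rho_i]$ for all $i$ with $\tau_i<\infty$. With $C(r,\zeta)=H(r+\zeta)-H(r)+k$ let $$J(r,\nu)=\mathbb E\Big[\int_0^{\tau^\nu}e^{-\delta s}G(R^\nu_s)\,ds-\sum_{\tau_i<\tau^\nu}e^{-\delta\tau_i}C(\rho_i,\zeta_i)\Big]\in[-\infty,\infty),\qquad V(r)=\sup_{\nu\in\mathcal I}J(r,\nu).$$ For functions $f$ on $[m,M]$ let $$\mathcal Af(r)=-c(r)f'(r)+\lambda\Big(\int_{[0,r-m)}f(r-s)\,dF(s)-f(r)\Big),\qquad \mathcal Mf(r)=\sup_{0\le\zeta\le M-r}\big(f(r+\zeta)-H(r+\zeta)+H(r)-k\big).$$ A *viscosity subsolution* (*supersolution*) of $$\min\{\delta f-\mathcal Af-G,\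 f-\mathcal Mf\}=0\qquad(\ast)$$ is an upper (lower) semicontinuous function $u$ on $[m,M]$ such that for every $r\in(m,M)$ and every $\varphi\in C^1(m,M)$ for which $s\mapsto\varphi(r-s)$ is $F$-integrable on $[0,r-m)$, if $u(r)=\varphi(r)$ and $r$ maximizes (minimizes) $u-\varphi$ over $(m,M)$, then $$\min\{\delta\varphi(r)-\mathcal A\varphi(r)-G(r),\ u(r)-\mathcal Mu(r)\}\le0\quad(\ge0).$$ A *viscosity solution* is a function that is both. **Theorem.** The value function $V$ is finite on $[m,M]$ and is a viscosity solution of $(\ast)$ on $[m,M]$. -/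

import Mathlib

open MeasureTheory ProbabilityTheory Set Filter Topology
open scoped NNReal ENNReal

noncomputable section

namespace ImpulseMaintenance

/-! ### The integral equation for the performance level

`levelPath b y` is the path `ρ` with `ρ t = y t - ∫ s in 0..t, b (ρ s)`, obtained by Picard
iteration. For `b` bounded and Lipschitz and `y` measurable it solves the equation
(`levelPath_eq`) and is its only solution (`eq_levelPath`). -/

/-- Picard iterates of `ρ t = y t - ∫ s in 0..t, b (ρ s)`. -/
def picardIterate (b : ℝ → ℝ) (y : ℝ≥0 → ℝ) : ℕ → ℝ≥0 → ℝ
  | 0 => y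
  | n + 1 => fun t => y t - ∫ s in (0 : ℝ)..t, b (picardIterate b y n s.toNNReal)

/-- The solution of `ρ t = y t - ∫ s in 0..t, b (ρ s)`. -/
def levelPath (b : ℝ → ℝ) (y : ℝ≥0 → ℝ) (t : ℝ≥0) : ℝ :=
  limUnder atTop fun n => picardIterate b y n t

section Picard

variable {b : ℝ → ℝ} {B : ℝ} {K : ℝ≥0}

theorem intervalIntegrable_rate (hK : LipschitzWith K b) (hB : ∀ x, |b x| ≤ B)
    {f : ℝ≥0 → ℝ} (hf : Measurable f) (u v : ℝ) :
    IntervalIntegrable (fun s : ℝ => b (f s.toNNReal)) volume u v := by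
  refine (intervalIntegrable_const (c := B)).mono_fun' ?_ ?_
  · exact (hK.continuous.measurable.comp (hf.comp measurable_real_toNNReal)).aestronglyMeasurable
  · exact Eventually.of_forall fun s => hB _

theorem measurable_primitive (hK : LipschitzWith K b) (hB : ∀ x, |b x| ≤ B)
    {f : ℝ≥0 → ℝ} (hf : Measurable f) :
    Measurable fun t : ℝ≥0 => ∫ s in (0 : ℝ)..t, b (f s.toNNReal) :=
  ((intervalIntegral.continuous_primitive
    (fun u v => intervalIntegrable_rate hK hB hf u v) 0).comp
      NNReal.continuous_coe).measurable

theorem measurable_picardIterate (hK : LipschitzWith K b) (hB : ∀ x, |b x| ≤ B)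
    {y : ℝ≥0 → ℝ} (hy : Measurable y) (n : ℕ) : Measurable (picardIterate b y n) := by
  induction n with
  | zero => exact hy
  | succ n ih => exact hy.sub (measurable_primitive hK hB ih)

theorem abs_integral_rate_le (hB : ∀ x, |b x| ≤ B) (f : ℝ≥0 → ℝ) (t : ℝ≥0) :
    |∫ s in (0 : ℝ)..t, b (f s.toNNReal)| ≤ B * t := by
  have := intervalIntegral.norm_integral_le_of_norm_le_const (a := (0 : ℝ)) (b := (t : ℝ))
    (f := fun s : ℝ => b (f s.toNNReal)) (C := B) (fun s _ => hB _)
  simpa using this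

theorem abs_integral_rate_sub_le (hK : LipschitzWith K b) (hB : ∀ x, |b x| ≤ B)
    {f g : ℝ≥0 → ℝ} (hf : Measurable f) (hg : Measurable g) {A : ℝ} {n : ℕ}
    (h : ∀ s : ℝ≥0, |f s - g s| ≤ A * s ^ n) (t : ℝ≥0) :
    |(∫ s in (0 : ℝ)..t, b (f s.toNNReal)) - ∫ s in (0 : ℝ)..t, b (g s.toNNReal)|
      ≤ K * A / (n + 1) * t ^ (n + 1) := by
  rw [← intervalIntegral.integral_sub (intervalIntegrable_rate hK hB hf _ _)
    (intervalIntegrable_rate hK hB hg _ _)]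
  have hbd := intervalIntegral.norm_integral_le_of_norm_le (μ := volume) (a := (0 : ℝ))
    (b := (t : ℝ)) (f := fun s : ℝ => b (f s.toNNReal) - b (g s.toNNReal))
    (g := fun s => K * A * s ^ n) t.2 (ae_of_all _ fun s hs => ?_)
    ((continuous_const.mul (continuous_pow n)).intervalIntegrable _ _)
  · refine hbd.trans (le_of_eq ?_)
    rw [intervalIntegral.integral_const_mul, integral_pow]
    simp
    ring
  · have h1 := hK.dist_le_mul (f s.toNNReal) (g s.toNNReal)
    rw [Real.dist_eq, Real.dist_eq] at h1
    have h2 := h s.toNNReal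
    rw [Real.coe_toNNReal _ hs.1.le] at h2
    calc ‖b (f s.toNNReal) - b (g s.toNNReal)‖ ≤ K * |f s.toNNReal - g s.toNNReal| := h1
      _ ≤ K * (A * s ^ n) := by gcongr
      _ = K * A * s ^ n := by ring

theorem picard_bound_step (n : ℕ) :
    (K : ℝ) * (B * K ^ n / (n + 1).factorial) / ((n + 1 : ℕ) + 1)
      = B * K ^ (n + 1) / (n + 1 + 1).factorial := by
  rw [Nat.factorial_succ (n + 1)]
  have : ((n + 1).factorial : ℝ) ≠ 0 := by positivity
  have : ((n + 1 : ℕ) + 1 : ℝ) ≠ 0 := by positivity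
  push_cast at *
  field_simp
  ring

/-- Any solution of the equation is close to the Picard iterates. -/
theorem abs_picardIterate_sub_le (hK : LipschitzWith K b) (hB : ∀ x, |b x| ≤ B)
    {y ρ : ℝ≥0 → ℝ} (hy : Measurable y) (hρ : Measurable ρ)
    (h : ∀ t : ℝ≥0, ρ t = y t - ∫ s in (0 : ℝ)..t, b (ρ s.toNNReal)) (n : ℕ) (t : ℝ≥0) :
    |picardIterate b y n t - ρ t| ≤ B * K ^ n / (n + 1).factorial * t ^ (n + 1) := by
  induction n generalizing t with
  | zero =>
    rw [h t]
    simpa [picardIterate] using abs_integral_rate_le hB ρ t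
  | succ n ih =>
    have := abs_integral_rate_sub_le hK hB (measurable_picardIterate hK hB hy n) hρ ih t
    rw [picard_bound_step] at this
    rw [h t, abs_sub_comm]
    simpa [picardIterate] using this

theorem abs_picardIterate_succ_sub_le (hK : LipschitzWith K b) (hB : ∀ x, |b x| ≤ B)
    {y : ℝ≥0 → ℝ} (hy : Measurable y) (n : ℕ) (t : ℝ≥0) :
    |picardIterate b y n t - picardIterate b y (n + 1) t|
      ≤ B * K ^ n / (n + 1).factorial * t ^ (n + 1) := by
  induction n generalizing t with
  | zero => simpa [picardIterate] using abs_integral_rate_le hB y t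
  | succ n ih =>
    have := abs_integral_rate_sub_le hK hB (measurable_picardIterate hK hB hy n)
      (measurable_picardIterate hK hB hy (n + 1)) ih t
    rw [picard_bound_step] at this
    rw [abs_sub_comm] at this
    simpa [picardIterate] using this

theorem summable_picard_bound (B : ℝ) (K t : ℝ≥0) :
    Summable fun n : ℕ => B * (K : ℝ) ^ n / (n + 1).factorial * (t : ℝ) ^ (n + 1) := by
  have h := ((Real.summable_pow_div_factorial ((K : ℝ) * t)).mul_left (|B| * t))
  refine Summable.of_norm_bounded h fun n => ?_
  rw [Real.norm_eq_abs, abs_mul, abs_div, abs_mul, abs_of_nonneg (a := (K : ℝ) ^ n) (by positivity),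
    abs_of_nonneg (a := (t : ℝ) ^ (n + 1)) (by positivity),
    abs_of_nonneg (a := ((n + 1).factorial : ℝ)) (by positivity)]
  calc |B| * (K : ℝ) ^ n / (n + 1).factorial * (t : ℝ) ^ (n + 1)
      ≤ |B| * (K : ℝ) ^ n / n.factorial * (t : ℝ) ^ (n + 1) := by
        gcongr
        exact Nat.le_succ n
    _ = |B| * t * (((K : ℝ) * t) ^ n / n.factorial) := by rw [mul_pow]; ring

theorem tendsto_picardIterate (hK : LipschitzWith K b) (hB : ∀ x, |b x| ≤ B)
    {y : ℝ≥0 → ℝ} (hy : Measurable y) (t : ℝ≥0) :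
    Tendsto (fun n => picardIterate b y n t) atTop (𝓝 (levelPath b y t)) := by
  have hc : CauchySeq fun n => picardIterate b y n t :=
    cauchySeq_of_dist_le_of_summable _
      (fun n => abs_picardIterate_succ_sub_le hK hB hy n t) (summable_picard_bound B K t)
  exact hc.tendsto_limUnder

theorem measurable_levelPath (hK : LipschitzWith K b) (hB : ∀ x, |b x| ≤ B)
    {y : ℝ≥0 → ℝ} (hy : Measurable y) : Measurable (levelPath b y) :=
  measurable_of_tendsto_metrizable (fun n => measurable_picardIterate hK hB hy n)
    (tendsto_pi_nhds.2 fun t => tendsto_picardIterate hK hB hy t)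

/-- `levelPath b y` solves the integral equation. -/
theorem levelPath_eq (hK : LipschitzWith K b) (hB : ∀ x, |b x| ≤ B)
    {y : ℝ≥0 → ℝ} (hy : Measurable y) (t : ℝ≥0) :
    levelPath b y t = y t - ∫ s in (0 : ℝ)..t, b (levelPath b y s.toNNReal) := by
  have h1 := (tendsto_picardIterate hK hB hy t).comp (tendsto_add_atTop_nat 1)
  refine tendsto_nhds_unique h1 ?_
  refine Tendsto.const_sub _ ?_
  refine intervalIntegral.tendsto_integral_filter_of_dominated_convergence (fun _ => B) ?_ ?_ ?_ ?_
  · exact Eventually.of_forall fun n => (hK.continuous.measurable.comp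
      ((measurable_picardIterate hK hB hy n).comp measurable_real_toNNReal)).aestronglyMeasurable
  · exact Eventually.of_forall fun n => ae_of_all _ fun s _ => hB _
  · exact intervalIntegrable_const
  · exact ae_of_all _ fun s _ =>
      (hK.continuous.tendsto _).comp (tendsto_picardIterate hK hB hy s.toNNReal)

/-- `levelPath b y` is the only solution of the integral equation. -/
theorem eq_levelPath (hK : LipschitzWith K b) (hB : ∀ x, |b x| ≤ B)
    {y ρ : ℝ≥0 → ℝ} (hy : Measurable y) (hρ : Measurable ρ)
    (h : ∀ t : ℝ≥0, ρ t = y t - ∫ s in (0 : ℝ)..t, b (ρ s.toNNReal)) : ρ = levelPath b y := by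
  funext t
  refine tendsto_nhds_unique ?_ (tendsto_picardIterate hK hB hy t)
  rw [tendsto_iff_dist_tendsto_zero]
  exact squeeze_zero (fun _ => dist_nonneg)
    (fun n => abs_picardIterate_sub_le hK hB hy hρ h n t)
    (summable_picard_bound B K t).tendsto_atTop_zero

/-- Measurability in the sample point when the input depends measurably on it. -/
theorem measurable_levelPath_apply (hK : LipschitzWith K b) (hB : ∀ x, |b x| ≤ B)
    {Ω : Type*} [MeasurableSpace Ω] {y : Ω → ℝ≥0 → ℝ}
    (hy : Measurable (Function.uncurry y)) (t : ℝ≥0) :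
    Measurable fun ω => levelPath b (y ω) t := by
  have hp : ∀ n, Measurable fun p : Ω × ℝ≥0 => picardIterate b (y p.1) n p.2 := by
    intro n
    induction n with
    | zero => exact hy
    | succ n ih =>
      refine Measurable.sub hy ?_
      have hj : StronglyMeasurable (Function.uncurry fun (p : Ω × ℝ≥0) (s : ℝ) =>
          (Ioc (0 : ℝ) p.2).indicator (fun s => b (picardIterate b (y p.1) n s.toNNReal)) s) := by
        refine Measurable.stronglyMeasurable ?_
        have hm : Measurable fun q : (Ω × ℝ≥0) × ℝ =>
            b (picardIterate b (y q.1.1) n q.2.toNNReal) :=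
          hK.continuous.measurable.comp (ih.comp (by fun_prop :
            Measurable fun q : (Ω × ℝ≥0) × ℝ => (q.1.1, q.2.toNNReal)))
        have hs : MeasurableSet {q : (Ω × ℝ≥0) × ℝ | 0 < q.2 ∧ q.2 ≤ (q.1.2 : ℝ)} :=
          (measurableSet_lt measurable_const measurable_snd).inter
            (measurableSet_le measurable_snd (by fun_prop))
        exact hm.indicator hs
      have := (hj.integral_prod_right (ν := (volume : Measure ℝ))).measurable
      convert this using 2 with p
      rw [integral_indicator measurableSet_Ioc]
      exact intervalIntegral.integral_of_le p.2.2
  exact measurable_of_tendsto_metrizable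
    (fun n => (hp n).comp (measurable_id.prodMk measurable_const))
    (tendsto_pi_nhds.2 fun ω =>
      tendsto_picardIterate hK hB (hy.comp measurable_prodMk_left) t)

end Picard

/-! ### Data of the model -/

/-- The deterministic data of the maintenance problem and the standing assumptions on them.
`m` is the failure threshold, `M` the maximal performance level, `c` the rate of progressive
deterioration, `lam` the intensity and `F` the size distribution of the shocks, `G` the benefit
rate, `H` and `k` the variable and the fixed part of the intervention cost, `δ` the discount
rate. The functions `c`, `G`, `H` matter on `[m, M]` only. -/
structure MaintenanceModel where
  m : ℝ
  M : ℝ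
  c : ℝ → ℝ
  lam : ℝ
  F : Measure ℝ
  G : ℝ → ℝ
  H : ℝ → ℝ
  k : ℝ
  δ : ℝ
  m_lt_M : m < M
  c_pos : ∀ x ∈ Icc m M, 0 < c x
  c_antitone : AntitoneOn c (Icc m M)
  c_lipschitz : ∃ L : ℝ≥0, LipschitzOnWith L c (Icc m M)
  lam_pos : 0 < lam
  isProbabilityMeasure_F : IsProbabilityMeasure F
  F_nonneg : F (Iio 0) = 0
  F_support : Icc 0 (M - m) ⊆ F.support
  G_nonneg : ∀ x ∈ Icc m M, 0 ≤ G x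
  G_continuous : ContinuousOn G (Icc m M)
  G_monotone : MonotoneOn G (Icc m M)
  H_continuous : ContinuousOn H (Icc m M)
  H_monotone : MonotoneOn H (Icc m M)
  k_pos : 0 < k
  δ_pos : 0 < δ

variable (A : MaintenanceModel)

/-- The deterioration rate `c`, extended by constants outside `[m, M]` so that the equation for
the performance level makes sense after failure. (Levels after failure never enter the profit,
and the filtration generated by the level is the same for every extension.) -/
def MaintenanceModel.rate (x : ℝ) : ℝ := A.c (max A.m (min x A.M))

/-- Cost of bringing the system from level `r` to level `r + z`. -/
def MaintenanceModel.cost (r z : ℝ) : ℝ := A.H (r + z) - A.H r + A.k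

theorem MaintenanceModel.clamp_mem (x : ℝ) : max A.m (min x A.M) ∈ Icc A.m A.M :=
  ⟨le_max_left _ _, max_le A.m_lt_M.le (min_le_right _ _)⟩

theorem MaintenanceModel.exists_lipschitzWith_rate : ∃ L : ℝ≥0, LipschitzWith L A.rate := by
  obtain ⟨L, hL⟩ := A.c_lipschitz
  refine ⟨L, LipschitzWith.of_dist_le_mul fun x y => ?_⟩
  refine (hL.dist_le_mul _ (A.clamp_mem x) _ (A.clamp_mem y)).trans ?_
  gcongr
  have h := ((LipschitzWith.id (α := ℝ)).min_const A.M).const_max A.m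
  simpa using h.dist_le_mul x y

theorem MaintenanceModel.abs_rate_le (x : ℝ) : |A.rate x| ≤ A.c A.m := by
  rw [MaintenanceModel.rate, abs_of_pos (A.c_pos _ (A.clamp_mem x))]
  exact A.c_antitone (left_mem_Icc.2 A.m_lt_M.le) (A.clamp_mem x) (A.clamp_mem x).1

/-! ### The shocks -/

section Probability

variable {Ω : Type*} [mΩ : MeasurableSpace Ω]

/-- `N` is a homogeneous Poisson process with intensity `lam`: the counting process whose
successive waiting times `E 0, E 1, …` are independent and exponential with parameter `lam`.
The `n`-th arrival is at time `E 0 + … + E (n - 1)`, and `N t` is at least `n` exactly when that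
arrival is not later than `t`. -/
def IsPoissonProcess (N : ℝ≥0 → Ω → ℕ) (lam : ℝ) (P : Measure Ω) : Prop :=
  ∃ E : ℕ → Ω → ℝ, (∀ i, Measurable (E i)) ∧ iIndepFun E P ∧
    (∀ i, P.map (E i) = expMeasure lam) ∧
    ∀ (ω : Ω) (t : ℝ≥0) (n : ℕ), n ≤ N t ω ↔ ∑ i ∈ Finset.range n, E i ω ≤ t

/-- The shocks that hit the system: a Poisson process `N` of intensity `lam`, and independent of
it an i.i.d. sequence of shock sizes with law `F`. The size of the first shock is `S 0`. -/
structure Shocks (P : Measure Ω) where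
  N : ℝ≥0 → Ω → ℕ
  S : ℕ → Ω → ℝ
  poisson : IsPoissonProcess N A.lam P
  measurable_S : ∀ i, Measurable (S i)
  law_S : ∀ i, P.map (S i) = A.F
  indep_S : iIndepFun S P
  indep_N_S : IndepFun (fun ω t => N t ω) (fun ω i => S i ω) P

variable {A} {P : Measure Ω} (X : Shocks A P)

/-- Total damage up to time `t`: the sum of the sizes of the first `N t` shocks. -/
def Shocks.damage (t : ℝ≥0) (ω : Ω) : ℝ := ∑ i ∈ Finset.range (X.N t ω), X.S i ω

theorem Shocks.measurable_damage : Measurable fun p : Ω × ℝ≥0 => X.damage p.2 p.1 := by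
  obtain ⟨E, hE, -, -, hN⟩ := X.poisson
  have hset : ∀ n : ℕ, MeasurableSet {p : Ω × ℝ≥0 | n ≤ X.N p.2 p.1} := by
    intro n
    have : {p : Ω × ℝ≥0 | n ≤ X.N p.2 p.1}
        = {p : Ω × ℝ≥0 | ∑ i ∈ Finset.range n, E i p.1 ≤ (p.2 : ℝ)} := by
      ext p; exact hN p.1 p.2 n
    rw [this]
    refine measurableSet_le ?_ (by fun_prop)
    exact Finset.measurable_sum _ fun i _ => (hE i).comp measurable_fst
  have hNm : Measurable fun p : Ω × ℝ≥0 => X.N p.2 p.1 := measurable_of_Ici hset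
  have h2 : Measurable fun q : ℕ × Ω => ∑ i ∈ Finset.range q.1, X.S i q.2 :=
    measurable_from_prod_countable_right fun n => by
      exact Finset.measurable_sum (Finset.range n) fun i _ => X.measurable_S i
  exact h2.comp (hNm.prodMk measurable_fst)

/-- The uncontrolled level with initial level `r`:
`R t = r - ∫ s in 0..t, c (R s) - ∑ i < N t, S i`. -/
def Shocks.level (r : ℝ) (t : ℝ≥0) (ω : Ω) : ℝ :=
  levelPath A.rate (fun s => r - X.damage s ω) t

theorem Shocks.measurable_level (r : ℝ) (t : ℝ≥0) : Measurable (X.level r t) := by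
  obtain ⟨L, hL⟩ := A.exists_lipschitzWith_rate
  exact measurable_levelPath_apply hL A.abs_rate_le
    (y := fun ω s => r - X.damage s ω) (measurable_const.sub X.measurable_damage) t

/-- The filtration `ℱ t = σ(R s, s ≤ t)` generated by the uncontrolled level. -/
def Shocks.filtration (r : ℝ) : Filtration ℝ≥0 mΩ :=
  Filtration.natural (X.level r) fun t => (X.measurable_level r t).stronglyMeasurable

/-! ### Impulse controls -/

/-- An impulse control for the initial level `r`: intervention times `τ i` (with value `⊤` when
the intervention does not take place) and improvements `ζ i`. -/
structure ImpulseControl (r : ℝ) where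
  τ : ℕ → Ω → WithTop ℝ≥0
  ζ : ℕ → Ω → ℝ
  τ_le_succ : ∀ i, ∀ᵐ ω ∂P, τ i ω ≤ τ (i + 1) ω
  isStoppingTime : ∀ i, IsStoppingTime (X.filtration r) (τ i)
  measurable_ζ : ∀ i, Measurable[(isStoppingTime i).measurableSpace] (ζ i)
  tendsto_τ : ∀ᵐ ω ∂P, Tendsto (fun i => τ i ω) atTop (𝓝 ⊤)

variable {X} {r : ℝ} (ν : ImpulseControl X r)

open Classical in
/-- The controlled level:
`R t = r - ∫ s in 0..t, c (R s) - ∑ i < N t, S i + ∑ τ i < t, ζ i`. -/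
def ImpulseControl.level (t : ℝ≥0) (ω : Ω) : ℝ :=
  levelPath A.rate
    (fun s => r - X.damage s ω + ∑' i, if ν.τ i ω < (s : WithTop ℝ≥0) then ν.ζ i ω else 0) t

open Classical in
/-- The level that the `i`-th intervention finds: the controlled level at time `τ i`, raised by
the earlier interventions (if any) that take place at the same time. -/
def ImpulseControl.levelBefore (i : ℕ) (ω : Ω) : ℝ :=
  ν.level ((ν.τ i ω).untopD 0) ω
    + ∑ j ∈ Finset.range i, if ν.τ j ω = ν.τ i ω then ν.ζ j ω else 0

/-- The control keeps the level at most `M`: the `i`-th improvement lies in `[0, M - R]`, where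
`R` is the level that the `i`-th intervention finds. -/
def ImpulseControl.IsAdmissible : Prop :=
  ∀ᵐ ω ∂P, ∀ i, ν.τ i ω ≠ ⊤ → ν.ζ i ω ∈ Icc 0 (A.M - ν.levelBefore i ω)

/-- The time of total failure `inf {t ≥ 0 | R t < m}`, equal to `⊤` if there is no such `t`. -/
def ImpulseControl.failureTime (ω : Ω) : WithTop ℝ≥0 :=
  sInf ((fun t : ℝ≥0 => (t : WithTop ℝ≥0)) '' {t | ν.level t ω < A.m})

/-- Discounted benefit `∫ s in 0..failureTime, exp (-δ s) G (R s)`. -/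
def ImpulseControl.benefit (ω : Ω) : ℝ≥0∞ :=
  ∫⁻ s in {s : ℝ | 0 ≤ s ∧ (s.toNNReal : WithTop ℝ≥0) < ν.failureTime ω},
    ENNReal.ofReal (Real.exp (-A.δ * s) * A.G (ν.level s.toNNReal ω))

open Classical in
/-- Discounted cost `∑ τ i < failureTime, exp (-δ τ i) C (R (τ i), ζ i)` of the interventions. -/
def ImpulseControl.totalCost (ω : Ω) : ℝ≥0∞ :=
  ∑' i, if ν.τ i ω < ν.failureTime ω then
      ENNReal.ofReal (Real.exp (-A.δ * ((ν.τ i ω).untopD 0 : ℝ≥0))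
        * A.cost (ν.levelBefore i ω) (ν.ζ i ω))
    else 0

/-- Expected discounted profit `J(r, ν)`. The expected benefit is at most `G M / δ`, so that the
difference is meaningful; it is `⊥` if the expected cost is infinite. -/
def ImpulseControl.profit : EReal :=
  ((∫⁻ ω, ν.benefit ω ∂P : ℝ≥0∞) : EReal) - ((∫⁻ ω, ν.totalCost ω ∂P : ℝ≥0∞) : EReal)

/-- The value function `V(r) = sup J(r, ν)` over the admissible impulse controls. -/
def Shocks.value (X : Shocks A P) (r : ℝ) : EReal :=
  ⨆ ν : {ν : ImpulseControl X r // ν.IsAdmissible}, ν.1.profit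

end Probability

/-! ### Viscosity solutions -/

variable (A : MaintenanceModel)

/-- `𝒜 φ (r) = -c(r) φ'(r) + λ (∫ φ(r - s) dF(s) - φ(r))`, the integral being over
`0 ≤ s < r - m`. -/
def MaintenanceModel.generator (φ : ℝ → ℝ) (r : ℝ) : ℝ :=
  -A.c r * deriv φ r + A.lam * ((∫ s in Ico 0 (r - A.m), φ (r - s) ∂A.F) - φ r)

/-- `ℳ u (r) = sup (u(r + z) - H(r + z) + H(r) - k)` over `0 ≤ z ≤ M - r`. -/
def MaintenanceModel.intervention (u : ℝ → ℝ) (r : ℝ) : EReal :=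
  ⨆ z ∈ Icc 0 (A.M - r), ((u (r + z) - A.H (r + z) + A.H r - A.k : ℝ) : EReal)

/-- The left-hand side `min {δ φ - 𝒜 φ - G, u - ℳ u}` of the equation, with the test function
`φ` in the first-order term. -/
def MaintenanceModel.hjb (φ u : ℝ → ℝ) (r : ℝ) : EReal :=
  min ((A.δ * φ r - A.generator φ r - A.G r : ℝ) : EReal) ((u r : EReal) - A.intervention u r)

/-- Test functions at `r`: `φ ∈ C¹(m, M)` for which `𝒜 φ (r)` exists. -/
def MaintenanceModel.IsTest (φ : ℝ → ℝ) (r : ℝ) : Prop :=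
  ContDiffOn ℝ 1 φ (Ioo A.m A.M) ∧
    IntegrableOn (fun s => φ (r - s)) (Ico 0 (r - A.m)) A.F

/-- Viscosity subsolution on `[m, M]`. -/
def MaintenanceModel.IsViscositySubsolution (u : ℝ → ℝ) : Prop :=
  UpperSemicontinuousOn u (Icc A.m A.M) ∧
    ∀ (φ : ℝ → ℝ), ∀ r ∈ Ioo A.m A.M, A.IsTest φ r →
      IsMaxOn (fun x => u x - φ x) (Ioo A.m A.M) r → u r = φ r → A.hjb φ u r ≤ 0

/-- Viscosity supersolution on `[m, M]`. -/
def MaintenanceModel.IsViscositySupersolution (v : ℝ → ℝ) : Prop :=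
  LowerSemicontinuousOn v (Icc A.m A.M) ∧
    ∀ (φ : ℝ → ℝ), ∀ r ∈ Ioo A.m A.M, A.IsTest φ r →
      IsMinOn (fun x => v x - φ x) (Ioo A.m A.M) r → v r = φ r → 0 ≤ A.hjb φ v r

/-- Viscosity solution on `[m, M]`. -/
def MaintenanceModel.IsViscositySolution (f : ℝ → ℝ) : Prop :=
  A.IsViscositySubsolution f ∧ A.IsViscositySupersolution f

end ImpulseMaintenance

end

/-!
The value function is identified with the solution `W` of an obstacle problem, for which the viscosity
property can be checked directly.

Between two shocks the level moves down with the drift, so the dynamic programming principle for the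
time until the next shock is a problem on an interval. In the time scale of the remaining lifetime
`∫ y in m..x, 1 / c y` the drift has unit speed, and the principle says that `W` is a fixed point of a
monotone operator `obstacleOp`: move down for some time, collecting the benefit and the mean value
after the next shock, then intervene, or stop at the threshold `m`. The theorem of Knaster and Tarski
gives a fixed point (`exists_obstacleOp_eq`, `MaintenanceModel.exists_isCandidate`). Any fixed point
is continuous, since what an intervention yields can only jump downwards along the level, and it
satisfies three properties (`IsObstacleSolution`): interventions do not increase the value, the
drift does not increase the expected discounted value plus reward, and it conserves it where
interventions are strictly suboptimal. Comparison with a test function along the drift turns these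
into the two viscosity inequalities (`IsCandidate.isViscositySolution`).

It remains to see that `W` is the value function. Conditioning on the history of the shocks gives the
compensation formula `Shocks.lintegral_next_shock`, in which the next shock is integrated out with
its intensity and law. Before the next shock, an event of the filtration is an event of the history
(`Shocks.exists_hist_set`), and so every admissible control is in each stage between two shocks a
measurable function of the history. Adding the balance of `W` along the drift and the interventions of
a stage (`IsRegular.stage_balance`), taking expectations and summing over the stages, one finds that no
admissible control earns more than `W r` (`IsAdmissible.profit_le`), with equality if nothing is lost on
the way (`IsLossless`, `IsAdmissible.le_profit`).

Finally a lossless control is constructed: intervene as soon as the value `W` does not exceed that of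
an intervention, and raise the level to the largest optimal target (`Plan.control`). At a target the
value exceeds that of an intervention by the fixed cost `k > 0`, so that interventions do not
accumulate (`Plan.tendsto_hit`). Since the filtration is not assumed to be right-continuous, the
hitting times are shown to be stopping times by hand (`Plan.IsValid.nextTime_le_iff_countable`): they
are attained, and between two shocks the level is continuous, so that countably many times not later
than `t` decide whether the intervention has taken place by time `t`.
-/

noncomputable section

namespace ImpulseMaintenance

/-! ### An obstacle problem with impulses on an interval -/

section Obstacle

/-- The best net gain `sup (v z - h z)` over `z ∈ [u, L]`. -/
def bestTarget (L : ℝ) (h v : ℝ → ℝ) (u : ℝ) : ℝ := sSup ((fun z => v z - h z) '' Icc u L)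

/-- The discounted running reward `∫ exp (κ t) g t dt` over `(y, u]`; the lower integral keeps it
monotone in `g` without any measurability. -/
def runningReward (κ : ℝ) (g : ℝ → ℝ) (y u : ℝ) : ℝ :=
  (∫⁻ t in Ioc y u, ENNReal.ofReal (Real.exp (κ * t) * g t)).toReal

/-- The dynamic programming operator: from position `u` move down to some `y ≤ u`, collecting the
running reward, and then either intervene at `y` or, if `y = 0`, stop. -/
def obstacleOp (L κ k : ℝ) (h : ℝ → ℝ) (g : (ℝ → ℝ) → ℝ → ℝ) (v : ℝ → ℝ) (u : ℝ) : ℝ :=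
  Real.exp (-(κ * u)) * max (runningReward κ (g v) 0 u)
    (sSup ((fun y => Real.exp (κ * y) * (bestTarget L h v y + h y - k)
      + runningReward κ (g v) y u) '' Icc 0 u))

variable {L κ β k : ℝ} {h : ℝ → ℝ}

theorem lintegral_exp_mul_le {g : ℝ → ℝ} {y u : ℝ} (hyu : y ≤ u)
    (hg : ∀ t ∈ Ioc y u, g t ≤ κ * β) :
    ∫⁻ t in Ioc y u, ENNReal.ofReal (Real.exp (κ * t) * g t)
      ≤ ENNReal.ofReal (β * (Real.exp (κ * u) - Real.exp (κ * y))) := by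
  calc ∫⁻ t in Ioc y u, ENNReal.ofReal (Real.exp (κ * t) * g t)
      ≤ ∫⁻ t in Ioc y u, ENNReal.ofReal (Real.exp (κ * t) * (κ * β)) := by
        refine setLIntegral_mono' measurableSet_Ioc fun t ht => ENNReal.ofReal_le_ofReal ?_
        exact mul_le_mul_of_nonneg_left (hg t ht) (Real.exp_pos _).le
    _ ≤ ENNReal.ofReal (β * (Real.exp (κ * u) - Real.exp (κ * y))) := by
        by_cases hκβ : 0 ≤ κ * β
        · rw [← ofReal_integral_eq_lintegral_ofReal]
          · refine ENNReal.ofReal_le_ofReal (le_of_eq ?_)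
            rw [← intervalIntegral.integral_of_le hyu]
            have hd : ∀ t ∈ uIcc y u, HasDerivAt (fun t => β * Real.exp (κ * t))
                (Real.exp (κ * t) * (κ * β)) t := by
              intro t _
              have := (((hasDerivAt_id' t).const_mul κ).exp).const_mul β
              exact this.congr_deriv (by ring)
            rw [intervalIntegral.integral_eq_sub_of_hasDerivAt hd
              (Continuous.intervalIntegrable (by fun_prop) _ _)]
            ring
          · exact ((Continuous.integrableOn_Icc (by fun_prop)).mono_set Ioc_subset_Icc_self)
          · exact ae_of_all _ fun t => mul_nonneg (Real.exp_pos _).le hκβ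
        · have : ∀ t, ENNReal.ofReal (Real.exp (κ * t) * (κ * β)) = 0 := fun t =>
            ENNReal.ofReal_of_nonpos (mul_nonpos_of_nonneg_of_nonpos (Real.exp_pos _).le (by linarith))
          simp [this]

theorem runningReward_nonneg (g : ℝ → ℝ) (y u : ℝ) : 0 ≤ runningReward κ g y u :=
  ENNReal.toReal_nonneg

theorem runningReward_le (hκ : 0 < κ) (hβ : 0 ≤ β) {g : ℝ → ℝ} {y u : ℝ} (hyu : y ≤ u)
    (hg : ∀ t ∈ Ioc y u, g t ≤ κ * β) :
    runningReward κ g y u ≤ β * (Real.exp (κ * u) - Real.exp (κ * y)) := by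
  refine ENNReal.toReal_le_of_le_ofReal (mul_nonneg hβ (sub_nonneg.2 ?_))
    (lintegral_exp_mul_le hyu hg)
  exact Real.exp_le_exp.2 (by gcongr)

theorem runningReward_mono {g g' : ℝ → ℝ} {y u : ℝ} (hyu : y ≤ u)
    (hg : ∀ t ∈ Ioc y u, g t ≤ g' t) (hg' : ∀ t ∈ Ioc y u, g' t ≤ κ * β) :
    runningReward κ g y u ≤ runningReward κ g' y u := by
  refine ENNReal.toReal_mono
    (ne_top_of_le_ne_top ENNReal.ofReal_ne_top (lintegral_exp_mul_le hyu hg')) ?_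
  refine setLIntegral_mono' measurableSet_Ioc fun t ht => ENNReal.ofReal_le_ofReal ?_
  exact mul_le_mul_of_nonneg_left (hg t ht) (Real.exp_pos _).le

theorem runningReward_add {g : ℝ → ℝ} {x y u : ℝ} (hxy : x ≤ y) (hyu : y ≤ u)
    (hg : ∀ t ∈ Ioc x u, g t ≤ κ * β) :
    runningReward κ g x u = runningReward κ g x y + runningReward κ g y u := by
  rw [runningReward, runningReward, runningReward, ← ENNReal.toReal_add, ← Ioc_union_Ioc_eq_Ioc hxy hyu,
    lintegral_union measurableSet_Ioc]
  · rw [Set.disjoint_left]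
    intro t ht ht'
    exact absurd ht.2 (not_le.2 ht'.1)
  · exact ne_top_of_le_ne_top ENNReal.ofReal_ne_top
      (lintegral_exp_mul_le hxy fun t ht => hg t ⟨ht.1, ht.2.trans hyu⟩)
  · exact ne_top_of_le_ne_top ENNReal.ofReal_ne_top
      (lintegral_exp_mul_le hyu fun t ht => hg t ⟨hxy.trans_lt ht.1, ht.2⟩)

theorem runningReward_self (g : ℝ → ℝ) (u : ℝ) : runningReward κ g u u = 0 := by
  simp [runningReward]

section Target

variable {v : ℝ → ℝ}

theorem bestTarget_bddAbove (hh : MonotoneOn h (Icc 0 L))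
    (hv : ∀ u ∈ Icc 0 L, 0 ≤ v u ∧ v u ≤ β) {u : ℝ} (hu : u ∈ Icc 0 L) :
    BddAbove ((fun z => v z - h z) '' Icc u L) := by
  refine ⟨β - h u, ?_⟩
  rintro _ ⟨z, hz, rfl⟩
  have hz' : z ∈ Icc 0 L := ⟨hu.1.trans hz.1, hz.2⟩
  have := hh hu hz' hz.1
  have := (hv z hz').2
  simp only
  linarith

theorem le_bestTarget (hh : MonotoneOn h (Icc 0 L))
    (hv : ∀ u ∈ Icc 0 L, 0 ≤ v u ∧ v u ≤ β) {u z : ℝ} (hu : u ∈ Icc 0 L) (hz : z ∈ Icc u L) :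
    v z - h z ≤ bestTarget L h v u :=
  le_csSup (bestTarget_bddAbove hh hv hu) ⟨z, hz, rfl⟩

theorem bestTarget_le {u a : ℝ} (hu : u ≤ L) (ha : ∀ z ∈ Icc u L, v z - h z ≤ a) :
    bestTarget L h v u ≤ a := by
  refine csSup_le ((nonempty_Icc.2 hu).image _) ?_
  rintro _ ⟨z, hz, rfl⟩
  exact ha z hz

theorem bestTarget_add_le (hh : MonotoneOn h (Icc 0 L))
    (hv : ∀ u ∈ Icc 0 L, 0 ≤ v u ∧ v u ≤ β) {u : ℝ} (hu : u ∈ Icc 0 L) :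
    bestTarget L h v u + h u ≤ β := by
  suffices bestTarget L h v u ≤ β - h u by linarith
  refine bestTarget_le hu.2 fun z hz => ?_
  have hz' : z ∈ Icc 0 L := ⟨hu.1.trans hz.1, hz.2⟩
  have := hh hu hz' hz.1
  have := (hv z hz').2
  linarith

theorem bestTarget_antitone (hh : MonotoneOn h (Icc 0 L))
    (hv : ∀ u ∈ Icc 0 L, 0 ≤ v u ∧ v u ≤ β) {u u' : ℝ} (hu : u ∈ Icc 0 L) (hu' : u' ∈ Icc 0 L)
    (huu : u ≤ u') : bestTarget L h v u' ≤ bestTarget L h v u :=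
  bestTarget_le hu'.2 fun _ hz => le_bestTarget hh hv hu ⟨huu.trans hz.1, hz.2⟩

theorem bestTarget_mono {w : ℝ → ℝ} (hh : MonotoneOn h (Icc 0 L))
    (hw : ∀ u ∈ Icc 0 L, 0 ≤ w u ∧ w u ≤ β) (hvw : ∀ u ∈ Icc 0 L, v u ≤ w u)
    {u : ℝ} (hu : u ∈ Icc 0 L) : bestTarget L h v u ≤ bestTarget L h w u := by
  refine bestTarget_le hu.2 fun z hz => ?_
  have := le_bestTarget hh hw hu hz
  have := hvw z ⟨hu.1.trans hz.1, hz.2⟩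
  linarith

theorem bestTarget_continuousOn (hh : MonotoneOn h (Icc 0 L))
    (hv : ∀ u ∈ Icc 0 L, 0 ≤ v u ∧ v u ≤ β) (hc : ContinuousOn (fun z => v z - h z) (Icc 0 L)) :
    ContinuousOn (bestTarget L h v) (Icc 0 L) := by
  have huc := isCompact_Icc.uniformContinuousOn_of_continuous hc
  rw [Metric.uniformContinuousOn_iff] at huc
  have key : ∀ ε > 0, ∃ d > 0, ∀ u ∈ Icc 0 L, ∀ y ∈ Icc 0 u, u - y < d →
      bestTarget L h v y ≤ bestTarget L h v u + ε := by
    intro ε hε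
    obtain ⟨d, hd, hd'⟩ := huc ε hε
    refine ⟨d, hd, fun u hu y hy huy => bestTarget_le (hy.2.trans hu.2) fun z hz => ?_⟩
    rcases le_total u z with huz | hzu
    · have := le_bestTarget hh hv hu ⟨huz, hz.2⟩
      linarith
    · have h1 := hd' z ⟨hy.1.trans hz.1, hz.2⟩ u hu (by
        rw [Real.dist_eq, abs_sub_comm, abs_of_nonneg (by linarith)]; linarith [hz.1])
      rw [Real.dist_eq] at h1
      have h2 := le_bestTarget hh hv hu ⟨le_rfl, hu.2⟩
      have h3 := le_abs_self (v z - h z - (v u - h u))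
      linarith
  rw [Metric.continuousOn_iff]
  intro x hx ε hε
  obtain ⟨d, hd, hd'⟩ := key (ε / 2) (by positivity)
  refine ⟨d, hd, fun y hy hxy => ?_⟩
  rw [Real.dist_eq] at hxy ⊢
  rcases le_total y x with h | h
  · have h1 := hd' x hx y ⟨hy.1, h⟩ (by rw [abs_sub_comm] at hxy; exact (le_abs_self _).trans_lt hxy)
    have h2 := bestTarget_antitone hh hv hy hx h
    rw [abs_of_nonneg (by linarith)]; linarith
  · have h1 := hd' y hy x ⟨hx.1, h⟩ ((le_abs_self _).trans_lt hxy)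
    have h2 := bestTarget_antitone hh hv hx hy h
    rw [abs_sub_comm, abs_of_nonneg (by linarith)]; linarith

end Target

section Operator

variable {g : (ℝ → ℝ) → ℝ → ℝ}

theorem obstacle_image_le (hκ : 0 < κ) (hβ : 0 ≤ β) (hk : 0 < k) (hh : MonotoneOn h (Icc 0 L))
    (hgβ : ∀ v, (∀ u ∈ Icc 0 L, 0 ≤ v u ∧ v u ≤ β) → ∀ u ∈ Icc 0 L, g v u ≤ κ * β)
    {v : ℝ → ℝ} (hv : ∀ u ∈ Icc 0 L, 0 ≤ v u ∧ v u ≤ β) {u y : ℝ} (hu : u ∈ Icc 0 L)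
    (hy : y ∈ Icc 0 u) :
    Real.exp (κ * y) * (bestTarget L h v y + h y - k) + runningReward κ (g v) y u
      ≤ β * Real.exp (κ * u) := by
  have h1 := bestTarget_add_le hh hv ⟨hy.1, hy.2.trans hu.2⟩
  have h2 := runningReward_le hκ hβ hy.2 fun t ht =>
    hgβ v hv t ⟨hy.1.trans ht.1.le, ht.2.trans hu.2⟩
  have h3 : Real.exp (κ * y) * (bestTarget L h v y + h y - k) ≤ Real.exp (κ * y) * β :=
    mul_le_mul_of_nonneg_left (by linarith) (Real.exp_pos _).le
  linarith

theorem obstacleOp_nonneg (v : ℝ → ℝ) (u : ℝ) : 0 ≤ obstacleOp L κ k h g v u :=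
  mul_nonneg (Real.exp_pos _).le (le_max_of_le_left (runningReward_nonneg _ _ _))

theorem obstacleOp_le (hκ : 0 < κ) (hβ : 0 ≤ β) (hk : 0 < k) (hh : MonotoneOn h (Icc 0 L))
    (hgβ : ∀ v, (∀ u ∈ Icc 0 L, 0 ≤ v u ∧ v u ≤ β) → ∀ u ∈ Icc 0 L, g v u ≤ κ * β)
    {v : ℝ → ℝ} (hv : ∀ u ∈ Icc 0 L, 0 ≤ v u ∧ v u ≤ β) {u : ℝ} (hu : u ∈ Icc 0 L) :
    obstacleOp L κ k h g v u ≤ β := by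
  rw [obstacleOp, Real.exp_neg, inv_mul_le_iff₀ (Real.exp_pos _), mul_comm _ β]
  refine max_le ?_ (csSup_le ((nonempty_Icc.2 hu.1).image _) ?_)
  · have := runningReward_le hκ hβ hu.1 fun t ht => hgβ v hv t ⟨ht.1.le, ht.2.trans hu.2⟩
    have h0 : 0 ≤ β * Real.exp (κ * 0) := by positivity
    linarith
  · rintro _ ⟨y, hy, rfl⟩
    exact obstacle_image_le hκ hβ hk hh hgβ hv hu hy

theorem obstacleOp_mono (hκ : 0 < κ) (hβ : 0 ≤ β) (hk : 0 < k) (hh : MonotoneOn h (Icc 0 L))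
    (hg : ∀ v w, (∀ u ∈ Icc 0 L, 0 ≤ v u ∧ v u ≤ w u ∧ w u ≤ β) → ∀ u ∈ Icc 0 L, g v u ≤ g w u)
    (hgβ : ∀ v, (∀ u ∈ Icc 0 L, 0 ≤ v u ∧ v u ≤ β) → ∀ u ∈ Icc 0 L, g v u ≤ κ * β)
    {v w : ℝ → ℝ} (hvw : ∀ u ∈ Icc 0 L, 0 ≤ v u ∧ v u ≤ w u ∧ w u ≤ β) {u : ℝ}
    (hu : u ∈ Icc 0 L) : obstacleOp L κ k h g v u ≤ obstacleOp L κ k h g w u := by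
  have hw : ∀ u ∈ Icc 0 L, 0 ≤ w u ∧ w u ≤ β := fun u hu =>
    ⟨(hvw u hu).1.trans (hvw u hu).2.1, (hvw u hu).2.2⟩
  have hr : ∀ y ∈ Icc 0 u, runningReward κ (g v) y u ≤ runningReward κ (g w) y u := by
    intro y hy
    refine runningReward_mono (β := β) hy.2 (fun t ht => hg v w hvw t ?_)
      (fun t ht => hgβ w hw t ?_)
    · exact ⟨hy.1.trans ht.1.le, ht.2.trans hu.2⟩
    · exact ⟨hy.1.trans ht.1.le, ht.2.trans hu.2⟩
  refine mul_le_mul_of_nonneg_left (max_le_max (hr 0 ⟨le_rfl, hu.1⟩) ?_) (Real.exp_pos _).le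
  refine csSup_le ((nonempty_Icc.2 hu.1).image _) ?_
  rintro _ ⟨y, hy, rfl⟩
  refine le_trans ?_ (le_csSup ⟨β * Real.exp (κ * u), ?_⟩ ⟨y, hy, rfl⟩)
  · have h1 : bestTarget L h v y ≤ bestTarget L h w y :=
      bestTarget_mono hh hw (fun u hu => (hvw u hu).2.1) ⟨hy.1, hy.2.trans hu.2⟩
    have h2 := hr y hy
    simp only
    gcongr
  · rintro _ ⟨y', hy', rfl⟩
    exact obstacle_image_le hκ hβ hk hh hgβ hw hu hy'

/-- Knaster–Tarski: the supremum of all bounded post-fixed points of the monotone operator is a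
fixed point. -/
theorem exists_obstacleOp_eq (hκ : 0 < κ) (hβ : 0 ≤ β) (hk : 0 < k) (hh : MonotoneOn h (Icc 0 L))
    (hg : ∀ v w, (∀ u ∈ Icc 0 L, 0 ≤ v u ∧ v u ≤ w u ∧ w u ≤ β) → ∀ u ∈ Icc 0 L, g v u ≤ g w u)
    (hgβ : ∀ v, (∀ u ∈ Icc 0 L, 0 ≤ v u ∧ v u ≤ β) → ∀ u ∈ Icc 0 L, g v u ≤ κ * β) :
    ∃ w : ℝ → ℝ, (∀ u ∈ Icc 0 L, 0 ≤ w u ∧ w u ≤ β) ∧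
      ∀ u ∈ Icc 0 L, w u = obstacleOp L κ k h g w u := by
  set 𝒮 : Set (ℝ → ℝ) := {v | ∀ u ∈ Icc 0 L, 0 ≤ v u ∧ v u ≤ β ∧ v u ≤ obstacleOp L κ k h g v u}
  set w : ℝ → ℝ := fun u => sSup ((fun v : ℝ → ℝ => v u) '' 𝒮) with hwdef
  have h0 : (fun _ => 0 : ℝ → ℝ) ∈ 𝒮 := fun u _ => ⟨le_rfl, hβ, obstacleOp_nonneg _ _⟩
  have hbdd : ∀ u ∈ Icc 0 L, BddAbove ((fun v : ℝ → ℝ => v u) '' 𝒮) := by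
    refine fun u hu => ⟨β, ?_⟩
    rintro _ ⟨v, hv, rfl⟩
    exact (hv u hu).2.1
  have hle : ∀ v ∈ 𝒮, ∀ u ∈ Icc 0 L, v u ≤ w u := fun v hv u hu =>
    le_csSup (hbdd u hu) ⟨v, hv, rfl⟩
  have hw : ∀ u ∈ Icc 0 L, 0 ≤ w u ∧ w u ≤ β := by
    refine fun u hu => ⟨hle _ h0 u hu, csSup_le ⟨_, _, h0, rfl⟩ ?_⟩
    rintro _ ⟨v, hv, rfl⟩
    exact (hv u hu).2.1
  have hpost : ∀ u ∈ Icc 0 L, w u ≤ obstacleOp L κ k h g w u := by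
    refine fun u hu => csSup_le ⟨_, _, h0, rfl⟩ ?_
    rintro _ ⟨v, hv, rfl⟩
    refine (hv u hu).2.2.trans (obstacleOp_mono hκ hβ hk hh hg hgβ (fun t ht => ?_) hu)
    exact ⟨(hv t ht).1, hle v hv t ht, (hw t ht).2⟩
  refine ⟨w, hw, fun u hu => le_antisymm (hpost u hu) ?_⟩
  refine hle (obstacleOp L κ k h g w) (fun t ht => ?_) u hu
  refine ⟨obstacleOp_nonneg _ _, obstacleOp_le hκ hβ hk hh hgβ hw ht, ?_⟩
  exact obstacleOp_mono hκ hβ hk hh hg hgβ (fun s hs =>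
    ⟨(hw s hs).1, hpost s hs, obstacleOp_le hκ hβ hk hh hgβ hw hs⟩) ht

end Operator

/-- The impulse obstacle problem on `[0, L]` for a running reward `g`: `w` dominates what an
intervention yields, the discounted value plus collected reward does not decrease when the
position drifts down, and it is conserved as long as interventions are strictly suboptimal. -/
structure IsObstacleSolution (L κ β k : ℝ) (h g w : ℝ → ℝ) : Prop where
  continuousOn : ContinuousOn w (Icc 0 L)
  nonneg : ∀ u ∈ Icc 0 L, 0 ≤ w u
  le_bound : ∀ u ∈ Icc 0 L, w u ≤ β
  obstacle_le : ∀ u ∈ Icc 0 L, bestTarget L h w u + h u - k ≤ w u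
  drift_le : ∀ u ∈ Icc 0 L, ∀ y ∈ Icc 0 u,
    Real.exp (κ * y) * w y + runningReward κ g y u ≤ Real.exp (κ * u) * w u
  drift_eq : ∀ u ∈ Icc 0 L, ∀ y ∈ Icc 0 u,
    (∀ z ∈ Ioc y u, bestTarget L h w z + h z - k < w z) →
      Real.exp (κ * y) * w y + runningReward κ g y u = Real.exp (κ * u) * w u
  boundary : bestTarget L h w 0 + h 0 - k < w 0 → w 0 = 0

/-- A fixed point of the dynamic programming operator is continuous: `exp (κ u) w u` minus the
collected reward is a running maximum of functions which can only jump downwards, as the best net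
gain decreases in the position. -/
theorem isObstacleSolution_of_fixedPoint (hL : 0 ≤ L) (hκ : 0 < κ) (hβ : 0 ≤ β) (hk : 0 < k)
    (hh : MonotoneOn h (Icc 0 L)) (hhc : ContinuousOn h (Icc 0 L)) {g : (ℝ → ℝ) → ℝ → ℝ}
    (hgβ : ∀ v, (∀ u ∈ Icc 0 L, 0 ≤ v u ∧ v u ≤ β) → ∀ u ∈ Icc 0 L, g v u ≤ κ * β)
    {w : ℝ → ℝ} (hw : ∀ u ∈ Icc 0 L, 0 ≤ w u ∧ w u ≤ β)
    (hfix : ∀ u ∈ Icc 0 L, w u = obstacleOp L κ k h g w u) :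
    IsObstacleSolution L κ β k h (g w) w := by
  set P : ℝ → ℝ := fun u => runningReward κ (g w) 0 u with hP
  set S : ℝ → ℝ := bestTarget L h w with hS
  set θ : ℝ → ℝ := fun y => Real.exp (κ * y) * (S y + h y - k) - P y with hθ
  set U : ℝ → ℝ := fun u => Real.exp (κ * u) * w u - P u with hU
  have hadd : ∀ u ∈ Icc 0 L, ∀ y ∈ Icc 0 u, runningReward κ (g w) y u = P u - P y := by
    intro u hu y hy
    have := runningReward_add (κ := κ) (β := β) (g := g w) hy.1 hy.2
      fun t ht => hgβ w hw t ⟨ht.1.le, ht.2.trans hu.2⟩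
    simp only [hP]
    linarith
  have hbd : ∀ u ∈ Icc 0 L, BddAbove ((fun y => Real.exp (κ * y) * (S y + h y - k)
      + runningReward κ (g w) y u) '' Icc 0 u) := by
    refine fun u hu => ⟨β * Real.exp (κ * u), ?_⟩
    rintro _ ⟨y', hy', rfl⟩
    exact obstacle_image_le hκ hβ hk hh hgβ hw hu hy'
  have hEw : ∀ u ∈ Icc 0 L, Real.exp (κ * u) * w u = max (P u)
      (sSup ((fun y => Real.exp (κ * y) * (S y + h y - k)
      + runningReward κ (g w) y u) '' Icc 0 u)) := by
    intro u hu
    rw [hfix u hu, obstacleOp, ← mul_assoc, ← Real.exp_add]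
    simp [hP, hS]
  -- `U` is the running maximum of `θ` and `0`
  have hU0 : ∀ u ∈ Icc 0 L, 0 ≤ U u := fun u hu => by
    have := le_max_left (P u) (sSup ((fun y => Real.exp (κ * y) * (S y + h y - k)
      + runningReward κ (g w) y u) '' Icc 0 u))
    rw [← hEw u hu] at this
    simp only [hU]; linarith
  have hθU : ∀ u ∈ Icc 0 L, ∀ y ∈ Icc 0 u, θ y ≤ U u := fun u hu y hy => by
    have h1 := le_csSup (hbd u hu) ⟨y, hy, rfl⟩
    have := h1.trans (le_max_right (P u) _)
    rw [← hEw u hu] at this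
    simp only [hadd u hu y hy] at this
    simp only [hU, hθ]; linarith
  have hUle : ∀ u ∈ Icc 0 L, ∀ a, 0 ≤ a → (∀ y ∈ Icc 0 u, θ y ≤ a) → U u ≤ a := by
    intro u hu a ha h
    have : Real.exp (κ * u) * w u ≤ P u + a := by
      rw [hEw u hu]
      refine max_le (by linarith) (csSup_le ((nonempty_Icc.2 hu.1).image _) ?_)
      rintro _ ⟨y, hy, rfl⟩
      simp only [hadd u hu y hy]
      have := h y hy
      simp only [hθ] at this
      linarith
    simp only [hU]; linarith
  have hUmono : ∀ u ∈ Icc 0 L, ∀ y ∈ Icc 0 u, U y ≤ U u := fun u hu y hy =>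
    hUle y ⟨hy.1, hy.2.trans hu.2⟩ _ (hU0 u hu) fun z hz => hθU u hu z ⟨hz.1, hz.2.trans hy.2⟩
  have hUstep : ∀ u ∈ Icc 0 L, ∀ y ∈ Icc 0 u, ∀ a, (∀ z ∈ Icc y u, θ z ≤ a) →
      U u ≤ max (U y) a := by
    intro u hu y hy a ha
    have hy' : y ∈ Icc 0 L := ⟨hy.1, hy.2.trans hu.2⟩
    refine hUle u hu _ (le_max_of_le_left (hU0 y hy')) fun z hz => ?_
    rcases le_total z y with h | h
    · exact le_max_of_le_left (hθU y hy' z ⟨hz.1, h⟩)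
    · exact le_max_of_le_right (ha z ⟨h, hz.2⟩)
  -- continuity of the collected reward
  have hPlip : ∀ u ∈ Icc 0 L, ∀ y ∈ Icc 0 u,
      |P u - P y| ≤ β * (Real.exp (κ * u) - Real.exp (κ * y)) := fun u hu y hy => by
    rw [← hadd u hu y hy, abs_of_nonneg (runningReward_nonneg _ _ _)]
    exact runningReward_le hκ hβ hy.2 fun t ht =>
      hgβ w hw t ⟨hy.1.trans ht.1.le, ht.2.trans hu.2⟩
  have hPc : ContinuousOn P (Icc 0 L) := by
    intro x hx
    have hle : ∀ y ∈ Icc 0 L, dist (P y) (P x) ≤ β * |Real.exp (κ * y) - Real.exp (κ * x)| := by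
      intro y hy
      rw [Real.dist_eq]
      rcases le_total y x with h | h
      · rw [abs_sub_comm, abs_sub_comm (Real.exp _)]
        exact (hPlip x hx y ⟨hy.1, h⟩).trans (mul_le_mul_of_nonneg_left (le_abs_self _) hβ)
      · exact (hPlip y hy x ⟨hx.1, h⟩).trans (mul_le_mul_of_nonneg_left (le_abs_self _) hβ)
    rw [ContinuousWithinAt, tendsto_iff_dist_tendsto_zero]
    refine squeeze_zero' (Eventually.of_forall fun _ => dist_nonneg)
      (eventually_nhdsWithin_of_forall hle) ?_
    have hc : Continuous fun y => β * |Real.exp (κ * y) - Real.exp (κ * x)| := by fun_prop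
    have := hc.continuousWithinAt (s := Icc 0 L) (x := x)
    simpa [ContinuousWithinAt] using this
  set q : ℝ → ℝ := fun y => Real.exp (κ * y) * (h y - k) - P y with hq
  have hqc : ContinuousOn q (Icc 0 L) := by
    refine ContinuousOn.sub (ContinuousOn.mul (by fun_prop) (hhc.sub continuousOn_const)) hPc
  have hL0 : (0 : ℝ) ∈ Icc 0 L := ⟨le_rfl, hL⟩
  have hLL : L ∈ Icc 0 L := ⟨hL, le_rfl⟩
  have hSb : ∃ C, 0 ≤ C ∧ ∀ u ∈ Icc 0 L, |S u| ≤ C := by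
    refine ⟨max |S 0| |S L|, by positivity, fun u hu => (abs_le_max_abs_abs
      (bestTarget_antitone hh hw hu hLL hu.2)
      (bestTarget_antitone hh hw hL0 hu hu.1)).trans (by rw [max_comm])⟩
  obtain ⟨C, hC0, hC⟩ := hSb
  have hθstep : ∀ z ∈ Icc 0 L, ∀ y ∈ Icc 0 z,
      θ z ≤ θ y + (C * (Real.exp (κ * z) - Real.exp (κ * y)) + |q z - q y|) := by
    intro z hz y hy
    have hy' : y ∈ Icc 0 L := ⟨hy.1, hy.2.trans hz.2⟩
    have h1 : S z ≤ S y := bestTarget_antitone hh hw hy' hz hy.2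
    have h2 : 0 ≤ Real.exp (κ * z) - Real.exp (κ * y) :=
      sub_nonneg.2 (Real.exp_le_exp.2 (mul_le_mul_of_nonneg_left hy.2 hκ.le))
    have h3 := mul_le_mul_of_nonneg_left ((le_abs_self _).trans (hC y hy')) h2
    have h4 := mul_le_mul_of_nonneg_left h1 (Real.exp_pos (κ * z)).le
    have h5 := le_abs_self (q z - q y)
    simp only [hθ]
    simp only [hq] at h5 ⊢
    linarith
  have hUc : ContinuousOn U (Icc 0 L) := by
    have huc : UniformContinuousOn (fun y => (Real.exp (κ * y), q y)) (Icc 0 L) :=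
      isCompact_Icc.uniformContinuousOn_of_continuous
        (ContinuousOn.prodMk (by fun_prop) hqc)
    rw [Metric.uniformContinuousOn_iff] at huc
    have key : ∀ ε > 0, ∃ d > 0, ∀ u ∈ Icc 0 L, ∀ y ∈ Icc 0 u, u - y < d → U u < U y + ε := by
      intro ε hε
      obtain ⟨d, hd, hd'⟩ := huc (ε / (2 * (C + 1))) (by positivity)
      refine ⟨d, hd, fun u hu y hy huy => ?_⟩
      have hy' : y ∈ Icc 0 L := ⟨hy.1, hy.2.trans hu.2⟩
      have := hUstep u hu y hy (U y + ε / 2) fun z hz => ?_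
      · refine this.trans_lt (max_lt (by linarith) (by linarith))
      · have hz' : z ∈ Icc 0 L := ⟨hy.1.trans hz.1, hz.2.trans hu.2⟩
        have h1 := hθstep z hz' y ⟨hy.1, hz.1⟩
        have h2 := hθU y hy' y ⟨hy.1, le_rfl⟩
        have h3 := hd' z hz' y hy' (by
          rw [Real.dist_eq, abs_of_nonneg (by linarith [hz.1])]; linarith [hz.2])
        rw [Prod.dist_eq, max_lt_iff, Real.dist_eq, Real.dist_eq] at h3
        have h4 : C * (Real.exp (κ * z) - Real.exp (κ * y)) ≤ C * (ε / (2 * (C + 1))) :=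
          mul_le_mul_of_nonneg_left ((le_abs_self _).trans h3.1.le) hC0
        have h5 : C * (ε / (2 * (C + 1))) + ε / (2 * (C + 1)) = ε / 2 := by field_simp
        linarith [h3.2]
    rw [Metric.continuousOn_iff]
    intro x hx ε hε
    obtain ⟨d, hd, hd'⟩ := key ε hε
    refine ⟨d, hd, fun y hy hxy => ?_⟩
    rw [Real.dist_eq] at hxy ⊢
    rcases le_total y x with h | h
    · have h1 := hd' x hx y ⟨hy.1, h⟩ (by rw [abs_sub_comm] at hxy; exact (le_abs_self _).trans_lt hxy)
      have h2 := hUmono x hx y ⟨hy.1, h⟩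
      rw [abs_sub_comm, abs_of_nonneg (by linarith)]; linarith
    · have h1 := hd' y hy x ⟨hx.1, h⟩ ((le_abs_self _).trans_lt hxy)
      have h2 := hUmono y hy x ⟨hx.1, h⟩
      rw [abs_of_nonneg (by linarith)]; linarith
  have hwc : ContinuousOn w (Icc 0 L) := by
    have : ContinuousOn (fun u => Real.exp (-(κ * u)) * (U u + P u)) (Icc 0 L) :=
      ContinuousOn.mul (by fun_prop) (hUc.add hPc)
    refine this.congr fun u _ => ?_
    simp only [hU, sub_add_cancel]
    rw [← mul_assoc, ← Real.exp_add]; simp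
  have hθw : ∀ u, S u + h u - k < w u → θ u < U u := fun u h => by
    simp only [hθ, hU]
    have := mul_lt_mul_of_pos_left h (Real.exp_pos (κ * u))
    linarith
  refine ⟨hwc, fun u hu => (hw u hu).1, fun u hu => (hw u hu).2, fun u hu => ?_,
    fun u hu y hy => ?_, fun u hu y hy hlt => ?_, fun hlt => ?_⟩
  · have := hθU u hu u ⟨hu.1, le_rfl⟩
    simp only [hθ, hU] at this
    exact le_of_mul_le_mul_left (by linarith) (Real.exp_pos (κ * u))
  · rw [hadd u hu y hy]
    have := hUmono u hu y hy
    simp only [hU] at this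
    linarith
  · rw [hadd u hu y hy]
    suffices U y = U u by simp only [hU] at this; linarith
    refine le_antisymm (hUmono u hu y hy) ?_
    by_contra! hcon
    have hsub : Icc y u ⊆ Icc 0 L := Icc_subset_Icc hy.1 hu.2
    have hθc : ContinuousOn θ (Icc 0 L) := ContinuousOn.sub (ContinuousOn.mul (by fun_prop)
      (((bestTarget_continuousOn hh hw (hwc.sub hhc)).add hhc).sub continuousOn_const)) hPc
    obtain ⟨z, hz, hzmax⟩ := isCompact_Icc.exists_isMaxOn (nonempty_Icc.2 hy.2) (hθc.mono hsub)
    have h1 : U u ≤ θ z := by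
      have := hUstep u hu y hy (θ z) fun t ht => hzmax ht
      rcases le_max_iff.1 this with h | h
      · exact absurd h (not_le.2 hcon)
      · exact h
    have h2 : y < z := by
      rcases hz.1.eq_or_lt with h | h
      · rw [← h] at h1
        exact absurd (h1.trans (hθU y ⟨hy.1, hy.2.trans hu.2⟩ y ⟨hy.1, le_rfl⟩)) (not_le.2 hcon)
      · exact h
    have h3 := hθw z (hlt z ⟨h2, hz.2⟩)
    have h4 := hUmono u hu z ⟨hy.1.trans hz.1, hz.2⟩
    linarith
  · have h00 := hθw 0 hlt
    have h1 : U 0 ≤ max 0 (θ 0) := hUle 0 hL0 _ (le_max_left _ _) fun y hy => by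
      obtain rfl : y = 0 := le_antisymm hy.2 hy.1
      exact le_max_right _ _
    have h2 : U 0 ≤ 0 := by
      rcases le_max_iff.1 h1 with h | h
      · exact h
      · linarith
    have h3 := hU0 0 hL0
    have hP0 : P 0 = 0 := runningReward_self _ _
    simp only [hU, hP0] at h2 h3
    simpa using le_antisymm h2 h3

end Obstacle

/-! ### Changing the discount rate -/

section Discount

/-- The loss along the drift, computed with the discount rate `l + d`, determines the loss computed
with the discount rate `d`, the difference being moved into the running reward. -/
theorem discount_change {a b l d : ℝ} {w g : ℝ → ℝ} (hab : a ≤ b)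
    (hw : ContinuousOn w (Icc a b)) (hg : IntervalIntegrable g volume a b) :
    Real.exp (d * b) * w b - Real.exp (d * a) * w a
        - ∫ t in a..b, Real.exp (d * t) * (g t - l * w t)
      = Real.exp (-(l * b)) * (Real.exp ((l + d) * b) * w b - Real.exp ((l + d) * a) * w a
          - ∫ t in a..b, Real.exp ((l + d) * t) * g t)
        + ∫ t in a..b, l * Real.exp (-(l * t)) * (Real.exp ((l + d) * t) * w t
          - Real.exp ((l + d) * a) * w a - ∫ s in a..t, Real.exp ((l + d) * s) * g s) := by
  set p : ℝ → ℝ := fun t => ∫ s in a..t, Real.exp ((l + d) * s) * g s with hp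
  have hwi : IntervalIntegrable w volume a b := by
    rw [← uIcc_of_le hab] at hw
    exact hw.intervalIntegrable
  have hG : IntervalIntegrable (fun s => Real.exp ((l + d) * s) * g s) volume a b :=
    hg.continuousOn_mul (Continuous.continuousOn (by fun_prop))
  have hpAC : AbsolutelyContinuousOnInterval p a b :=
    hG.absolutelyContinuousOnInterval_intervalIntegral (by simp)
  have heAC : AbsolutelyContinuousOnInterval (fun t => Real.exp (-(l * t))) a b :=
    ContDiffOn.absolutelyContinuousOnInterval (ContDiff.contDiffOn (by fun_prop))
  have hparts := heAC.integral_mul_deriv_eq_deriv_mul hpAC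
  have hde : ∀ t, HasDerivAt (fun t => Real.exp (-(l * t))) (-(l * Real.exp (-(l * t)))) t :=
    fun t => by
    have h := ((hasDerivAt_id' t).const_mul (-l)).exp
    simp only [neg_mul, mul_one] at h
    exact h.congr_deriv (by ring)
  have hd : ∀ t, deriv (fun t => Real.exp (-(l * t))) t = -(l * Real.exp (-(l * t))) :=
    fun t => (hde t).deriv
  have h1 : ∫ t in a..b, Real.exp (-(l * t)) * deriv p t = ∫ t in a..b, Real.exp (d * t) * g t := by
    refine intervalIntegral.integral_congr_ae ?_
    filter_upwards [hG.ae_hasDerivAt_integral] with t ht hta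
    rw [(ht (uIoc_subset_uIcc hta) a (by simp)).deriv, ← mul_assoc, ← Real.exp_add]
    congr 2; ring
  have hpc : IntervalIntegrable p volume a b := hpAC.continuousOn.intervalIntegrable
  have h2 : ∫ t in a..b, l * Real.exp (-(l * t)) * p t
      = (∫ t in a..b, Real.exp (d * t) * g t) - Real.exp (-(l * b)) * p b := by
    have h3 : ∫ t in a..b, deriv (fun t => Real.exp (-(l * t))) t * p t
        = - ∫ t in a..b, l * Real.exp (-(l * t)) * p t := by
      rw [← intervalIntegral.integral_neg]
      refine intervalIntegral.integral_congr fun t _ => ?_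
      simp only [hd]; ring
    have hpa : p a = 0 := by simp [hp]
    rw [h1, h3, hpa] at hparts
    linarith
  have hi1 : IntervalIntegrable (fun t => l * Real.exp (-(l * t)) * p t) volume a b :=
    hpc.continuousOn_mul (Continuous.continuousOn (by fun_prop))
  have hi2 : IntervalIntegrable (fun t => l * Real.exp (d * t) * w t) volume a b :=
    hwi.continuousOn_mul (Continuous.continuousOn (by fun_prop))
  have hi3 : IntervalIntegrable (fun t => l * Real.exp (-(l * t))) volume a b :=
    Continuous.intervalIntegrable (by fun_prop) _ _
  have hi4 : IntervalIntegrable (fun t => Real.exp (d * t) * g t) volume a b :=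
    hg.continuousOn_mul (Continuous.continuousOn (by fun_prop))
  have h4 : ∫ t in a..b, l * Real.exp (-(l * t)) * (Real.exp ((l + d) * t) * w t
      - Real.exp ((l + d) * a) * w a - p t)
      = (∫ t in a..b, l * Real.exp (d * t) * w t)
        - (∫ t in a..b, l * Real.exp (-(l * t))) * (Real.exp ((l + d) * a) * w a)
        - ∫ t in a..b, l * Real.exp (-(l * t)) * p t := by
    rw [← intervalIntegral.integral_mul_const,
      ← intervalIntegral.integral_sub hi2 (hi3.mul_const _),
      ← intervalIntegral.integral_sub (hi2.sub (hi3.mul_const _)) hi1]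
    refine intervalIntegral.integral_congr fun t _ => ?_
    have : Real.exp (d * t) = Real.exp (-(l * t)) * Real.exp ((l + d) * t) := by
      rw [← Real.exp_add]; congr 1; ring
    simp only [this]
    ring
  have h5 : ∫ t in a..b, l * Real.exp (-(l * t)) = Real.exp (-(l * a)) - Real.exp (-(l * b)) := by
    have hd' : ∀ t ∈ uIcc a b, HasDerivAt (fun t => -Real.exp (-(l * t)))
        (l * Real.exp (-(l * t))) t := fun t _ => (hde t).neg.congr_deriv (by ring)
    rw [intervalIntegral.integral_eq_sub_of_hasDerivAt hd' hi3]
    ring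
  have h6 : ∫ t in a..b, Real.exp (d * t) * (g t - l * w t)
      = (∫ t in a..b, Real.exp (d * t) * g t) - ∫ t in a..b, l * Real.exp (d * t) * w t := by
    rw [← intervalIntegral.integral_sub hi4 hi2]
    refine intervalIntegral.integral_congr fun t _ => ?_
    ring
  have e1 : Real.exp (-(l * b)) * Real.exp ((l + d) * b) = Real.exp (d * b) := by
    rw [← Real.exp_add]; congr 1; ring
  have e2 : Real.exp (-(l * a)) * Real.exp ((l + d) * a) = Real.exp (d * a) := by
    rw [← Real.exp_add]; congr 1; ring
  rw [h4, h2, h5, h6, ← e1, ← e2]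
  simp only [hp]
  ring

variable {L κ β k : ℝ} {h g w : ℝ → ℝ}

theorem runningReward_eq_integral {y u : ℝ} (hyu : y ≤ u) (hg0 : ∀ t ∈ Icc y u, 0 ≤ g t)
    (hg : IntervalIntegrable g volume y u) :
    runningReward κ g y u = ∫ t in y..u, Real.exp (κ * t) * g t := by
  have hG : IntervalIntegrable (fun s => Real.exp (κ * s) * g s) volume y u :=
    hg.continuousOn_mul (Continuous.continuousOn (by fun_prop))
  rw [runningReward, intervalIntegral.integral_of_le hyu, ← ofReal_integral_eq_lintegral_ofReal,
    ENNReal.toReal_ofReal]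
  · exact setIntegral_nonneg measurableSet_Ioc fun t ht =>
      mul_nonneg (Real.exp_pos _).le (hg0 t (Ioc_subset_Icc_self ht))
  · exact (intervalIntegrable_iff_integrableOn_Ioc_of_le hyu).1 hG
  · exact (ae_restrict_iff' measurableSet_Ioc).2 (ae_of_all _ fun t ht =>
      mul_nonneg (Real.exp_pos _).le (hg0 t (Ioc_subset_Icc_self ht)))

namespace IsObstacleSolution

variable {l d : ℝ}

/-- The discounted value plus collected reward does not decrease along the drift; here the mean of
the value after the next shock is part of `g`, and the chance `l` of a shock is a loss instead of a
part of the discount rate. -/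
theorem loss_nonneg (hsol : IsObstacleSolution L (l + d) β k h g w) (hl : 0 ≤ l)
    (hg0 : ∀ t ∈ Icc 0 L, 0 ≤ g t) (hg : IntervalIntegrable g volume 0 L)
    {u y : ℝ} (hu : u ∈ Icc 0 L) (hy : y ∈ Icc 0 u) :
    Real.exp (d * y) * w y + ∫ t in y..u, Real.exp (d * t) * (g t - l * w t)
      ≤ Real.exp (d * u) * w u := by
  have hsub : Icc y u ⊆ Icc 0 L := Icc_subset_Icc hy.1 hu.2
  have hg' : IntervalIntegrable g volume y u := hg.mono_set (by
    rw [uIcc_of_le hy.2, uIcc_of_le (hu.1.trans hu.2)]; exact hsub)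
  have key : ∀ t ∈ Icc y u, 0 ≤ Real.exp ((l + d) * t) * w t - Real.exp ((l + d) * y) * w y
      - ∫ s in y..t, Real.exp ((l + d) * s) * g s := fun t ht => by
    have := hsol.drift_le t (hsub ht) y ⟨hy.1, ht.1⟩
    rw [runningReward_eq_integral ht.1 (fun s hs => hg0 s (hsub ⟨hs.1, hs.2.trans ht.2⟩))
      (hg'.mono_set (by
        rw [uIcc_of_le ht.1, uIcc_of_le hy.2]; exact Icc_subset_Icc_right ht.2))] at this
    linarith
  have hid := discount_change (l := l) (d := d) hy.2 (hsol.continuousOn.mono hsub) hg'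
  have h1 := mul_nonneg (Real.exp_pos (-(l * u))).le (key u ⟨hy.2, le_rfl⟩)
  have h2 : 0 ≤ ∫ t in y..u, l * Real.exp (-(l * t)) * (Real.exp ((l + d) * t) * w t
          - Real.exp ((l + d) * y) * w y - ∫ s in y..t, Real.exp ((l + d) * s) * g s) :=
    intervalIntegral.integral_nonneg hy.2 fun t ht =>
      mul_nonneg (mul_nonneg hl (Real.exp_pos _).le) (key t ht)
  linarith

/-- Equality in `loss_nonneg` needs strict suboptimality of interventions in the interior only, as
both sides are continuous. -/
theorem loss_eq_zero (hsol : IsObstacleSolution L (l + d) β k h g w)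
    (hg0 : ∀ t ∈ Icc 0 L, 0 ≤ g t) (hg : IntervalIntegrable g volume 0 L)
    {u y : ℝ} (hu : u ∈ Icc 0 L) (hy : y ∈ Icc 0 u)
    (hlt : ∀ z ∈ Ioo y u, bestTarget L h w z + h z - k < w z) :
    Real.exp (d * y) * w y + ∫ t in y..u, Real.exp (d * t) * (g t - l * w t)
      = Real.exp (d * u) * w u := by
  have hsub : Icc y u ⊆ Icc 0 L := Icc_subset_Icc hy.1 hu.2
  have hg' : IntervalIntegrable g volume y u := hg.mono_set (by
    rw [uIcc_of_le hy.2, uIcc_of_le (hu.1.trans hu.2)]; exact hsub)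
  set Δ : ℝ → ℝ := fun t => Real.exp ((l + d) * t) * w t - Real.exp ((l + d) * y) * w y
      - ∫ s in y..t, Real.exp ((l + d) * s) * g s with hΔ
  have key : ∀ t ∈ Ico y u, Δ t = 0 := fun t ht => by
    have := hsol.drift_eq t (hsub (Ico_subset_Icc_self ht)) y ⟨hy.1, ht.1⟩
      fun z hz => hlt z ⟨hz.1, hz.2.trans_lt ht.2⟩
    rw [runningReward_eq_integral ht.1 (fun s hs => hg0 s (hsub ⟨hs.1, hs.2.trans ht.2.le⟩))
      (hg'.mono_set (by
        rw [uIcc_of_le ht.1, uIcc_of_le hy.2]; exact Icc_subset_Icc_right ht.2.le))] at this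
    simp only [hΔ]
    linarith
  have hG : IntervalIntegrable (fun s => Real.exp ((l + d) * s) * g s) volume y u :=
    hg'.continuousOn_mul (Continuous.continuousOn (by fun_prop))
  have hΔc : ContinuousOn Δ (Icc y u) := by
    refine ((ContinuousOn.mul (by fun_prop) (hsol.continuousOn.mono hsub)).sub
      continuousOn_const).sub ?_
    rw [← uIcc_of_le hy.2]
    exact intervalIntegral.continuousOn_primitive_interval
      ((intervalIntegrable_iff_integrableOn_Icc_of_le hy.2).1 hG |>.mono_set
        (by rw [uIcc_of_le hy.2]))
  have keyu : Δ u = 0 := by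
    rcases hy.2.eq_or_lt with h | h
    · simp [hΔ, ← h]
    · have h1 : Tendsto Δ (𝓝[<] u) (𝓝 (Δ u)) :=
        ((hΔc u ⟨hy.2, le_rfl⟩).mono_left (nhdsWithin_le_of_mem (Icc_mem_nhdsLT h)))
      refine tendsto_nhds_unique h1 (tendsto_const_nhds.congr' ?_)
      filter_upwards [Ico_mem_nhdsLT h] with t ht
      exact (key t ht).symm
  have hid := discount_change (l := l) (d := d) hy.2 (hsol.continuousOn.mono hsub) hg'
  have h2 : ∫ t in y..u, l * Real.exp (-(l * t)) * Δ t = 0 := by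
    rw [intervalIntegral.integral_congr (g := fun _ => (0 : ℝ))]
    · simp
    · intro t ht
      rw [uIcc_of_le hy.2] at ht
      rcases ht.2.eq_or_lt with h | h
      · simp only [h, keyu, mul_zero]
      · simp only [key t ⟨ht.1, h⟩, mul_zero]
  have h3 : Real.exp ((l + d) * u) * w u - Real.exp ((l + d) * y) * w y
      - ∫ s in y..u, Real.exp ((l + d) * s) * g s = 0 := keyu
  simp only [hΔ] at h2
  rw [h2, h3] at hid
  linarith

end IsObstacleSolution

end Discount

/-! ### The drift in the time scale of the remaining lifetime -/

namespace MaintenanceModel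

variable (A : MaintenanceModel)

theorem rate_pos (x : ℝ) : 0 < A.rate x := A.c_pos _ (A.clamp_mem x)

theorem rate_le (x : ℝ) : A.rate x ≤ A.c A.m := (le_abs_self _).trans (A.abs_rate_le x)

theorem rate_of_mem {x : ℝ} (hx : x ∈ Icc A.m A.M) : A.rate x = A.c x := by
  rw [rate, min_eq_left hx.2, max_eq_right hx.1]

theorem continuous_rate : Continuous A.rate := by
  obtain ⟨L, hL⟩ := A.exists_lipschitzWith_rate
  exact hL.continuous

theorem continuous_inv_rate : Continuous fun y => (A.rate y)⁻¹ :=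
  A.continuous_rate.inv₀ fun x => (A.rate_pos x).ne'

/-- The time in which the drift alone takes the level from `x` down to the threshold `m` (negative
below the threshold). -/
def lifetime (x : ℝ) : ℝ := ∫ y in A.m..x, (A.rate y)⁻¹

theorem hasDerivAt_lifetime (x : ℝ) : HasDerivAt A.lifetime (A.rate x)⁻¹ x :=
  A.continuous_inv_rate.integral_hasStrictDerivAt A.m x |>.hasDerivAt

theorem continuous_lifetime : Continuous A.lifetime :=
  continuous_iff_continuousAt.2 fun x => (A.hasDerivAt_lifetime x).continuousAt

theorem strictMono_lifetime : StrictMono A.lifetime :=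
  strictMono_of_deriv_pos fun x => by
    rw [(A.hasDerivAt_lifetime x).deriv]; exact inv_pos.2 (A.rate_pos x)

theorem lifetime_sub_ge {x y : ℝ} (hxy : x ≤ y) :
    (A.c A.m)⁻¹ * (y - x) ≤ A.lifetime y - A.lifetime x := by
  refine Convex.mul_sub_le_image_sub_of_le_deriv convex_univ
    A.continuous_lifetime.continuousOn
    (fun z _ => (A.hasDerivAt_lifetime z).differentiableAt.differentiableWithinAt) ?_ x
    (mem_univ _) y (mem_univ _) hxy
  intro z _
  rw [(A.hasDerivAt_lifetime z).deriv]
  exact inv_anti₀ (A.rate_pos z) (A.rate_le z)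

theorem surjective_lifetime : Function.Surjective A.lifetime := by
  have hc : 0 < (A.c A.m)⁻¹ := inv_pos.2 (A.c_pos _ (left_mem_Icc.2 A.m_lt_M.le))
  have h0 : A.lifetime A.m = 0 := by simp [lifetime]
  refine A.continuous_lifetime.surjective ?_ ?_
  · refine tendsto_atTop_mono' _ (f₁ := fun x => (A.c A.m)⁻¹ * (x - A.m)) ?_
      ((tendsto_atTop_add_const_right _ _ tendsto_id).const_mul_atTop hc)
    filter_upwards [eventually_ge_atTop A.m] with x hx
    have := A.lifetime_sub_ge hx
    linarith
  · refine tendsto_atBot_mono' _ (f₁ := fun x => (A.c A.m)⁻¹ * (x - A.m)) ?_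
      ((tendsto_atBot_add_const_right _ _ tendsto_id).const_mul_atBot hc)
    filter_upwards [eventually_le_atBot A.m] with x hx
    have := A.lifetime_sub_ge hx
    linarith

/-- `lifetime` as an order isomorphism of the line. -/
def lifetimeIso : ℝ ≃o ℝ :=
  A.strictMono_lifetime.orderIsoOfSurjective A.lifetime A.surjective_lifetime

/-- The level from which the drift needs the time `u` to reach the threshold. -/
def levelAt (u : ℝ) : ℝ := A.lifetimeIso.symm u

@[simp] theorem levelAt_lifetime (x : ℝ) : A.levelAt (A.lifetime x) = x :=
  A.lifetimeIso.symm_apply_apply x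

@[simp] theorem lifetime_levelAt (u : ℝ) : A.lifetime (A.levelAt u) = u :=
  A.lifetimeIso.apply_symm_apply u

theorem strictMono_levelAt : StrictMono A.levelAt := A.lifetimeIso.symm.strictMono

theorem continuous_levelAt : Continuous A.levelAt := A.lifetimeIso.symm.continuous

theorem hasDerivAt_levelAt (u : ℝ) : HasDerivAt A.levelAt (A.rate (A.levelAt u)) u := by
  have h := A.hasDerivAt_lifetime (A.levelAt u)
  have := HasDerivAt.of_local_left_inverse A.continuous_levelAt.continuousAt h
    (inv_ne_zero (A.rate_pos _).ne') (Eventually.of_forall fun v => A.lifetime_levelAt v)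
  rwa [inv_inv] at this

@[simp] theorem lifetime_m : A.lifetime A.m = 0 := by simp [lifetime]

@[simp] theorem levelAt_zero : A.levelAt 0 = A.m := by
  rw [← A.lifetime_m, levelAt_lifetime]

theorem lifetime_M_pos : 0 < A.lifetime A.M := by
  rw [← A.lifetime_m]; exact A.strictMono_lifetime A.m_lt_M

theorem levelAt_mem {u : ℝ} (hu : u ∈ Icc 0 (A.lifetime A.M)) : A.levelAt u ∈ Icc A.m A.M := by
  constructor
  · rw [← A.levelAt_zero]; exact A.strictMono_levelAt.monotone hu.1
  · have := A.strictMono_levelAt.monotone hu.2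
    rwa [levelAt_lifetime] at this

theorem lifetime_mem {x : ℝ} (hx : x ∈ Icc A.m A.M) : A.lifetime x ∈ Icc 0 (A.lifetime A.M) := by
  constructor
  · rw [← A.lifetime_m]; exact A.strictMono_lifetime.monotone hx.1
  · exact A.strictMono_lifetime.monotone hx.2

/-- Along the drift the remaining lifetime decreases at unit speed. -/
theorem lifetime_drift {ρ : ℝ → ℝ} {x a t : ℝ} (hat : a ≤ t) (hρ : ContinuousOn ρ (Icc a t))
    (h : ∀ s ∈ Icc a t, ρ s = x - ∫ v in a..s, A.rate (ρ v)) :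
    ∀ s ∈ Icc a t, A.lifetime (ρ s) = A.lifetime x - (s - a) := by
  have hρa : ρ a = x := by simpa using h a ⟨le_rfl, hat⟩
  have hd : ∀ s ∈ Ico a t, HasDerivWithinAt ρ (-(A.rate (ρ s))) (Ici s) s := by
    intro s hs
    have hc : ContinuousOn (fun v => A.rate (ρ v)) (Icc a t) := A.continuous_rate.comp_continuousOn hρ
    have hst : Icc s t ⊆ Icc a t := Icc_subset_Icc_left hs.1
    have hI : IntervalIntegrable (fun v => A.rate (ρ v)) volume a s :=
      (hc.mono (by rw [uIcc_of_le hs.1]; exact Icc_subset_Icc_right hs.2.le)).intervalIntegrable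
    have hm : Icc s t ∈ 𝓝[>] s := Icc_mem_nhdsGT hs.2
    have h1 : HasDerivWithinAt (fun u => ∫ v in a..u, A.rate (ρ v)) (A.rate (ρ s)) (Ici s) s := by
      refine intervalIntegral.integral_hasDerivWithinAt_right hI ?_ ?_ (t := Ioi s)
      · exact ⟨Icc s t, hm, (hc.mono hst).aestronglyMeasurable measurableSet_Icc⟩
      · exact ((hc.mono hst) s ⟨le_rfl, hs.2.le⟩).mono_left (nhdsWithin_le_of_mem hm)
    refine (h1.const_sub x).congr_of_eventuallyEq_of_mem ?_ self_mem_Ici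
    filter_upwards [Icc_mem_nhdsGE hs.2] with u hu
    exact h u (hst hu)
  intro s hs
  have hconst := constant_of_has_deriv_right_zero (f := fun s => A.lifetime (ρ s) + s) (a := a) (b := t)
    ((A.continuous_lifetime.comp_continuousOn hρ).add continuousOn_id) ?_ s hs
  · simp only [hρa] at hconst
    linarith
  · intro u hu
    have := ((A.hasDerivAt_lifetime (ρ u)).comp_hasDerivWithinAt u (hd u hu)).add
      (hasDerivWithinAt_id u _)
    refine this.congr_deriv ?_
    have := (A.rate_pos (ρ u)).ne'
    field_simp
    ring

/-! ### The value of the obstacle problem -/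

/-- The mean of `W` at the level reached by a shock that hits the system at level `x`, the value
after failure being `0`. -/
def shockMean (W : ℝ → ℝ) (x : ℝ) : ℝ≥0∞ :=
  ∫⁻ s, (Icc A.m A.M).indicator (fun y => ENNReal.ofReal (W y)) (x - s) ∂A.F

/-- Benefit rate plus intensity times mean value after the next shock. -/
def runRate (W : ℝ → ℝ) (x : ℝ) : ℝ := A.G x + A.lam * (A.shockMean W x).toReal

/-- The upper bound `G M / δ` for the value. -/
def valueBound : ℝ := A.G A.M / A.δ

theorem M_mem : A.M ∈ Icc A.m A.M := right_mem_Icc.2 A.m_lt_M.le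

theorem m_mem : A.m ∈ Icc A.m A.M := left_mem_Icc.2 A.m_lt_M.le

theorem G_le {x : ℝ} (hx : x ∈ Icc A.m A.M) : A.G x ≤ A.δ * A.valueBound := by
  rw [valueBound, mul_div_cancel₀ _ A.δ_pos.ne']
  exact A.G_monotone hx A.M_mem hx.2

theorem valueBound_nonneg : 0 ≤ A.valueBound :=
  div_nonneg (A.G_nonneg _ A.M_mem) A.δ_pos.le

/-- `W` solves the obstacle problem of the maintenance model, written in the time scale of the
remaining lifetime. -/
def IsCandidate (W : ℝ → ℝ) : Prop :=
  IsObstacleSolution (A.lifetime A.M) (A.lam + A.δ) A.valueBound A.k (fun u => A.H (A.levelAt u))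
    (fun u => A.runRate W (A.levelAt u)) (fun u => W (A.levelAt u))

theorem shockMean_le {W : ℝ → ℝ} {b : ℝ} (hW : ∀ x ∈ Icc A.m A.M, W x ≤ b) (x : ℝ) :
    A.shockMean W x ≤ ENNReal.ofReal b := by
  have := A.isProbabilityMeasure_F
  calc A.shockMean W x ≤ ∫⁻ _, ENNReal.ofReal b ∂A.F := by
        refine lintegral_mono fun s => ?_
        refine indicator_le' (fun y hy => ENNReal.ofReal_le_ofReal (hW y hy)) (fun _ _ => zero_le) _
    _ = ENNReal.ofReal b := by simp

theorem shockMean_mono {V W : ℝ → ℝ} (h : ∀ x ∈ Icc A.m A.M, V x ≤ W x) (x : ℝ) :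
    A.shockMean V x ≤ A.shockMean W x :=
  lintegral_mono fun s => by
    by_cases hs : x - s ∈ Icc A.m A.M
    · rw [indicator_of_mem hs, indicator_of_mem hs]
      exact ENNReal.ofReal_le_ofReal (h _ hs)
    · rw [indicator_of_notMem hs, indicator_of_notMem hs]

theorem monotoneOn_H_levelAt :
    MonotoneOn (fun u => A.H (A.levelAt u)) (Icc 0 (A.lifetime A.M)) := fun _ hu _ hv huv =>
  A.H_monotone (A.levelAt_mem hu) (A.levelAt_mem hv) (A.strictMono_levelAt.monotone huv)

/-- The running reward depends monotonically on the value after the next shock, so that the dynamic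
programming operator has a fixed point. -/
theorem exists_isCandidate : ∃ W : ℝ → ℝ, A.IsCandidate W := by
  set g : (ℝ → ℝ) → ℝ → ℝ := fun v u => A.runRate (fun x => v (A.lifetime x)) (A.levelAt u) with hg
  have hκ : 0 < A.lam + A.δ := add_pos A.lam_pos A.δ_pos
  have hmean : ∀ v : ℝ → ℝ, (∀ u ∈ Icc 0 (A.lifetime A.M), 0 ≤ v u ∧ v u ≤ A.valueBound) →
      ∀ x, A.shockMean (fun x => v (A.lifetime x)) x ≤ ENNReal.ofReal A.valueBound :=
    fun v hv x => A.shockMean_le (fun y hy => (hv _ (A.lifetime_mem hy)).2) x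
  have hgβ : ∀ v, (∀ u ∈ Icc 0 (A.lifetime A.M), 0 ≤ v u ∧ v u ≤ A.valueBound) →
      ∀ u ∈ Icc 0 (A.lifetime A.M), g v u ≤ (A.lam + A.δ) * A.valueBound := by
    intro v hv u hu
    have h1 := A.G_le (A.levelAt_mem hu)
    have h2 := ENNReal.toReal_le_of_le_ofReal A.valueBound_nonneg (hmean v hv (A.levelAt u))
    have h3 := mul_le_mul_of_nonneg_left h2 A.lam_pos.le
    simp only [hg, runRate]
    linarith
  have hgm : ∀ v w, (∀ u ∈ Icc 0 (A.lifetime A.M), 0 ≤ v u ∧ v u ≤ w u ∧ w u ≤ A.valueBound) →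
      ∀ u ∈ Icc 0 (A.lifetime A.M), g v u ≤ g w u := by
    intro v w hvw u hu
    have hw := hmean w (fun u hu => ⟨(hvw u hu).1.trans (hvw u hu).2.1, (hvw u hu).2.2⟩)
      (A.levelAt u)
    have := ENNReal.toReal_mono (ne_top_of_le_ne_top ENNReal.ofReal_ne_top hw)
      (A.shockMean_mono (fun x hx => (hvw _ (A.lifetime_mem hx)).2.1) (A.levelAt u))
    have h3 := mul_le_mul_of_nonneg_left this A.lam_pos.le
    simp only [hg, runRate]
    linarith
  obtain ⟨w, hw, hfix⟩ := exists_obstacleOp_eq hκ A.valueBound_nonneg A.k_pos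
    A.monotoneOn_H_levelAt hgm hgβ
  have hsol := isObstacleSolution_of_fixedPoint A.lifetime_M_pos.le hκ A.valueBound_nonneg A.k_pos
    A.monotoneOn_H_levelAt
    (A.H_continuous.comp A.continuous_levelAt.continuousOn fun u hu => A.levelAt_mem hu)
    hgβ hw hfix
  refine ⟨fun x => w (A.lifetime x), ?_⟩
  simpa [IsCandidate, hg] using hsol

end MaintenanceModel

namespace MaintenanceModel.IsCandidate

variable {A : MaintenanceModel} {W : ℝ → ℝ}

theorem continuousOn (hW : A.IsCandidate W) : ContinuousOn W (Icc A.m A.M) := by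
  have := (IsObstacleSolution.continuousOn hW).comp A.continuous_lifetime.continuousOn
    fun x hx => A.lifetime_mem hx
  refine this.congr fun x _ => ?_
  simp

theorem nonneg (hW : A.IsCandidate W) {x : ℝ} (hx : x ∈ Icc A.m A.M) : 0 ≤ W x := by
  simpa using IsObstacleSolution.nonneg hW _ (A.lifetime_mem hx)

theorem le_bound (hW : A.IsCandidate W) {x : ℝ} (hx : x ∈ Icc A.m A.M) : W x ≤ A.valueBound := by
  simpa using IsObstacleSolution.le_bound hW _ (A.lifetime_mem hx)

end MaintenanceModel.IsCandidate

namespace MaintenanceModel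

variable (A : MaintenanceModel)

/-- The candidate value as a function on the line with values in `[0, ∞]`: it is
extended by `0` outside `[m, M]`, so that it vanishes after failure. -/
def aliveValue (W : ℝ → ℝ) : ℝ → ℝ≥0∞ := (Icc A.m A.M).indicator fun y => ENNReal.ofReal (W y)

variable {A}

theorem aliveValue_of_mem {W : ℝ → ℝ} {x : ℝ} (hx : x ∈ Icc A.m A.M) :
    A.aliveValue W x = ENNReal.ofReal (W x) := indicator_of_mem hx _

theorem aliveValue_of_lt {W : ℝ → ℝ} {x : ℝ} (hx : x < A.m) : A.aliveValue W x = 0 :=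
  indicator_of_notMem (fun h => absurd h.1 (not_le.2 hx)) _

theorem bestTarget_levelAt (W : ℝ → ℝ) (u : ℝ) :
    bestTarget (A.lifetime A.M) (fun u => A.H (A.levelAt u)) (fun u => W (A.levelAt u)) u
      = bestTarget A.M A.H W (A.levelAt u) := by
  have : Icc (A.levelAt u) A.M = A.levelAt '' Icc u (A.lifetime A.M) := by
    have h := A.lifetimeIso.symm.image_Icc u (A.lifetime A.M)
    rw [show A.levelAt '' Icc u (A.lifetime A.M)
      = A.lifetimeIso.symm '' Icc u (A.lifetime A.M) from rfl, h]
    congr 1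
    exact (A.levelAt_lifetime A.M).symm
  rw [bestTarget, bestTarget, this, image_image]

theorem shockMean_congr {V W : ℝ → ℝ} (h : EqOn V W (Icc A.m A.M)) :
    A.shockMean V = A.shockMean W := by
  funext x
  refine lintegral_congr fun s => ?_
  exact congrFun (indicator_congr fun y hy => by rw [h hy]) _

namespace IsCandidate

variable {W : ℝ → ℝ}

/-- Being a candidate depends on the values on `[m, M]` only. -/
theorem congr {V : ℝ → ℝ} (hW : A.IsCandidate W) (h : EqOn V W (Icc A.m A.M)) :
    A.IsCandidate V := by
  have hΦ : ∀ u ∈ Icc 0 (A.lifetime A.M), V (A.levelAt u) = W (A.levelAt u) := fun u hu =>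
    h (A.levelAt_mem hu)
  have hg : (fun u => A.runRate V (A.levelAt u)) = fun u => A.runRate W (A.levelAt u) := by
    funext u
    simp only [runRate, shockMean_congr h]
  have hb : ∀ u ∈ Icc 0 (A.lifetime A.M), bestTarget (A.lifetime A.M)
      (fun u => A.H (A.levelAt u)) (fun u => V (A.levelAt u)) u = bestTarget (A.lifetime A.M)
      (fun u => A.H (A.levelAt u)) (fun u => W (A.levelAt u)) u := by
    intro u hu
    rw [bestTarget, bestTarget]
    congr 1
    refine image_congr fun z hz => ?_
    simp only [hΦ z ⟨hu.1.trans hz.1, hz.2⟩]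
  have h0 : (0 : ℝ) ∈ Icc 0 (A.lifetime A.M) := ⟨le_rfl, A.lifetime_M_pos.le⟩
  rw [IsCandidate, hg]
  rw [IsCandidate] at hW
  refine ⟨hW.continuousOn.congr hΦ, fun u hu => ?_, fun u hu => ?_, fun u hu => ?_,
    fun u hu y hy => ?_, fun u hu y hy hz => ?_, fun hlt => ?_⟩
  · simp only [hΦ u hu]; exact hW.nonneg u hu
  · simp only [hΦ u hu]; exact hW.le_bound u hu
  · simp only [hb u hu, hΦ u hu]; exact hW.obstacle_le u hu
  · simp only [hΦ u hu, hΦ y ⟨hy.1, hy.2.trans hu.2⟩]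
    exact hW.drift_le u hu y hy
  · simp only [hΦ u hu, hΦ y ⟨hy.1, hy.2.trans hu.2⟩]
    refine hW.drift_eq u hu y hy fun z hz' => ?_
    have hz0 : z ∈ Icc 0 (A.lifetime A.M) := ⟨hy.1.trans hz'.1.le, hz'.2.trans hu.2⟩
    have := hz z hz'
    simp only [hb z hz0, hΦ z hz0] at this
    exact this
  · simp only [hb 0 h0, hΦ 0 h0] at hlt ⊢
    exact hW.boundary hlt

theorem measurable_aliveValue (hW : A.IsCandidate W) : Measurable (A.aliveValue W) := by
  classical
  have h : ContinuousOn (fun y => ENNReal.ofReal (W y)) (Icc A.m A.M) :=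
    ENNReal.continuous_ofReal.comp_continuousOn hW.continuousOn
  have := h.measurable_piecewise (g := fun _ => 0) continuousOn_const measurableSet_Icc
  rwa [aliveValue, ← piecewise_eq_indicator]

theorem aliveValue_le (hW : A.IsCandidate W) (x : ℝ) :
    A.aliveValue W x ≤ ENNReal.ofReal A.valueBound :=
  indicator_le' (fun _ hy => ENNReal.ofReal_le_ofReal (hW.le_bound hy)) (fun _ _ => zero_le) _

theorem measurable_shockMean (hW : A.IsCandidate W) : Measurable (A.shockMean W) := by
  have := A.isProbabilityMeasure_F
  have : Measurable fun p : ℝ × ℝ => A.aliveValue W (p.1 - p.2) :=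
    hW.measurable_aliveValue.comp (measurable_fst.sub measurable_snd)
  exact this.lintegral_prod_right'

theorem shockMean_toReal_le (hW : A.IsCandidate W) (x : ℝ) :
    (A.shockMean W x).toReal ≤ A.valueBound :=
  ENNReal.toReal_le_of_le_ofReal A.valueBound_nonneg (A.shockMean_le (fun _ hy => hW.le_bound hy) x)

theorem shockMean_ne_top (hW : A.IsCandidate W) (x : ℝ) : A.shockMean W x ≠ ⊤ :=
  ne_top_of_le_ne_top ENNReal.ofReal_ne_top (A.shockMean_le (fun _ hy => hW.le_bound hy) x)

theorem runRate_nonneg {x : ℝ} (hx : x ∈ Icc A.m A.M) : 0 ≤ A.runRate W x :=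
  add_nonneg (A.G_nonneg x hx) (mul_nonneg A.lam_pos.le ENNReal.toReal_nonneg)

theorem intervalIntegrable_runRate (hW : A.IsCandidate W) :
    IntervalIntegrable (fun u => A.runRate W (A.levelAt u)) volume 0 (A.lifetime A.M) := by
  refine IntervalIntegrable.add ?_ (IntervalIntegrable.const_mul ?_ _)
  · refine ContinuousOn.intervalIntegrable ?_
    rw [uIcc_of_le A.lifetime_M_pos.le]
    exact A.G_continuous.comp A.continuous_levelAt.continuousOn fun u hu => A.levelAt_mem hu
  · refine (intervalIntegrable_const (c := A.valueBound)).mono_fun' ?_ ?_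
    · exact (hW.measurable_shockMean.ennreal_toReal.comp
        A.continuous_levelAt.measurable).aestronglyMeasurable
    · refine ae_of_all _ fun u => ?_
      simp only [Real.norm_eq_abs]
      rw [abs_of_nonneg ENNReal.toReal_nonneg]
      exact hW.shockMean_toReal_le _

/-- An optimal target level of an intervention at level `x`. -/
theorem exists_target (hW : A.IsCandidate W) {x : ℝ} (hx : x ∈ Icc A.m A.M) :
    ∃ y ∈ Icc x A.M, W y - A.H y = bestTarget A.M A.H W x := by
  have hc : ContinuousOn (fun y => W y - A.H y) (Icc x A.M) :=
    (hW.continuousOn.sub A.H_continuous).mono (Icc_subset_Icc_left hx.1)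
  obtain ⟨y, hy, h⟩ := isCompact_Icc.exists_sSup_image_eq (nonempty_Icc.2 hx.2) hc
  exact ⟨y, hy, h.symm⟩

theorem le_bestTarget' (hW : A.IsCandidate W) {x y : ℝ} (hx : x ∈ Icc A.m A.M)
    (hy : y ∈ Icc x A.M) : W y - A.H y ≤ bestTarget A.M A.H W x := by
  have hc : ContinuousOn (fun y => W y - A.H y) (Icc x A.M) :=
    (hW.continuousOn.sub A.H_continuous).mono (Icc_subset_Icc_left hx.1)
  exact le_csSup (isCompact_Icc.image_of_continuousOn hc).bddAbove ⟨y, hy, rfl⟩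

theorem obstacle_le' (hW : A.IsCandidate W) {x : ℝ} (hx : x ∈ Icc A.m A.M) :
    bestTarget A.M A.H W x + A.H x - A.k ≤ W x := by
  have := IsObstacleSolution.obstacle_le hW _ (A.lifetime_mem hx)
  simpa only [bestTarget_levelAt, levelAt_lifetime] using this

theorem continuousOn_bestTarget (hW : A.IsCandidate W) :
    ContinuousOn (bestTarget A.M A.H W) (Icc A.m A.M) := by
  have hW' : IsObstacleSolution _ _ _ _ _ _ _ := hW
  have h := bestTarget_continuousOn A.monotoneOn_H_levelAt
    (fun u hu => ⟨hW'.nonneg u hu, hW'.le_bound u hu⟩)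
    (hW'.continuousOn.sub (A.H_continuous.comp A.continuous_levelAt.continuousOn
      fun u hu => A.levelAt_mem hu))
  refine (h.comp A.continuous_lifetime.continuousOn fun x hx => A.lifetime_mem hx).congr ?_
  intro x _
  simp [bestTarget_levelAt]

/-! ### The candidate is a viscosity solution -/

theorem intervention_eq (hW : A.IsCandidate W) {r : ℝ} (hr : r ∈ Icc A.m A.M) :
    A.intervention W r = ((bestTarget A.M A.H W r + A.H r - A.k : ℝ) : EReal) := by
  refine le_antisymm (iSup₂_le fun z hz => ?_) ?_
  · have := hW.le_bestTarget' hr (y := r + z) ⟨by linarith [hz.1], by linarith [hz.2]⟩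
    exact EReal.coe_le_coe_iff.2 (by linarith)
  · obtain ⟨y, hy, h⟩ := hW.exists_target hr
    refine le_trans (EReal.coe_le_coe_iff.2 ?_)
      (le_iSup₂_of_le (y - r) ⟨by linarith [hy.1], by linarith [hy.2]⟩ le_rfl)
    rw [add_sub_cancel, h]

theorem hjb_eq (hW : A.IsCandidate W) {r : ℝ} (hr : r ∈ Icc A.m A.M) (φ : ℝ → ℝ) :
    A.hjb φ W r = ((min (A.δ * φ r - A.generator φ r - A.G r)
      (W r - (bestTarget A.M A.H W r + A.H r - A.k)) : ℝ) : EReal) := by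
  rw [hjb, hW.intervention_eq hr, ← EReal.coe_sub]
  exact (EReal.coe_strictMono.monotone.map_min).symm

/-- The limit of the running rate along the drift. Immediately after the level `r` a shock of the
exact size `r - m` leads to failure, whence the half-open interval. -/
theorem tendsto_runRate (hW : A.IsCandidate W) {r : ℝ} (hr : r ∈ Ioo A.m A.M) :
    Tendsto (A.runRate W) (𝓝[<] r)
      (𝓝 (A.G r + A.lam * ∫ s in Ico 0 (r - A.m), W (r - s) ∂A.F)) := by
  have := A.isProbabilityMeasure_F
  have hpos : ∀ᵐ s ∂A.F, 0 ≤ s := by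
    rw [ae_iff]
    simpa [Iio, not_le] using A.F_nonneg
  have hG : Tendsto A.G (𝓝[<] r) (𝓝 (A.G r)) :=
    ((A.G_continuous r ⟨hr.1.le, hr.2.le⟩).continuousAt (Icc_mem_nhds hr.1 hr.2)).mono_left
      nhdsWithin_le_nhds
  have hmean : Tendsto (A.shockMean W) (𝓝[<] r)
      (𝓝 (∫⁻ s in Ico 0 (r - A.m), ENNReal.ofReal (W (r - s)) ∂A.F)) := by
    rw [← lintegral_indicator measurableSet_Ico]
    refine tendsto_lintegral_filter_of_dominated_convergence
      (fun _ => ENNReal.ofReal A.valueBound) ?_ ?_ (by simp) ?_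
    · exact Eventually.of_forall fun x =>
        hW.measurable_aliveValue.comp (measurable_const.sub measurable_id)
    · exact Eventually.of_forall fun x => ae_of_all _ fun s => hW.aliveValue_le _
    · filter_upwards [hpos] with s hs
      by_cases hsr : s < r - A.m
      · rw [indicator_of_mem (show s ∈ Ico 0 (r - A.m) from ⟨hs, hsr⟩)]
        have hmem : r - s ∈ Icc A.m A.M := ⟨by linarith, by linarith [hr.2]⟩
        have h1 : Tendsto (fun x => x - s) (𝓝[<] r) (𝓝[Icc A.m A.M] (r - s)) := by
          refine tendsto_nhdsWithin_iff.2 ⟨?_, ?_⟩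
          · exact ((continuous_id.sub continuous_const).tendsto r).mono_left nhdsWithin_le_nhds
          · filter_upwards [Ioo_mem_nhdsLT (show A.m + s < r by linarith)] with x hx
            exact ⟨by linarith [hx.1], by linarith [hx.2, hr.2]⟩
        have h2 := (ENNReal.continuous_ofReal.tendsto _).comp
          (((hW.continuousOn (r - s) hmem)).tendsto.comp h1)
        refine h2.congr' ?_
        filter_upwards [h1.eventually self_mem_nhdsWithin] with x hx
        rw [indicator_of_mem (show x - s ∈ Icc A.m A.M from hx)]
        rfl
      · rw [indicator_of_notMem (fun h => hsr h.2)]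
        refine tendsto_const_nhds.congr' ?_
        filter_upwards [self_mem_nhdsWithin] with x hx
        rw [indicator_of_notMem]
        intro h
        have := h.1
        simp only [mem_Iio] at hx
        linarith
  have hfin : ∫⁻ s in Ico 0 (r - A.m), ENNReal.ofReal (W (r - s)) ∂A.F ≠ ⊤ := by
    refine ne_top_of_le_ne_top (b := ENNReal.ofReal A.valueBound * A.F (Ico 0 (r - A.m))) ?_ ?_
    · exact ENNReal.mul_ne_top ENNReal.ofReal_ne_top (measure_ne_top _ _)
    · rw [← setLIntegral_const]
      refine setLIntegral_mono' measurableSet_Ico fun s hs => ENNReal.ofReal_le_ofReal ?_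
      exact hW.le_bound ⟨by linarith [hs.2], by linarith [hs.1, hr.2]⟩
  have heq : ∫ s in Ico 0 (r - A.m), W (r - s) ∂A.F
      = (∫⁻ s in Ico 0 (r - A.m), ENNReal.ofReal (W (r - s)) ∂A.F).toReal := by
    refine integral_eq_lintegral_of_nonneg_ae ?_ ?_
    · refine (ae_restrict_iff' measurableSet_Ico).2 (ae_of_all _ fun s hs => ?_)
      exact hW.nonneg ⟨by linarith [hs.2], by linarith [hs.1, hr.2]⟩
    · refine ContinuousOn.aestronglyMeasurable ?_ measurableSet_Ico
      refine hW.continuousOn.comp (by fun_prop) fun s hs => ?_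
      exact ⟨by linarith [hs.2], by linarith [hs.1, hr.2]⟩
  rw [heq]
  exact hG.add (((ENNReal.tendsto_toReal hfin).comp hmean).const_mul _)

/-- The derivative along the drift of a test function against the collected reward. -/
theorem hasDerivWithinAt_test (hW : A.IsCandidate W) {r : ℝ} (hr : r ∈ Ioo A.m A.M) {φ : ℝ → ℝ}
    (hφ : DifferentiableAt ℝ φ r) :
    HasDerivWithinAt (fun y => Real.exp ((A.lam + A.δ) * y) * φ (A.levelAt y)
        + ∫ t in y..A.lifetime r, Real.exp ((A.lam + A.δ) * t) * A.runRate W (A.levelAt t))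
      (Real.exp ((A.lam + A.δ) * A.lifetime r) * ((A.lam + A.δ) * φ r + A.c r * deriv φ r
        - (A.G r + A.lam * ∫ s in Ico 0 (r - A.m), W (r - s) ∂A.F)))
      (Iic (A.lifetime r)) (A.lifetime r) := by
  set κ := A.lam + A.δ
  set u := A.lifetime r with hu
  have hum : u ∈ Icc 0 (A.lifetime A.M) := A.lifetime_mem ⟨hr.1.le, hr.2.le⟩
  have hΦu : A.levelAt u = r := A.levelAt_lifetime r
  have hI : IntervalIntegrable (fun t => Real.exp (κ * t) * A.runRate W (A.levelAt t)) volume 0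
      (A.lifetime A.M) :=
    hW.intervalIntegrable_runRate.continuousOn_mul (Continuous.continuousOn (by fun_prop))
  have hlim : Tendsto (fun t => Real.exp (κ * t) * A.runRate W (A.levelAt t)) (𝓝[<] u)
      (𝓝 (Real.exp (κ * u) * (A.G r + A.lam * ∫ s in Ico 0 (r - A.m), W (r - s) ∂A.F))) := by
    refine Tendsto.mul ?_ ((hW.tendsto_runRate hr).comp ?_)
    · exact (Continuous.tendsto (by fun_prop) u).mono_left nhdsWithin_le_nhds
    · refine tendsto_nhdsWithin_iff.2 ⟨?_, ?_⟩
      · have := (A.continuous_levelAt.tendsto u).mono_left (nhdsWithin_le_nhds (s := Iio u))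
        rwa [hΦu] at this
      · filter_upwards [self_mem_nhdsWithin] with t ht
        have := A.strictMono_levelAt ht
        rwa [hΦu] at this
  have h0u : 0 < u := by rw [hu, ← A.lifetime_m]; exact A.strictMono_lifetime hr.1
  have hmeas : StronglyMeasurableAtFilter
      (fun t => Real.exp (κ * t) * A.runRate W (A.levelAt t)) (𝓝[Iic u] u) := by
    refine ⟨Icc 0 u, ?_, ?_⟩
    · exact Icc_mem_nhdsLE h0u
    · have : IntegrableOn _ (Icc 0 (A.lifetime A.M)) volume :=
        (intervalIntegrable_iff_integrableOn_Icc_of_le A.lifetime_M_pos.le).1 hI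
      exact (this.mono_set (Icc_subset_Icc_right hum.2)).aestronglyMeasurable
  have h1 : HasDerivWithinAt (fun y => ∫ t in y..u, Real.exp (κ * t) * A.runRate W (A.levelAt t))
      (-(Real.exp (κ * u) * (A.G r + A.lam * ∫ s in Ico 0 (r - A.m), W (r - s) ∂A.F)))
      (Iic u) u := by
    refine intervalIntegral.integral_hasDerivWithinAt_of_tendsto_ae_left (t := Iic u)
      IntervalIntegrable.refl hmeas (hlim.mono_left ?_)
    refine le_inf (inf_le_left.trans inf_le_left) (le_principal_iff.2 ?_)
    have h3 : ({u}ᶜ : Set ℝ) ∈ ae (volume : Measure ℝ) := compl_mem_ae_iff.2 (by simp)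
    filter_upwards [mem_inf_of_left self_mem_nhdsWithin, mem_inf_of_right h3] with y hy hy'
    exact lt_of_le_of_ne hy hy'
  have h2 : HasDerivAt (fun y => Real.exp (κ * y) * φ (A.levelAt y))
      (Real.exp (κ * u) * κ * φ r + Real.exp (κ * u) * (deriv φ r * A.c r)) u := by
    have hφ' : HasDerivAt φ (deriv φ r) (A.levelAt u) := by rw [hΦu]; exact hφ.hasDerivAt
    have h3 := hφ'.comp u (A.hasDerivAt_levelAt u)
    have h4 : HasDerivAt (fun y => Real.exp (κ * y)) (Real.exp (κ * u) * κ) u := by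
      have := ((hasDerivAt_id' u).const_mul κ).exp
      rwa [mul_one] at this
    have h5 := h4.mul h3
    rw [hΦu, A.rate_of_mem ⟨hr.1.le, hr.2.le⟩] at h5
    refine h5.congr_deriv ?_
    simp [hΦu]
  refine (h2.hasDerivWithinAt.add h1).congr_deriv ?_
  ring

theorem deriv_nonneg_of_left_max {f : ℝ → ℝ} {f' u : ℝ} (hf : HasDerivWithinAt f f' (Iic u) u)
    (h : ∀ᶠ y in 𝓝[<] u, f y ≤ f u) : 0 ≤ f' := by
  have := hasDerivWithinAt_iff_tendsto_slope.1 hf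
  rw [Iic_sdiff_right] at this
  refine ge_of_tendsto this ?_
  filter_upwards [h, self_mem_nhdsWithin] with y hy hyu
  rw [slope_def_field]
  simp only [mem_Iio] at hyu
  exact div_nonneg_of_nonpos (by linarith) (by linarith)

/-- Test functions touching from either side see the derivative of the candidate along the drift
only, where its increments are those of the collected reward. -/
theorem isViscositySolution (hW : A.IsCandidate W) : A.IsViscositySolution W := by
  have := A.isProbabilityMeasure_F
  have hE : ∀ r ∈ Ioo A.m A.M, ∀ φ : ℝ → ℝ, W r = φ r → ∀ y ∈ Ioo 0 (A.lifetime r),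
      A.levelAt y ∈ Ioo A.m A.M := by
    intro r hr φ _ y hy
    constructor
    · rw [← A.levelAt_zero]; exact A.strictMono_levelAt hy.1
    · have := A.strictMono_levelAt hy.2
      rw [levelAt_lifetime] at this
      exact this.trans hr.2
  have hIW : ∀ r ∈ Ioo A.m A.M, IntegrableOn (fun s => W (r - s)) (Ico 0 (r - A.m)) A.F := by
    intro r hr
    refine (integrable_const A.valueBound).mono' ?_ ?_
    · refine ContinuousOn.aestronglyMeasurable ?_ measurableSet_Ico
      refine hW.continuousOn.comp (by fun_prop) fun s hs => ?_
      exact ⟨by linarith [hs.2], by linarith [hs.1, hr.2]⟩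
    · refine (ae_restrict_iff' measurableSet_Ico).2 (ae_of_all _ fun s hs => ?_)
      have hm : r - s ∈ Icc A.m A.M := ⟨by linarith [hs.2], by linarith [hs.1, hr.2]⟩
      rw [Real.norm_eq_abs, abs_of_nonneg (hW.nonneg hm)]
      exact hW.le_bound hm
  have hdiff : ∀ r ∈ Ioo A.m A.M, ∀ φ, A.IsTest φ r → DifferentiableAt ℝ φ r := fun r hr φ hφ =>
    (hφ.1.differentiableOn one_ne_zero r hr).differentiableAt (Ioo_mem_nhds hr.1 hr.2)
  have hpos : ∀ r ∈ Ioo A.m A.M, 0 < A.lifetime r := fun r hr => by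
    rw [← A.lifetime_m]; exact A.strictMono_lifetime hr.1
  have hrr : ∀ r ∈ Ioo A.m A.M, ∀ y ∈ Ioo 0 (A.lifetime r),
      runningReward (A.lam + A.δ) (fun u => A.runRate W (A.levelAt u)) y (A.lifetime r)
        = ∫ t in y..A.lifetime r, Real.exp ((A.lam + A.δ) * t) * A.runRate W (A.levelAt t) := by
    intro r hr y hy
    have hum : A.lifetime r ∈ Icc 0 (A.lifetime A.M) := A.lifetime_mem ⟨hr.1.le, hr.2.le⟩
    refine runningReward_eq_integral hy.2.le (fun t ht => runRate_nonneg
      (A.levelAt_mem ⟨hy.1.le.trans ht.1, ht.2.trans hum.2⟩)) ?_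
    refine hW.intervalIntegrable_runRate.mono_set ?_
    rw [uIcc_of_le hy.2.le, uIcc_of_le A.lifetime_M_pos.le]
    exact Icc_subset_Icc hy.1.le hum.2
  have hW' : IsObstacleSolution _ _ _ _ _ _ _ := hW
  refine ⟨⟨hW.continuousOn.upperSemicontinuousOn, fun φ r hr hφ hmax heq => ?_⟩,
    ⟨hW.continuousOn.lowerSemicontinuousOn, fun φ r hr hφ hmin heq => ?_⟩⟩
  · have hr' : r ∈ Icc A.m A.M := ⟨hr.1.le, hr.2.le⟩
    have hle : ∀ x ∈ Ioo A.m A.M, W x ≤ φ x := fun x hx => by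
      have := hmax hx
      simp only [mem_ofPred_eq] at this
      linarith
    rw [hW.hjb_eq hr', ← EReal.coe_zero, EReal.coe_le_coe_iff, min_le_iff]
    by_contra! hcon
    -- near `r` no intervention is optimal, so that the drift inequality is an equality
    have hcont : ContinuousOn (fun u => W (A.levelAt u)
        - (bestTarget A.M A.H W (A.levelAt u) + A.H (A.levelAt u) - A.k))
        (Icc 0 (A.lifetime A.M)) :=
      (hW.continuousOn.sub ((hW.continuousOn_bestTarget.add A.H_continuous).sub
        continuousOn_const)).comp A.continuous_levelAt.continuousOn fun u hu => A.levelAt_mem hu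
    have hmem : Icc 0 (A.lifetime A.M) ∈ 𝓝 (A.lifetime r) :=
      Icc_mem_nhds (hpos r hr) (A.strictMono_lifetime hr.2)
    have hev : ∀ᶠ u in 𝓝 (A.lifetime r), 0 < W (A.levelAt u)
        - (bestTarget A.M A.H W (A.levelAt u) + A.H (A.levelAt u) - A.k) := by
      refine (hcont.continuousAt hmem).eventually_const_lt ?_
      simpa using hcon.2
    obtain ⟨e, he, hball⟩ := Metric.eventually_nhds_iff.1 hev
    have hd := deriv_nonneg_of_left_max (hW.hasDerivWithinAt_test hr (hdiff r hr φ hφ)).neg ?_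
    · have h1 : 0 ≤ -((A.lam + A.δ) * φ r + A.c r * deriv φ r
        - (A.G r + A.lam * ∫ s in Ico 0 (r - A.m), W (r - s) ∂A.F)) := by
        rw [← mul_neg] at hd
        exact nonneg_of_mul_nonneg_right hd (Real.exp_pos _)
      have h2 : ∫ s in Ico 0 (r - A.m), W (r - s) ∂A.F ≤ ∫ s in Ico 0 (r - A.m), φ (r - s) ∂A.F := by
        refine setIntegral_mono_on (hIW r hr) hφ.2 measurableSet_Ico fun s hs => hle _ ?_
        exact ⟨by linarith [hs.2], by linarith [hs.1, hr.2]⟩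
      have h3 := mul_le_mul_of_nonneg_left h2 A.lam_pos.le
      have h4 := hcon.1
      rw [generator] at h4
      linarith
    · filter_upwards [Ioo_mem_nhdsLT (max_lt (hpos r hr) (sub_lt_self _ he))] with y hy
      have hy0 : y ∈ Ioo 0 (A.lifetime r) := ⟨(le_max_left _ _).trans_lt hy.1, hy.2⟩
      have hye : A.lifetime r - e < y := (le_max_right _ _).trans_lt hy.1
      have h1 := hle _ (hE r hr φ heq y hy0)
      have h2 := hW'.drift_eq _ (A.lifetime_mem hr') y ⟨hy0.1.le, hy0.2.le⟩ fun z hz => by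
        have := hball (y := z) (by
          rw [Real.dist_eq, abs_sub_comm, abs_of_nonneg (by linarith [hz.2])]
          linarith [hz.1])
        rw [bestTarget_levelAt]
        linarith
      rw [hrr r hr y hy0] at h2
      have h3 := mul_le_mul_of_nonneg_left h1 (Real.exp_pos ((A.lam + A.δ) * y)).le
      simp only [levelAt_lifetime, intervalIntegral.integral_same, Pi.neg_apply] at h2 ⊢
      rw [← heq]
      linarith
  · have hr' : r ∈ Icc A.m A.M := ⟨hr.1.le, hr.2.le⟩
    have hle : ∀ x ∈ Ioo A.m A.M, φ x ≤ W x := fun x hx => by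
      have := hmin hx
      simp only [mem_ofPred_eq] at this
      linarith
    rw [hW.hjb_eq hr', ← EReal.coe_zero, EReal.coe_le_coe_iff]
    refine le_min ?_ (by linarith [hW.obstacle_le' hr'])
    have hd := deriv_nonneg_of_left_max (hW.hasDerivWithinAt_test hr (hdiff r hr φ hφ)) ?_
    · have h1 := nonneg_of_mul_nonneg_right hd (Real.exp_pos _)
      have h2 : ∫ s in Ico 0 (r - A.m), φ (r - s) ∂A.F ≤ ∫ s in Ico 0 (r - A.m), W (r - s) ∂A.F := by
        refine setIntegral_mono_on hφ.2 (hIW r hr) measurableSet_Ico fun s hs => hle _ ?_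
        exact ⟨by linarith [hs.2], by linarith [hs.1, hr.2]⟩
      have h3 := mul_le_mul_of_nonneg_left h2 A.lam_pos.le
      rw [generator]
      linarith
    · filter_upwards [Ioo_mem_nhdsLT (hpos r hr)] with y hy
      have h1 := hle _ (hE r hr φ heq y hy)
      have h2 := hW'.drift_le _ (A.lifetime_mem hr') y ⟨hy.1.le, hy.2.le⟩
      rw [hrr r hr y hy] at h2
      have h3 := mul_le_mul_of_nonneg_left h1 (Real.exp_pos ((A.lam + A.δ) * y)).le
      simp only [levelAt_lifetime, intervalIntegral.integral_same] at h2 ⊢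
      rw [← heq]
      linarith

end IsCandidate
end MaintenanceModel

/-! ### Arrival times and the history of the shocks -/

section Fubini

variable {Ω : Type*} [MeasurableSpace Ω] {P : Measure Ω} [IsProbabilityMeasure P]
  {α β γ δ : Type*} [MeasurableSpace α] [MeasurableSpace β] [MeasurableSpace γ] [MeasurableSpace δ]

theorem lintegral_comp_indepFun {a : Ω → α} {b : Ω → β} (ha : Measurable a) (hb : Measurable b)
    (h : IndepFun a b P) {f : α × β → ℝ≥0∞} (hf : Measurable f) :
    ∫⁻ ω, f (a ω, b ω) ∂P = ∫⁻ x, ∫⁻ y, f (x, y) ∂(P.map b) ∂(P.map a) := by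
  have := Measure.isProbabilityMeasure_map (μ := P) ha.aemeasurable
  have := Measure.isProbabilityMeasure_map (μ := P) hb.aemeasurable
  rw [← lintegral_prod _ hf.aemeasurable,
    ← (indepFun_iff_map_prod_eq_prod_map_map ha.aemeasurable hb.aemeasurable).1 h,
    lintegral_map hf (ha.prodMk hb)]

/-- Integrating out the second components of two independent pairs with independent components. -/
theorem lintegral_comp_indepFun_pairs {a : Ω → α} {b : Ω → β} {c : Ω → γ} {d : Ω → δ}
    (ha : Measurable a) (hb : Measurable b) (hc : Measurable c) (hd : Measurable d)
    (hab : IndepFun a b P) (hcd : IndepFun c d P)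
    (h : IndepFun (fun ω => (a ω, b ω)) (fun ω => (c ω, d ω)) P)
    {f : (α × γ) × β × δ → ℝ≥0∞} (hf : Measurable f) :
    ∫⁻ ω, f ((a ω, c ω), b ω, d ω) ∂P
      = ∫⁻ ω, ∫⁻ y, ∫⁻ z, f ((a ω, c ω), y, z) ∂(P.map d) ∂(P.map b) ∂P := by
  have := Measure.isProbabilityMeasure_map (μ := P) ha.aemeasurable
  have := Measure.isProbabilityMeasure_map (μ := P) hb.aemeasurable
  have := Measure.isProbabilityMeasure_map (μ := P) hc.aemeasurable
  have := Measure.isProbabilityMeasure_map (μ := P) hd.aemeasurable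
  have hac : IndepFun a c P := h.comp measurable_fst measurable_fst
  have e1 : ∫⁻ ω, f ((a ω, c ω), b ω, d ω) ∂P = ∫⁻ x, ∫⁻ u, ∫⁻ y, ∫⁻ z, f ((x, u), y, z)
      ∂(P.map d) ∂(P.map b) ∂(P.map c) ∂(P.map a) := by
    have hm : Measurable fun q : (α × β) × γ × δ => f ((q.1.1, q.2.1), q.1.2, q.2.2) :=
      hf.comp (by fun_prop)
    rw [lintegral_comp_indepFun (f := fun q : (α × β) × γ × δ => f ((q.1.1, q.2.1), q.1.2, q.2.2))
      (ha.prodMk hb) (hc.prodMk hd) h hm,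
      (indepFun_iff_map_prod_eq_prod_map_map ha.aemeasurable hb.aemeasurable).1 hab,
      (indepFun_iff_map_prod_eq_prod_map_map hc.aemeasurable hd.aemeasurable).1 hcd,
      lintegral_prod _ (Measurable.aemeasurable (by exact hm.lintegral_prod_right'))]
    refine lintegral_congr fun x => ?_
    have h1 : ∀ y, ∫⁻ (v : γ × δ), f ((x, v.1), y, v.2) ∂(P.map c).prod (P.map d)
        = ∫⁻ u, ∫⁻ z, f ((x, u), y, z) ∂(P.map d) ∂(P.map c) := fun y =>
      lintegral_prod _ (Measurable.aemeasurable (hf.comp (by fun_prop)))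
    simp only [h1]
    refine lintegral_lintegral_swap (Measurable.aemeasurable ?_)
    have : Measurable fun q : (β × γ) × δ => f ((x, q.1.2), q.1.1, q.2) := hf.comp (by fun_prop)
    exact this.lintegral_prod_right'
  rw [e1]
  have hm2 : Measurable fun q : α × γ => ∫⁻ y, ∫⁻ z, f (q, y, z) ∂(P.map d) ∂(P.map b) := by
    have h3 : Measurable fun q : ((α × γ) × β) × δ => f (q.1.1, q.1.2, q.2) := hf.comp (by fun_prop)
    have h4 : Measurable fun q : (α × γ) × β => ∫⁻ z, f (q.1, q.2, z) ∂(P.map d) :=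
      h3.lintegral_prod_right'
    exact h4.lintegral_prod_right'
  exact (lintegral_comp_indepFun ha hc hac hm2).symm

end Fubini

/-- Exponential waiting: the time `e` itself can be traded for the uniform clock before `e`. -/
theorem lintegral_expMeasure_eq {l : ℝ} (hl : 0 < l) {f : ℝ → ℝ≥0∞} (hf : Measurable f) :
    ∫⁻ e, f e ∂(expMeasure l)
      = ∫⁻ e, (∫⁻ s in Ioo 0 e, ENNReal.ofReal l * f s) ∂(expMeasure l) := by
  have := isProbabilityMeasure_expMeasure hl
  have htail : ∀ s : ℝ, 0 ≤ s → expMeasure l (Ioi s) = ENNReal.ofReal (Real.exp (-(l * s))) := by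
    intro s hs
    have h1 : (expMeasure l).real (Iic s) = 1 - Real.exp (-(l * s)) := by
      rw [← cdf_eq_real, cdf_expMeasure_eq hl, if_pos hs]
    rw [← compl_Iic, ← ofReal_measureReal, probReal_compl_eq_one_sub measurableSet_Iic, h1]
    congr 1; ring
  have hpdf : expMeasure l = volume.withDensity (exponentialPDF l) := rfl
  have hm : Measurable fun q : ℝ × ℝ => (Ioo 0 q.1).indicator (fun s => ENNReal.ofReal l * f s) q.2 := by
    have : MeasurableSet {q : ℝ × ℝ | 0 < q.2 ∧ q.2 < q.1} :=
      (measurableSet_lt measurable_const measurable_snd).inter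
        (measurableSet_lt measurable_snd measurable_fst)
    exact (((hf.comp measurable_snd).const_mul (ENNReal.ofReal l))).indicator this
  have e1 : ∫⁻ e, (∫⁻ s in Ioo 0 e, ENNReal.ofReal l * f s) ∂(expMeasure l)
      = ∫⁻ s, ∫⁻ e, (Ioo 0 e).indicator (fun s => ENNReal.ofReal l * f s) s ∂(expMeasure l) := by
    have h1 : ∀ e : ℝ, ∫⁻ s in Ioo 0 e, ENNReal.ofReal l * f s
        = ∫⁻ s, (Ioo 0 e).indicator (fun s => ENNReal.ofReal l * f s) s := fun e =>
      (lintegral_indicator measurableSet_Ioo _).symm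
    simp only [h1]
    exact lintegral_lintegral_swap hm.aemeasurable
  have e2 : ∀ s, ∫⁻ e, (Ioo 0 e).indicator (fun s => ENNReal.ofReal l * f s) s ∂(expMeasure l)
      = (Ioi 0).indicator (fun s => ENNReal.ofReal (l * Real.exp (-(l * s))) * f s) s := by
    intro s
    by_cases hs : 0 < s
    · rw [indicator_of_mem (show s ∈ Ioi (0 : ℝ) from hs)]
      have : ∀ e, (Ioo 0 e).indicator (fun s => ENNReal.ofReal l * f s) s
          = (Ioi s).indicator (fun _ => ENNReal.ofReal l * f s) e := by
        intro e
        by_cases h : s < e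
        · rw [indicator_of_mem (show s ∈ Ioo 0 e from ⟨hs, h⟩),
            indicator_of_mem (show e ∈ Ioi s from h)]
        · rw [indicator_of_notMem (fun h' => h h'.2), indicator_of_notMem (by simpa using h)]
      simp only [this]
      rw [lintegral_indicator measurableSet_Ioi, setLIntegral_const, htail s hs.le,
        ENNReal.ofReal_mul hl.le]
      ring
    · rw [indicator_of_notMem (by simpa using hs)]
      have : ∀ e, (Ioo 0 e).indicator (fun s => ENNReal.ofReal l * f s) s = 0 := fun e =>
        indicator_of_notMem (fun h => hs h.1) _
      simp [this]
  rw [e1, lintegral_congr e2, hpdf,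
    lintegral_withDensity_eq_lintegral_mul volume (f := exponentialPDF l)
      (measurable_exponentialPDFReal l).ennreal_ofReal hf]
  refine lintegral_congr_ae ?_
  have h0 : ∀ᵐ s : ℝ, s ≠ 0 := by simp [ae_iff]
  filter_upwards [h0] with s hs
  rw [Pi.mul_apply, exponentialPDF_eq]
  by_cases h : 0 < s
  · rw [indicator_of_mem (show s ∈ Ioi (0 : ℝ) from h), if_pos h.le]
  · rw [indicator_of_notMem (by simpa using h), if_neg (fun h' => hs (le_antisymm (not_lt.1 h) h'))]
    simp

namespace Shocks

variable {Ω : Type*} [mΩ : MeasurableSpace Ω] {A : MaintenanceModel} {P : Measure Ω}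
  (X : Shocks A P)

/-- The waiting times of the Poisson process. -/
def waiting : ℕ → Ω → ℝ := X.poisson.choose

theorem measurable_waiting (i : ℕ) : Measurable (X.waiting i) := X.poisson.choose_spec.1 i

theorem iIndepFun_waiting : iIndepFun X.waiting P := X.poisson.choose_spec.2.1

theorem map_waiting (i : ℕ) : P.map (X.waiting i) = expMeasure A.lam :=
  X.poisson.choose_spec.2.2.1 i

theorem le_N_iff_sum (ω : Ω) (t : ℝ≥0) (n : ℕ) :
    n ≤ X.N t ω ↔ ∑ i ∈ Finset.range n, X.waiting i ω ≤ t :=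
  X.poisson.choose_spec.2.2.2 ω t n

/-- The time of the `n`-th shock; the `0`-th is time `0`. -/
def arrival (n : ℕ) (ω : Ω) : ℝ≥0 := (∑ i ∈ Finset.range n, X.waiting i ω).toNNReal

theorem le_N_iff (ω : Ω) (t : ℝ≥0) (n : ℕ) : n ≤ X.N t ω ↔ X.arrival n ω ≤ t := by
  rw [X.le_N_iff_sum, arrival, Real.toNNReal_le_iff_le_coe]

theorem lt_arrival_iff (ω : Ω) (t : ℝ≥0) (n : ℕ) : t < X.arrival n ω ↔ X.N t ω < n := by
  rw [← not_le, ← X.le_N_iff, not_le]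

@[simp] theorem arrival_zero (ω : Ω) : X.arrival 0 ω = 0 := by simp [arrival]

theorem arrival_mono (ω : Ω) : Monotone fun n => X.arrival n ω :=
  monotone_nat_of_le_succ fun n =>
    (X.le_N_iff ω _ n).1 ((Nat.le_succ n).trans ((X.le_N_iff ω _ (n + 1)).2 le_rfl))

theorem measurable_arrival (n : ℕ) : Measurable (X.arrival n) :=
  (Finset.measurable_sum _ fun i _ => X.measurable_waiting i).real_toNNReal

theorem exists_lt_arrival (ω : Ω) (t : ℝ≥0) : ∃ n, t < X.arrival n ω :=
  ⟨X.N t ω + 1, (X.lt_arrival_iff ω t _).2 (Nat.lt_succ_self _)⟩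


theorem waiting_pos : ∀ᵐ ω ∂P, ∀ i, 0 < X.waiting i ω := by
  refine ae_all_iff.2 fun i => ?_
  have := isProbabilityMeasure_expMeasure A.lam_pos
  have h0 : expMeasure A.lam (Iic 0) = 0 := by
    rw [← ofReal_measureReal, ← cdf_eq_real, cdf_expMeasure_eq A.lam_pos]
    simp
  rw [← X.map_waiting i, Measure.map_apply (X.measurable_waiting i) measurableSet_Iic] at h0
  rw [ae_iff]
  convert! h0 using 2
  ext ω
  simp

theorem coe_arrival : ∀ᵐ ω ∂P, ∀ n, (X.arrival n ω : ℝ) = ∑ i ∈ Finset.range n, X.waiting i ω := by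
  filter_upwards [X.waiting_pos] with ω hω n
  exact Real.coe_toNNReal _ (Finset.sum_nonneg fun i _ => (hω i).le)

theorem arrival_strictMono : ∀ᵐ ω ∂P, StrictMono fun n => X.arrival n ω := by
  filter_upwards [X.waiting_pos, X.coe_arrival] with ω h1 h2
  refine strictMono_nat_of_lt_succ fun n => ?_
  rw [← NNReal.coe_lt_coe, h2, h2, Finset.sum_range_succ]
  linarith [h1 n]

/-- The time between the `n`-th shock (or the start, for `n = 0`) and the next one. -/
def gap (n : ℕ) (ω : Ω) : ℝ := X.arrival (n + 1) ω - X.arrival n ω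

theorem measurable_gap (n : ℕ) : Measurable (X.gap n) :=
  (X.measurable_arrival _).coe_nnreal_real.sub (X.measurable_arrival _).coe_nnreal_real

theorem gap_ae_eq (n : ℕ) : X.waiting n =ᵐ[P] X.gap n := by
  filter_upwards [X.coe_arrival] with ω h
  rw [gap, h, h, Finset.sum_range_succ]
  ring

theorem map_gap (n : ℕ) : P.map (X.gap n) = expMeasure A.lam := by
  rw [← X.map_waiting n]
  exact Measure.map_congr (X.gap_ae_eq n).symm

theorem iIndepFun_gap : iIndepFun X.gap P :=
  (iIndepFun_congr X.gap_ae_eq).1 X.iIndepFun_waiting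

theorem coe_arrival_eq_sum (n : ℕ) (ω : Ω) :
    (X.arrival n ω : ℝ) = ∑ i ∈ Finset.range n, X.gap i ω := by
  have := Finset.sum_range_sub (fun n => (X.arrival n ω : ℝ)) n
  simp only [gap, this]
  simp

/-- The gaps are functions of the counting process, hence independent of the shock sizes. -/
theorem indepFun_gap_S : IndepFun (fun ω n => X.gap n ω) (fun ω i => X.S i ω) P := by
  refine indep_of_indep_of_le_left X.indep_N_S ?_
  have hN : ∀ t, Measurable[MeasurableSpace.comap (fun ω t => X.N t ω) inferInstance] (X.N t) :=
    fun t => (measurable_pi_apply t).comp (comap_measurable fun ω t => X.N t ω)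
  have harr : ∀ n, Measurable[MeasurableSpace.comap (fun ω t => X.N t ω) inferInstance]
      (X.arrival n) := by
    intro n
    refine @measurable_of_Iic ℝ≥0 Ω _ _ _ (MeasurableSpace.comap (fun ω t => X.N t ω) inferInstance)
      _ _ _ _ fun t => ?_
    have : X.arrival n ⁻¹' Iic t = X.N t ⁻¹' Ici n := by
      ext ω
      simp [X.le_N_iff]
    rw [this]
    exact hN t measurableSet_Ici
  have hgap : Measurable[MeasurableSpace.comap (fun ω t => X.N t ω) inferInstance]
      (fun ω n => X.gap n ω) := by
    refine @measurable_pi_lambda _ _ _ (_) _ _ fun n => ?_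
    exact Measurable.sub (measurable_coe_nnreal_real.comp (harr (n + 1)))
      (measurable_coe_nnreal_real.comp (harr n))
  exact hgap.comap_le

/-- Gaps and sizes of the shocks as sequences. -/
abbrev History : Type := (ℕ → ℝ) × (ℕ → ℝ)

/-- The history of the first `n` shocks: their gaps and sizes, continued by `0`. -/
def hist (n : ℕ) (ω : Ω) : History :=
  (fun i => if i < n then X.gap i ω else 0, fun i => if i < n then X.S i ω else 0)

theorem measurable_hist (n : ℕ) : Measurable (X.hist n) := by
  refine Measurable.prodMk (measurable_pi_lambda _ fun i => ?_) (measurable_pi_lambda _ fun i => ?_)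
  · by_cases h : i < n
    · simpa [h] using X.measurable_gap i
    · simp [h]
  · by_cases h : i < n
    · simpa [h] using X.measurable_S i
    · simp [h]

theorem indepFun_init {f : ℕ → Ω → ℝ} (hf : iIndepFun f P) (hm : ∀ i, Measurable (f i)) (n : ℕ) :
    IndepFun (fun ω i => if i < n then f i ω else 0) (f n) P := by
  have h := hf.indepFun_finset (Finset.range n) {n} (by simp) hm
  have h1 : Measurable fun v : Finset.range n → ℝ =>
      (fun i : ℕ => if hi : i ∈ Finset.range n then v ⟨i, hi⟩ else 0) := by
    refine measurable_pi_lambda _ fun i => ?_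
    by_cases hi : i ∈ Finset.range n
    · simpa only [hi, dite_true] using measurable_pi_apply _
    · simpa only [hi, dite_false] using measurable_const
  have h2 : Measurable fun v : ({n} : Finset ℕ) → ℝ => v ⟨n, by simp⟩ := measurable_pi_apply _
  have h3 := h.comp h1 h2
  have e1 : (fun ω i => if i < n then f i ω else 0)
      = (fun v : Finset.range n → ℝ =>
      (fun i : ℕ => if hi : i ∈ Finset.range n then v ⟨i, hi⟩ else 0)) ∘
        fun ω (i : Finset.range n) => f i ω := by
    funext ω i
    by_cases hi : i < n <;> simp [hi]
  rw [e1]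
  exact h3

/-- The `n`-th gap is exponential, the size of the next shock has law `F`, and both are independent
of the history. -/
theorem lintegral_hist [IsProbabilityMeasure P] (n : ℕ) {f : History × ℝ × ℝ → ℝ≥0∞}
    (hf : Measurable f) :
    ∫⁻ ω, f (X.hist n ω, X.gap n ω, X.S n ω) ∂P
      = ∫⁻ ω, ∫⁻ e, ∫⁻ x, f (X.hist n ω, e, x) ∂A.F ∂(expMeasure A.lam) ∂P := by
  rw [← X.map_gap n, ← X.law_S n]
  have hg : Measurable fun v : ℕ → ℝ => ((fun i => if i < n then v i else 0), v n) := by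
    refine Measurable.prodMk (measurable_pi_lambda _ fun i => ?_) (measurable_pi_apply n)
    by_cases h : i < n
    · simpa [h] using measurable_pi_apply i
    · simp [h]
  exact lintegral_comp_indepFun_pairs (a := fun ω i => if i < n then X.gap i ω else 0)
    (b := X.gap n) (c := fun ω i => if i < n then X.S i ω else 0) (d := X.S n)
    (measurable_fst.comp (X.measurable_hist n)) (X.measurable_gap n)
    (measurable_snd.comp (X.measurable_hist n)) (X.measurable_S n)
    (indepFun_init X.iIndepFun_gap X.measurable_gap n)
    (indepFun_init X.indep_S X.measurable_S n)
    (X.indepFun_gap_S.comp hg hg) hf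

/-- The time of the `n`-th shock as a function of a history. -/
def History.arrival (n : ℕ) (η : History) : ℝ≥0 := (∑ i ∈ Finset.range n, η.1 i).toNNReal

theorem History.measurable_arrival (n : ℕ) : Measurable (History.arrival n) :=
  (Finset.measurable_sum _ fun i _ =>
    (measurable_pi_apply i).comp measurable_fst).real_toNNReal

theorem arrival_hist {n j : ℕ} (hj : j ≤ n) (ω : Ω) :
    History.arrival j (X.hist n ω) = X.arrival j ω := by
  rw [← Real.toNNReal_coe (r := X.arrival j ω), coe_arrival_eq_sum, History.arrival]
  congr 1
  refine Finset.sum_congr rfl fun i hi => ?_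
  rw [hist]
  simp [(Finset.mem_range.1 hi).trans_le hj]

/-- The compensation formula: a function of the history, of the time of the next shock and of its
size has the same expectation as its integral against the intensity up to the next shock. -/
theorem lintegral_next_shock [IsProbabilityMeasure P] (n : ℕ) {f : History × ℝ≥0 × ℝ → ℝ≥0∞}
    (hf : Measurable f) :
    ∫⁻ ω, f (X.hist n ω, X.arrival (n + 1) ω, X.S n ω) ∂P
      = ∫⁻ ω, (∫⁻ s in Ioo (X.arrival n ω : ℝ) (X.arrival (n + 1) ω),
          ENNReal.ofReal A.lam * ∫⁻ x, f (X.hist n ω, s.toNNReal, x) ∂A.F) ∂P := by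
  have := A.isProbabilityMeasure_F
  have := isProbabilityMeasure_expMeasure A.lam_pos
  have hta : ∀ ω, X.arrival (n + 1) ω
      = ((History.arrival n (X.hist n ω) : ℝ) + X.gap n ω).toNNReal := by
    intro ω
    rw [X.arrival_hist le_rfl, gap, add_sub_cancel, Real.toNNReal_coe]
  have hmarr := (History.measurable_arrival n).coe_nnreal_real
  set g : History × ℝ × ℝ → ℝ≥0∞ := fun q =>
    f (q.1, ((History.arrival n q.1 : ℝ) + q.2.1).toNNReal, q.2.2) with hg
  have hgm : Measurable g := hf.comp (measurable_fst.prodMk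
    (Measurable.prodMk (((hmarr.comp measurable_fst).add
      (measurable_fst.comp measurable_snd)).real_toNNReal) (measurable_snd.comp measurable_snd)))
  have hgbar : Measurable fun q : History × ℝ => ∫⁻ x, g (q.1, q.2, x) ∂A.F := by
    have : Measurable fun p : (History × ℝ) × ℝ => g (p.1.1, p.1.2, p.2) := hgm.comp (by fun_prop)
    exact this.lintegral_prod_right'
  have e1 : ∫⁻ ω, f (X.hist n ω, X.arrival (n + 1) ω, X.S n ω) ∂P
      = ∫⁻ ω, g (X.hist n ω, X.gap n ω, X.S n ω) ∂P := by
    refine lintegral_congr fun ω => ?_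
    rw [hta ω]
  have hjm : Measurable fun q : (History × ℝ) × ℝ => (Ioo 0 q.1.2).indicator
      (fun s => ENNReal.ofReal A.lam * ∫⁻ x, g (q.1.1, s, x) ∂A.F) q.2 := by
    have hs : MeasurableSet {q : (History × ℝ) × ℝ | 0 < q.2 ∧ q.2 < q.1.2} :=
      (measurableSet_lt measurable_const measurable_snd).inter
        (measurableSet_lt measurable_snd (measurable_snd.comp measurable_fst))
    have h1 : Measurable fun q : (History × ℝ) × ℝ =>
        ENNReal.ofReal A.lam * ∫⁻ x, g (q.1.1, q.2, x) ∂A.F :=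
      (hgbar.comp (by fun_prop : Measurable fun q : (History × ℝ) × ℝ => (q.1.1, q.2))).const_mul _
    exact h1.indicator hs
  have hj2 : Measurable fun q : History × ℝ × ℝ => ∫⁻ s in Ioo 0 q.2.1,
      ENNReal.ofReal A.lam * ∫⁻ x, g (q.1, s, x) ∂A.F := by
    have := (hjm.lintegral_prod_right' (ν := (volume : Measure ℝ))).comp
      (by fun_prop : Measurable fun q : History × ℝ × ℝ => (q.1, q.2.1))
    convert this using 2 with q
    exact (lintegral_indicator measurableSet_Ioo _).symm
  have e2 : ∫⁻ ω, (∫⁻ s in Ioo 0 (X.gap n ω), ENNReal.ofReal A.lam *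
        ∫⁻ x, g (X.hist n ω, s, x) ∂A.F) ∂P
      = ∫⁻ ω, ∫⁻ e, ∫⁻ x, g (X.hist n ω, e, x) ∂A.F ∂(expMeasure A.lam) ∂P := by
    rw [X.lintegral_hist n hj2]
    refine lintegral_congr fun ω => ?_
    simp only [lintegral_const, measure_univ, mul_one]
    exact (lintegral_expMeasure_eq A.lam_pos (f := fun e => ∫⁻ x, g (X.hist n ω, e, x) ∂A.F)
      (hgbar.comp measurable_prodMk_left)).symm
  rw [e1, X.lintegral_hist n hgm, ← e2]
  refine lintegral_congr fun ω => ?_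
  have hmp := (measurePreserving_add_left (volume : Measure ℝ) (X.arrival n ω : ℝ))
  have hpre : (fun s => (X.arrival n ω : ℝ) + s) ⁻¹' Ioo (X.arrival n ω : ℝ) (X.arrival (n + 1) ω)
      = Ioo 0 (X.gap n ω) := by
    ext s
    simp only [mem_preimage, mem_Ioo, gap]
    constructor <;> rintro ⟨h1, h2⟩ <;> constructor <;> linarith
  have key := hmp.setLIntegral_comp_preimage_emb (measurableEmbedding_addLeft _)
    (fun s => ENNReal.ofReal A.lam * ∫⁻ x, f (X.hist n ω, s.toNNReal, x) ∂A.F)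
    (Ioo (X.arrival n ω : ℝ) (X.arrival (n + 1) ω))
  rw [hpre] at key
  rw [← key]
  simp only [hg, X.arrival_hist le_rfl]

end Shocks

/-! ### Locality and joint measurability of the performance level -/

section Picard

variable {b : ℝ → ℝ} {B : ℝ} {K : ℝ≥0}

theorem picardIterate_congr {y y' : ℝ≥0 → ℝ} {I : Set ℝ≥0} (hI : IsLowerSet I) (h : EqOn y y' I)
    (n : ℕ) : EqOn (picardIterate b y n) (picardIterate b y' n) I := by
  induction n with
  | zero => exact h
  | succ n ih =>
    intro t ht
    simp only [picardIterate]
    rw [h ht]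
    congr 1
    refine intervalIntegral.integral_congr fun s hs => ?_
    rw [uIcc_of_le (NNReal.coe_nonneg t)] at hs
    have : s.toNNReal ∈ I := hI (Real.toNNReal_le_iff_le_coe.2 hs.2) ht
    simp only [ih this]

/-- The solution depends on the past of the input only. -/
theorem levelPath_congr {y y' : ℝ≥0 → ℝ} {I : Set ℝ≥0} (hI : IsLowerSet I) (h : EqOn y y' I) :
    EqOn (levelPath b y) (levelPath b y') I := by
  intro t ht
  simp only [levelPath, picardIterate_congr hI h _ ht]

theorem measurable_levelPath_uncurry (hK : LipschitzWith K b) (hB : ∀ x, |b x| ≤ B)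
    {Ω : Type*} {m : MeasurableSpace Ω} {y : Ω → ℝ≥0 → ℝ} (hy : Measurable (Function.uncurry y)) :
    Measurable fun p : Ω × ℝ≥0 => levelPath b (y p.1) p.2 := by
  have hyω : ∀ ω, Measurable (y ω) := fun ω => hy.comp measurable_prodMk_left
  have hyt : ∀ t, Measurable fun ω => y ω t := fun t => hy.comp measurable_prodMk_right
  have hu : Measurable (Function.uncurry fun (t : ℝ≥0) (ω : Ω) => y ω t - levelPath b (y ω) t) := by
    refine measurable_uncurry_of_continuous_of_measurable (fun ω => ?_) fun t => ?_
    · have : (fun t : ℝ≥0 => y ω t - levelPath b (y ω) t)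
          = fun t : ℝ≥0 => ∫ s in (0 : ℝ)..t, b (levelPath b (y ω) s.toNNReal) := by
        funext t
        rw [levelPath_eq hK hB (hyω ω) t]
        ring
      rw [this]
      exact (intervalIntegral.continuous_primitive (fun u v => intervalIntegrable_rate hK hB
        (measurable_levelPath hK hB (hyω ω)) u v) 0).comp NNReal.continuous_coe
    · exact (hyt t).sub (measurable_levelPath_apply hK hB hy t)
  have := hy.sub (hu.comp measurable_swap)
  convert this using 2 with p
  simp [Function.uncurry]

/-- The solution moves by at most `B * (t - a)` beyond the increments of the input. -/
theorem levelPath_sub (hK : LipschitzWith K b) (hB : ∀ x, |b x| ≤ B) {y : ℝ≥0 → ℝ}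
    (hy : Measurable y) (a t : ℝ≥0) :
    levelPath b y t - levelPath b y a
      = y t - y a - ∫ s in (a : ℝ)..t, b (levelPath b y s.toNNReal) := by
  have hi := fun u v => intervalIntegrable_rate hK hB (measurable_levelPath hK hB hy) u v
  rw [levelPath_eq hK hB hy t, levelPath_eq hK hB hy a,
    ← intervalIntegral.integral_interval_sub_left (hi 0 t) (hi 0 a)]
  ring

end Picard

/-- A right-continuous process is jointly measurable. -/
theorem measurable_uncurry_of_rightContinuous {Ω : Type*} {m : MeasurableSpace Ω}
    {f : Ω → ℝ≥0 → ℝ} (hc : ∀ ω t, ContinuousWithinAt (f ω) (Ici t) t)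
    (hm : ∀ t, Measurable fun ω => f ω t) : Measurable (Function.uncurry f) := by
  -- approximate the time `t` from the right by multiples of `1 / (n + 1)`
  set d : ℕ → ℝ≥0 → ℝ≥0 := fun n t => ((⌊t * (n + 1)⌋₊ : ℝ≥0) + 1) / (n + 1) with hd
  have hle : ∀ n t, t ≤ d n t := by
    intro n t
    rw [hd, le_div_iff₀ (by positivity)]
    exact (Nat.lt_floor_add_one _).le
  have hge : ∀ n t, d n t ≤ t + 1 / (n + 1) := by
    intro n t
    simp only [hd]
    rw [add_div]
    gcongr
    rw [div_le_iff₀ (by positivity)]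
    exact Nat.floor_le (by positivity)
  have hlim : ∀ t, Tendsto (fun n => d n t) atTop (𝓝[≥] t) := by
    intro t
    refine tendsto_nhdsWithin_iff.2 ⟨?_, Eventually.of_forall fun n => hle n t⟩
    refine tendsto_of_tendsto_of_tendsto_of_le_of_le tendsto_const_nhds ?_ (fun n => hle n t)
      (fun n => hge n t)
    have : Tendsto (fun n : ℕ => 1 / ((n : ℝ≥0) + 1)) atTop (𝓝 0) :=
      tendsto_one_div_add_atTop_nhds_zero_nat
    simpa using this.const_add t
  refine measurable_of_tendsto_metrizable (f := fun n (p : Ω × ℝ≥0) => f p.1 (d n p.2))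
    (fun n => ?_) (tendsto_pi_nhds.2 fun p => (hc p.1 p.2).tendsto.comp (hlim p.2))
  have h1 : Measurable fun q : ℕ × Ω => f q.2 (((q.1 : ℝ≥0) + 1) / (n + 1)) :=
    measurable_from_prod_countable_right fun k =>
      hm (((k : ℝ≥0) + 1) / (n + 1))
  have h2 : Measurable fun p : Ω × ℝ≥0 => (⌊p.2 * (n + 1)⌋₊, p.1) :=
    (Nat.measurable_floor.comp (measurable_snd.mul_const _)).prodMk measurable_fst
  exact h1.comp h2

namespace Shocks

variable {Ω : Type*} [mΩ : MeasurableSpace Ω] {A : MaintenanceModel} {P : Measure Ω}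
  (X : Shocks A P)

theorem N_eq {ω : Ω} {t : ℝ≥0} {n : ℕ} (h1 : X.arrival n ω ≤ t) (h2 : t < X.arrival (n + 1) ω) :
    X.N t ω = n :=
  le_antisymm (Nat.lt_succ_iff.1 ((X.lt_arrival_iff ω t _).1 h2)) ((X.le_N_iff ω t n).2 h1)

theorem arrival_N_le (ω : Ω) (t : ℝ≥0) : X.arrival (X.N t ω) ω ≤ t := (X.le_N_iff ω t _).1 le_rfl

theorem lt_arrival_N (ω : Ω) (t : ℝ≥0) : t < X.arrival (X.N t ω + 1) ω :=
  (X.lt_arrival_iff ω t _).2 (Nat.lt_succ_self _)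

theorem N_mono (ω : Ω) : Monotone fun t => X.N t ω := fun _ t h =>
  (X.le_N_iff ω t _).2 ((X.arrival_N_le ω _).trans h)

theorem N_eq_of_lt {ω : Ω} {a t : ℝ≥0} (h1 : a ≤ t) (h2 : t < X.arrival (X.N a ω + 1) ω) :
    X.N t ω = X.N a ω := X.N_eq ((X.arrival_N_le ω a).trans h1) h2

theorem damage_eq_of_lt {ω : Ω} {a t : ℝ≥0} (h1 : a ≤ t) (h2 : t < X.arrival (X.N a ω + 1) ω) :
    X.damage t ω = X.damage a ω := by
  rw [damage, damage, X.N_eq_of_lt h1 h2]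

theorem measurable_damage_path (ω : Ω) : Measurable fun t => X.damage t ω :=
  X.measurable_damage.comp measurable_prodMk_left

theorem damage_rightContinuous (ω : Ω) (t : ℝ≥0) :
    ContinuousWithinAt (fun t => X.damage t ω) (Ici t) t := by
  refine ContinuousWithinAt.congr_of_eventuallyEq (continuousWithinAt_const (b := X.damage t ω)) ?_
    rfl
  filter_upwards [Ico_mem_nhdsGE (X.lt_arrival_N ω t)] with s hs
  exact X.damage_eq_of_lt hs.1 hs.2

end Shocks

namespace MaintenanceModel

variable (A : MaintenanceModel)

theorem levelPath_eq {y : ℝ≥0 → ℝ} (hy : Measurable y) (t : ℝ≥0) :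
    levelPath A.rate y t
      = y t - ∫ s in (0 : ℝ)..t, A.rate (levelPath A.rate y s.toNNReal) := by
  obtain ⟨L, hL⟩ := A.exists_lipschitzWith_rate
  exact ImpulseMaintenance.levelPath_eq hL A.abs_rate_le hy t

theorem levelPath_sub {y : ℝ≥0 → ℝ} (hy : Measurable y) (a t : ℝ≥0) :
    levelPath A.rate y t - levelPath A.rate y a
      = y t - y a - ∫ s in (a : ℝ)..t, A.rate (levelPath A.rate y s.toNNReal) := by
  obtain ⟨L, hL⟩ := A.exists_lipschitzWith_rate
  exact ImpulseMaintenance.levelPath_sub hL A.abs_rate_le hy a t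

theorem measurable_levelPath {y : ℝ≥0 → ℝ} (hy : Measurable y) : Measurable (levelPath A.rate y) := by
  obtain ⟨L, hL⟩ := A.exists_lipschitzWith_rate
  exact ImpulseMaintenance.measurable_levelPath hL A.abs_rate_le hy

theorem measurable_levelPath_uncurry {Ω : Type*} {m : MeasurableSpace Ω} {y : Ω → ℝ≥0 → ℝ}
    (hy : Measurable (Function.uncurry y)) :
    Measurable fun p : Ω × ℝ≥0 => levelPath A.rate (y p.1) p.2 := by
  obtain ⟨L, hL⟩ := A.exists_lipschitzWith_rate
  exact ImpulseMaintenance.measurable_levelPath_uncurry hL A.abs_rate_le hy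

theorem intervalIntegrable_rate {f : ℝ≥0 → ℝ} (hf : Measurable f) (u v : ℝ) :
    IntervalIntegrable (fun s : ℝ => A.rate (f s.toNNReal)) volume u v := by
  obtain ⟨L, hL⟩ := A.exists_lipschitzWith_rate
  exact ImpulseMaintenance.intervalIntegrable_rate hL A.abs_rate_le hf u v

theorem integral_rate_nonneg {f : ℝ≥0 → ℝ} {a t : ℝ} (h : a ≤ t) :
    0 ≤ ∫ s in a..t, A.rate (f s.toNNReal) :=
  intervalIntegral.integral_nonneg h fun _ _ => (A.rate_pos _).le

theorem integral_rate_le {f : ℝ≥0 → ℝ} {a t : ℝ} (h : a ≤ t) :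
    ∫ s in a..t, A.rate (f s.toNNReal) ≤ A.c A.m * (t - a) := by
  have := intervalIntegral.norm_integral_le_of_norm_le_const (a := a) (b := t)
    (f := fun s : ℝ => A.rate (f s.toNNReal)) (C := A.c A.m) (fun s _ => A.abs_rate_le _)
  rw [abs_of_nonneg (sub_nonneg.2 h)] at this
  exact (le_abs_self _).trans this

theorem measurable_integral_rate {Ω : Type*} {m : MeasurableSpace Ω} {f : Ω × ℝ≥0 → ℝ}
    (hf : Measurable f) (t : ℝ) :
    Measurable fun ω => ∫ u in Ioc (0 : ℝ) t, A.rate (f (ω, u.toNNReal)) := by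
  have hj : Measurable fun p : Ω × ℝ => A.rate (f (p.1, p.2.toNNReal)) :=
    A.continuous_rate.measurable.comp (hf.comp (by fun_prop))
  exact (hj.stronglyMeasurable.integral_prod_right' (ν := volume.restrict (Ioc 0 t))).measurable

/-- Where the input is right-continuous, so is the level. -/
theorem levelPath_rightContinuous {y : ℝ≥0 → ℝ} (hy : Measurable y) {t : ℝ≥0}
    (hc : ContinuousWithinAt y (Ici t) t) : ContinuousWithinAt (levelPath A.rate y) (Ici t) t := by
  have h : levelPath A.rate y
      = fun t : ℝ≥0 => y t - ∫ s in (0 : ℝ)..t, A.rate (levelPath A.rate y s.toNNReal) :=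
    funext (A.levelPath_eq hy)
  have := (hc.sub (Continuous.continuousWithinAt (f := fun t : ℝ≥0 =>
    ∫ s in (0 : ℝ)..t, A.rate (levelPath A.rate y s.toNNReal)) ?_))
  · rw [h]; exact this
  exact (intervalIntegral.continuous_primitive (fun u v =>
    A.intervalIntegrable_rate (A.measurable_levelPath hy) u v) 0).comp NNReal.continuous_coe

end MaintenanceModel

/-! ### The filtration of the level determines the damage -/

namespace Shocks

variable {Ω : Type*} [mΩ : MeasurableSpace Ω] {A : MaintenanceModel} {P : Measure Ω}
  (X : Shocks A P) (r : ℝ)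

theorem measurable_level_filtration {s t : ℝ≥0} (hst : s ≤ t) :
    Measurable[X.filtration r t] (X.level r s) :=
  (Filtration.stronglyAdapted_natural
    (fun t => (X.measurable_level r t).stronglyMeasurable) s).measurable.mono
    ((X.filtration r).mono hst) le_rfl

theorem level_rightContinuous (ω : Ω) (t : ℝ≥0) :
    ContinuousWithinAt (fun t => X.level r t ω) (Ici t) t :=
  A.levelPath_rightContinuous (measurable_const.sub (X.measurable_damage_path ω))
    (continuousWithinAt_const.sub (X.damage_rightContinuous ω t))

theorem ContinuousWithinAt.stopped {f : ℝ≥0 → ℝ} (hf : ∀ s, ContinuousWithinAt f (Ici s) s)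
    (t s : ℝ≥0) : ContinuousWithinAt (fun s => f (min s t)) (Ici s) s :=
  (hf (min s t)).comp (f := fun s => min s t)
    (continuous_id.min continuous_const).continuousWithinAt
    fun _ hu => min_le_min_right t hu

theorem damage_eq (t : ℝ≥0) (ω : Ω) : X.damage t ω
    = r - X.level r t ω - ∫ s in (0 : ℝ)..t, A.rate (X.level r (min s.toNNReal t) ω) := by
  have h := A.levelPath_eq (y := fun s => r - X.damage s ω)
    (measurable_const.sub (X.measurable_damage_path ω)) t
  have e : ∫ s in (0 : ℝ)..t, A.rate (X.level r (min s.toNNReal t) ω)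
      = ∫ s in (0 : ℝ)..t, A.rate (levelPath A.rate (fun s => r - X.damage s ω) s.toNNReal) := by
    refine intervalIntegral.integral_congr fun s hs => ?_
    rw [uIcc_of_le (NNReal.coe_nonneg t)] at hs
    simp only [level, min_eq_left (Real.toNNReal_le_iff_le_coe.2 hs.2)]
  rw [e, level]
  linarith

theorem measurable_level_stopped (t : ℝ≥0) :
    Measurable[(X.filtration r t).prod inferInstance]
      fun p : Ω × ℝ≥0 => X.level r (min p.2 t) p.1 :=
  @measurable_uncurry_of_rightContinuous Ω (X.filtration r t)
    (fun ω s => X.level r (min s t) ω)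
    (fun ω s => ContinuousWithinAt.stopped (X.level_rightContinuous r ω) t s)
    (fun _ => X.measurable_level_filtration r (min_le_right _ _))

/-- The damage is adapted to the filtration generated by the level. -/
theorem measurable_damage_filtration {s t : ℝ≥0} (hst : s ≤ t) :
    Measurable[X.filtration r t] (X.damage s) := by
  refine Measurable.mono ?_ ((X.filtration r).mono hst) le_rfl
  have h2 := A.measurable_integral_rate (X.measurable_level_stopped r s) s
  have h3 : X.damage s = fun ω => r - X.level r s ω
      - ∫ u in Ioc (0 : ℝ) s, A.rate (X.level r (min u.toNNReal s) ω) := by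
    funext ω
    rw [X.damage_eq r s ω, intervalIntegral.integral_of_le (NNReal.coe_nonneg s)]
  rw [h3]
  exact (measurable_const.sub (X.measurable_level_filtration r le_rfl)).sub h2

theorem measurable_damage_stopped (t : ℝ≥0) :
    Measurable[(X.filtration r t).prod inferInstance]
      fun p : Ω × ℝ≥0 => X.damage (min p.2 t) p.1 :=
  @measurable_uncurry_of_rightContinuous Ω (X.filtration r t)
    (fun ω s => X.damage (min s t) ω)
    (fun ω s => ContinuousWithinAt.stopped (X.damage_rightContinuous ω) t s)
    (fun _ => X.measurable_damage_filtration r (min_le_right _ _))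

end Shocks

/-! ### Between two shocks everything is a function of the history -/

namespace Shocks

variable {Ω : Type*} [mΩ : MeasurableSpace Ω] {A : MaintenanceModel} {P : Measure Ω}
  (X : Shocks A P)

/-- The damage that the first `n` shocks of a history have caused up to time `u`. -/
def History.damage (n : ℕ) (η : History) (u : ℝ≥0) : ℝ :=
  ∑ i ∈ Finset.range n, if History.arrival (i + 1) η ≤ u then η.2 i else 0

theorem History.measurable_damage (n : ℕ) :
    Measurable fun p : History × ℝ≥0 => History.damage n p.1 p.2 := by
  refine Finset.measurable_sum _ fun i _ => Measurable.ite ?_ ?_ measurable_const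
  · exact measurableSet_le ((History.measurable_arrival _).comp measurable_fst) measurable_snd
  · exact (measurable_pi_apply i).comp (measurable_snd.comp measurable_fst)

theorem damage_eq_hist {n : ℕ} {ω : Ω} {u : ℝ≥0} (hu : u < X.arrival (n + 1) ω) :
    X.damage u ω = History.damage n (X.hist n ω) u := by
  have hN : X.N u ω ≤ n := Nat.lt_succ_iff.1 ((X.lt_arrival_iff ω u _).1 hu)
  rw [damage, History.damage, ← Finset.sum_subset (Finset.range_mono hN) fun i hi hi' => ?_]
  · refine Finset.sum_congr rfl fun i hi => ?_
    have hi' := Finset.mem_range.1 hi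
    rw [X.arrival_hist (by omega), if_pos ((X.le_N_iff ω u _).1 hi'), hist]
    simp [hi'.trans_le hN]
  · have hi1 := Finset.mem_range.1 hi
    rw [X.arrival_hist (by omega), if_neg]
    rw [← X.le_N_iff]
    simpa using hi'

/-- The uncontrolled level for the damage that the first `n` shocks of a history cause. -/
def History.level (A : MaintenanceModel) (r : ℝ) (n : ℕ) (p : History × ℝ≥0) : ℝ :=
  levelPath A.rate (fun u => r - History.damage n p.1 u) p.2

theorem History.measurable_level (A : MaintenanceModel) (r : ℝ) (n : ℕ) :
    Measurable (History.level A r n) :=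
  A.measurable_levelPath_uncurry (y := fun η u => r - History.damage n η u)
    (Measurable.const_sub (History.measurable_damage n) r)

/-- On the event that the next shock has not occurred, an event of the filtration is an event of
the history. -/
theorem exists_hist_set (r : ℝ) (n : ℕ) {t : ℝ≥0} {s : Set Ω}
    (hs : MeasurableSet[X.filtration r t] s) :
    ∃ B, MeasurableSet B ∧ ∀ ω, t < X.arrival (n + 1) ω → (ω ∈ s ↔ X.hist n ω ∈ B) := by
  set ι : {ω // t < X.arrival (n + 1) ω} → Ω := Subtype.val with hι
  have hle : MeasurableSpace.comap ι (X.filtration r t)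
      ≤ MeasurableSpace.comap (X.hist n ∘ ι) inferInstance := by
    have : X.filtration r t = ⨆ j ≤ t, MeasurableSpace.comap (X.level r j) inferInstance := rfl
    rw [this]
    simp only [MeasurableSpace.comap_iSup, MeasurableSpace.comap_comp]
    refine iSup₂_le fun j hjt => ?_
    have hΦm := (History.measurable_level A r n).comp (measurable_prodMk_right (y := j))
    set Φ : History → ℝ := fun η => History.level A r n (η, j) with hΦ
    have e : X.level r j ∘ ι = Φ ∘ (X.hist n ∘ ι) := by
      funext ω
      have hy : EqOn (fun u => r - X.damage u ω.1)
          (fun u => r - History.damage n (X.hist n ω.1) u) (Iio (X.arrival (n + 1) ω.1)) :=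
        fun u hu => by simp only [X.damage_eq_hist hu]
      have := levelPath_congr (b := A.rate) (isLowerSet_Iio _) hy (hjt.trans_lt ω.2)
      exact this
    rw [e, ← MeasurableSpace.comap_comp]
    exact MeasurableSpace.comap_mono hΦm.comap_le
  obtain ⟨B, hB, h⟩ := hle _ ⟨s, hs, rfl⟩
  exact ⟨B, hB, fun ω hω => (Set.ext_iff.1 h ⟨ω, hω⟩).symm⟩

end Shocks

namespace ImpulseControl

variable {Ω : Type*} [mΩ : MeasurableSpace Ω] {A : MaintenanceModel} {P : Measure Ω}
  {X : Shocks A P} {r : ℝ} (ν : ImpulseControl X r)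

theorem measurableSet_intervention (i : ℕ) {C : Set ℝ} (hC : MeasurableSet C) (q : ℝ≥0) :
    MeasurableSet[X.filtration r q] {ω | ν.ζ i ω ∈ C ∧ ν.τ i ω ≤ q} :=
  ((ν.measurable_ζ i) hC).2 q

open Classical in
/-- The improvement made before time `s`, as a process in `s`, is up to the next shock a function
of the history. -/
theorem exists_hist_impulse (n i : ℕ) : ∃ g : Shocks.History × ℝ≥0 → ℝ, Measurable g ∧
    ∀ ω, ∀ s ≤ X.arrival (n + 1) ω,
      (if ν.τ i ω < (s : WithTop ℝ≥0) then ν.ζ i ω else 0) = g (X.hist n ω, s) := by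
  set D := {p : Ω × ℝ≥0 // p.2 ≤ X.arrival (n + 1) p.1}
  set φ : D → Shocks.History × ℝ≥0 := fun d => (X.hist n d.1.1, d.1.2) with hφ
  set f : D → ℝ := fun d => if ν.τ i d.1.1 < (d.1.2 : WithTop ℝ≥0) then ν.ζ i d.1.1 else 0 with hf
  have key : ∀ C : Set ℝ, MeasurableSet C → (0 : ℝ) ∉ C →
      MeasurableSet[MeasurableSpace.comap φ inferInstance] (f ⁻¹' C) := by
    intro C hC h0
    have hq : ∀ q : ℝ≥0, ∃ B, MeasurableSet B ∧ ∀ ω, q < X.arrival (n + 1) ω →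
        (ω ∈ {ω | ν.ζ i ω ∈ C ∧ ν.τ i ω ≤ q} ↔ X.hist n ω ∈ B) := fun q =>
      X.exists_hist_set r n (ν.measurableSet_intervention i hC q)
    choose B hB hBq using hq
    set u := TopologicalSpace.denseSeq ℝ≥0 with hu
    refine ⟨⋃ k, B (u k) ×ˢ Ioi (u k),
      MeasurableSet.iUnion fun k => (hB _).prod measurableSet_Ioi, ?_⟩
    ext d
    obtain ⟨⟨ω, s⟩, hd⟩ := d
    simp only [hφ, hf, mem_preimage, mem_iUnion, mem_prod, mem_Ioi]
    constructor
    · rintro ⟨k, hk, hks⟩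
      have := (hBq (u k) ω (hks.trans_le hd)).2 hk
      have hlt : ν.τ i ω < (s : WithTop ℝ≥0) := this.2.trans_lt (WithTop.coe_lt_coe.2 hks)
      rw [if_pos hlt]
      exact this.1
    · intro h
      by_cases hlt : ν.τ i ω < (s : WithTop ℝ≥0)
      · rw [if_pos hlt] at h
        obtain ⟨a, ha⟩ := WithTop.ne_top_iff_exists.1 (ne_top_of_lt hlt)
        rw [← ha, WithTop.coe_lt_coe] at hlt
        obtain ⟨b, hb⟩ := (TopologicalSpace.denseRange_denseSeq ℝ≥0).exists_between hlt
        obtain ⟨k, hk⟩ := hb.1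
        have hab : u k ∈ Ioo a s := by rw [hu, hk]; exact hb.2
        refine ⟨k, (hBq (u k) ω (hab.2.trans_le hd)).1 ⟨h, ?_⟩, hab.2⟩
        rw [← ha, WithTop.coe_le_coe]
        exact hab.1.le
      · rw [if_neg hlt] at h
        exact absurd h h0
  have hfm : Measurable[MeasurableSpace.comap φ inferInstance] f := by
    intro C hC
    by_cases h0 : (0 : ℝ) ∈ C
    · have := (key Cᶜ hC.compl (fun h => h h0)).compl
      rwa [← preimage_compl, compl_compl] at this
    · exact key C hC h0
  obtain ⟨g, hg, h⟩ := hfm.exists_eq_measurable_comp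
  exact ⟨g, hg, fun ω s hs => congrFun h ⟨(ω, s), hs⟩⟩

end ImpulseControl

/-! ### Regular sample points of a controlled level -/

theorem Shocks.S_nonneg {Ω : Type*} [MeasurableSpace Ω] {A : MaintenanceModel} {P : Measure Ω}
    (X : Shocks A P) : ∀ᵐ ω ∂P, ∀ i, 0 ≤ X.S i ω := by
  refine ae_all_iff.2 fun i => ?_
  have h := A.F_nonneg
  rw [← X.law_S i, Measure.map_apply (X.measurable_S i) measurableSet_Iio] at h
  rw [ae_iff]
  convert! h using 2
  ext ω
  simp

namespace ImpulseControl

variable {Ω : Type*} [mΩ : MeasurableSpace Ω] {A : MaintenanceModel} {P : Measure Ω}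
  {X : Shocks A P} {r : ℝ} (ν : ImpulseControl X r)

/-- The sample points at which the almost sure properties of the shocks and of an admissible
control hold. -/
structure IsRegular (ω : Ω) : Prop where
  strictMono_arrival : StrictMono fun n => X.arrival n ω
  S_nonneg : ∀ i, 0 ≤ X.S i ω
  τ_mono : Monotone fun i => ν.τ i ω
  tendsto_τ : Tendsto (fun i => ν.τ i ω) atTop (𝓝 ⊤)
  ζ_mem : ∀ i, ν.τ i ω ≠ ⊤ → ν.ζ i ω ∈ Icc 0 (A.M - ν.levelBefore i ω)

theorem ae_isRegular (hν : ν.IsAdmissible) : ∀ᵐ ω ∂P, ν.IsRegular ω := by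
  filter_upwards [X.arrival_strictMono, X.S_nonneg, ae_all_iff.2 ν.τ_le_succ, ν.tendsto_τ, hν]
    with ω h1 h2 h3 h4 h5
  exact ⟨h1, h2, monotone_nat_of_le_succ h3, h4, h5⟩

open Classical in
/-- The sum of the improvements made before time `s`. -/
def impulses (ω : Ω) (s : ℝ≥0) : ℝ :=
  ∑' i, if ν.τ i ω < (s : WithTop ℝ≥0) then ν.ζ i ω else 0

theorem level_def (t : ℝ≥0) (ω : Ω) :
    ν.level t ω = levelPath A.rate (fun s => r - X.damage s ω + ν.impulses ω s) t := rfl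

/-- The level in the `n`-th stage (after `n` shocks and before the next one) with the first `i`
interventions taken into account. It is continuous in time up to and including the time of the
next shock. -/
def stageLevel (n i : ℕ) (t : ℝ≥0) (ω : Ω) : ℝ :=
  r - X.damage (X.arrival n ω) ω + ∑ j ∈ Finset.range i, ν.ζ j ω
    - ∫ s in (0 : ℝ)..t, A.rate (ν.level s.toNNReal ω)

theorem stageLevel_succ (n i : ℕ) (t : ℝ≥0) (ω : Ω) :
    ν.stageLevel n (i + 1) t ω = ν.stageLevel n i t ω + ν.ζ i ω := by
  rw [stageLevel, stageLevel, Finset.sum_range_succ]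
  ring

theorem le_failureTime_iff {ω : Ω} {s : ℝ≥0} :
    (s : WithTop ℝ≥0) ≤ ν.failureTime ω ↔ ∀ u < s, A.m ≤ ν.level u ω := by
  rw [failureTime, le_sInf_iff]
  constructor
  · intro h u hu
    by_contra hlt
    exact absurd (WithTop.coe_le_coe.1 (h _ ⟨u, not_le.1 hlt, rfl⟩)) (not_le.2 hu)
  · rintro h _ ⟨u, hu, rfl⟩
    rw [WithTop.coe_le_coe]
    by_contra hlt
    exact absurd (h u (not_le.1 hlt)) (not_le.2 hu)

namespace IsRegular

variable {ν} {ω : Ω}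

theorem exists_count (h : ν.IsRegular ω) (s : ℝ≥0) :
    ∃ n, ∀ j, ν.τ j ω < (s : WithTop ℝ≥0) ↔ j < n := by
  classical
  have hex : ∃ n, ¬ ν.τ n ω < (s : WithTop ℝ≥0) := by
    have := h.tendsto_τ.eventually (lt_mem_nhds (WithTop.coe_lt_top s))
    obtain ⟨n, hn⟩ := this.exists
    exact ⟨n, hn.not_gt⟩
  refine ⟨Nat.find hex, fun j => ⟨fun hj => ?_, fun hj => not_not.1 (Nat.find_min hex hj)⟩⟩
  by_contra hle
  exact Nat.find_spec hex ((h.τ_mono (not_lt.1 hle)).trans_lt hj)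

theorem ζ_nonneg (h : ν.IsRegular ω) {i : ℕ} {s : ℝ≥0} (hi : ν.τ i ω < (s : WithTop ℝ≥0)) :
    0 ≤ ν.ζ i ω := (h.ζ_mem i (ne_top_of_lt hi)).1

theorem impulses_eq (_h : ν.IsRegular ω) {s : ℝ≥0} {n : ℕ}
    (hn : ∀ j, ν.τ j ω < (s : WithTop ℝ≥0) ↔ j < n) :
    ν.impulses ω s = ∑ j ∈ Finset.range n, ν.ζ j ω := by
  rw [impulses, tsum_eq_sum (s := Finset.range n)]
  · refine Finset.sum_congr rfl fun j hj => ?_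
    rw [if_pos ((hn j).2 (Finset.mem_range.1 hj))]
  · intro j hj
    rw [if_neg]
    rw [hn j]
    simpa using hj

theorem impulses_mono (h : ν.IsRegular ω) : Monotone (ν.impulses ω) := by
  intro s t hst
  obtain ⟨n, hn⟩ := h.exists_count s
  obtain ⟨k, hk⟩ := h.exists_count t
  rw [h.impulses_eq hn, h.impulses_eq hk]
  have hnk : n ≤ k := by
    by_contra hlt
    have := ((hn k).2 (not_le.1 hlt)).trans_le (WithTop.coe_le_coe.2 hst)
    exact lt_irrefl _ ((hk k).1 this)
  exact Finset.sum_le_sum_of_subset_of_nonneg (Finset.range_mono hnk) fun j hj _ =>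
    h.ζ_nonneg ((hk j).2 (Finset.mem_range.1 hj))

theorem measurable_input (h : ν.IsRegular ω) :
    Measurable fun s => r - X.damage s ω + ν.impulses ω s :=
  (measurable_const.sub (X.measurable_damage_path ω)).add h.impulses_mono.measurable

theorem measurable_level (h : ν.IsRegular ω) : Measurable fun s => ν.level s ω :=
  A.measurable_levelPath h.measurable_input

theorem level_eq (h : ν.IsRegular ω) (t : ℝ≥0) : ν.level t ω
    = r - X.damage t ω + ν.impulses ω t - ∫ s in (0 : ℝ)..t, A.rate (ν.level s.toNNReal ω) :=
  A.levelPath_eq h.measurable_input t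

theorem level_zero (h : ν.IsRegular ω) : ν.level 0 ω = r := by
  have hN : X.N 0 ω = 0 := X.N_eq (by simp) (by simpa using h.strictMono_arrival zero_lt_one)
  have h0 : ν.impulses ω 0 = 0 := by
    rw [h.impulses_eq (n := 0)]
    · simp
    · intro j
      simp
  rw [h.level_eq, h0, Shocks.damage, hN]
  simp

theorem stageLevel_sub (h : ν.IsRegular ω) (n i : ℕ) (a t : ℝ≥0) :
    ν.stageLevel n i t ω
      = ν.stageLevel n i a ω - ∫ s in (a : ℝ)..t, A.rate (ν.level s.toNNReal ω) := by
  have hi := fun u v => A.intervalIntegrable_rate h.measurable_level u v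
  rw [stageLevel, stageLevel, ← intervalIntegral.integral_interval_sub_left (hi 0 t) (hi 0 a)]
  ring

theorem damage_eq (h : ν.IsRegular ω) {n : ℕ} {t : ℝ≥0} (h1 : X.arrival n ω ≤ t)
    (h2 : t < X.arrival (n + 1) ω) : X.damage t ω = X.damage (X.arrival n ω) ω := by
  rw [Shocks.damage, Shocks.damage, X.N_eq h1 h2,
    X.N_eq le_rfl (h.strictMono_arrival (Nat.lt_succ_self n))]

theorem level_eq_stageLevel (h : ν.IsRegular ω) {n i : ℕ} {t : ℝ≥0} (h1 : X.arrival n ω ≤ t)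
    (h2 : t < X.arrival (n + 1) ω) (hi : ∀ j, ν.τ j ω < (t : WithTop ℝ≥0) ↔ j < i) :
    ν.level t ω = ν.stageLevel n i t ω := by
  rw [h.level_eq, h.damage_eq h1 h2, h.impulses_eq hi, stageLevel]

theorem level_arrival (h : ν.IsRegular ω) {n i : ℕ}
    (hi : ∀ j, ν.τ j ω < (X.arrival (n + 1) ω : WithTop ℝ≥0) ↔ j < i) :
    ν.level (X.arrival (n + 1) ω) ω = ν.stageLevel n i (X.arrival (n + 1) ω) ω - X.S n ω := by
  rw [h.level_eq, h.impulses_eq hi, stageLevel, Shocks.damage, Shocks.damage,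
    X.N_eq le_rfl (h.strictMono_arrival (Nat.lt_succ_self n)),
    X.N_eq le_rfl (h.strictMono_arrival (Nat.lt_succ_self (n + 1))), Finset.sum_range_succ]
  ring

/-- An intervention in the `n`-th stage finds the stage level. -/
theorem levelBefore_eq (h : ν.IsRegular ω) {n i : ℕ} {t : ℝ≥0} (ht : ν.τ i ω = t)
    (h1 : X.arrival n ω ≤ t) (h2 : t < X.arrival (n + 1) ω) :
    ν.levelBefore i ω = ν.stageLevel n i t ω := by
  classical
  obtain ⟨c, hc⟩ := h.exists_count t
  have hci : c ≤ i := by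
    by_contra hlt
    have := (hc i).2 (not_le.1 hlt)
    rw [ht] at this
    exact lt_irrefl _ this
  have e : ∑ j ∈ Finset.range i, ν.ζ j ω = ∑ j ∈ Finset.range c, ν.ζ j ω
      + ∑ j ∈ Finset.range i, if ν.τ j ω = ν.τ i ω then ν.ζ j ω else 0 := by
    have : ∑ j ∈ Finset.range c, ν.ζ j ω
        = ∑ j ∈ Finset.range i, if j < c then ν.ζ j ω else 0 := by
      rw [← Finset.sum_subset (Finset.range_mono hci) fun j _ hj => ?_]
      · exact Finset.sum_congr rfl fun j hj => by rw [if_pos (Finset.mem_range.1 hj)]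
      · rw [if_neg (by simpa using hj)]
    rw [this, ← Finset.sum_add_distrib]
    refine Finset.sum_congr rfl fun j hj => ?_
    by_cases hjc : j < c
    · have := (hc j).2 hjc
      rw [if_pos hjc, if_neg (by rw [ht]; exact this.ne), add_zero]
    · have h3 : ν.τ j ω ≤ ν.τ i ω := h.τ_mono (Finset.mem_range.1 hj).le
      have h4 : ¬ ν.τ j ω < (t : WithTop ℝ≥0) := fun h' => hjc ((hc j).1 h')
      rw [if_neg hjc, if_pos (le_antisymm h3 (by rw [ht]; exact not_lt.1 h4)), zero_add]
  rw [levelBefore, ht, WithTop.untopD_coe, h.level_eq_stageLevel h1 h2 hc, stageLevel, stageLevel,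
    e, ht]
  ring

/-- The controlled level never exceeds `M`. -/
theorem level_le (h : ν.IsRegular ω) (hr : r ≤ A.M) (t : ℝ≥0) : ν.level t ω ≤ A.M := by
  have hint : ∀ a b : ℝ≥0, a ≤ b → ∫ s in (0 : ℝ)..a, A.rate (ν.level s.toNNReal ω)
      ≤ ∫ s in (0 : ℝ)..b, A.rate (ν.level s.toNNReal ω) := by
    intro a b hab
    have hi := fun u v => A.intervalIntegrable_rate h.measurable_level u v
    have := A.integral_rate_nonneg (f := fun s => ν.level s ω) (NNReal.coe_le_coe.2 hab)
    rw [← intervalIntegral.integral_interval_sub_left (hi 0 b) (hi 0 a)] at this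
    linarith
  have hdam : ∀ a b : ℝ≥0, a ≤ b → X.damage a ω ≤ X.damage b ω := fun a b hab =>
    Finset.sum_le_sum_of_subset_of_nonneg (Finset.range_mono (X.N_mono ω hab))
      fun i _ _ => h.S_nonneg i
  obtain ⟨c, hc⟩ := h.exists_count t
  rw [h.level_eq, h.impulses_eq hc]
  cases c with
  | zero =>
    have h1 : 0 ≤ X.damage t ω := Finset.sum_nonneg fun i _ => h.S_nonneg i
    have h2 := hint 0 t zero_le
    simp only [NNReal.coe_zero, intervalIntegral.integral_same] at h2
    rw [Finset.range_zero, Finset.sum_empty]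
    linarith
  | succ c =>
    have hlt := (hc c).2 (Nat.lt_succ_self c)
    obtain ⟨a, ha⟩ := WithTop.ne_top_iff_exists.1 (ne_top_of_lt hlt)
    have hat : a ≤ t := by
      rw [← ha, WithTop.coe_lt_coe] at hlt
      exact hlt.le
    have hbefore := h.levelBefore_eq (n := X.N a ω) ha.symm (X.arrival_N_le ω a) (X.lt_arrival_N ω a)
    have hz := (h.ζ_mem c (ne_top_of_lt hlt)).2
    rw [hbefore, stageLevel] at hz
    have hd := (hdam _ _ (X.arrival_N_le ω a))
    rw [← h.damage_eq (X.arrival_N_le ω a) (X.lt_arrival_N ω a)] at hz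
    have h1 := hdam a t hat
    have h2 := hint a t hat
    rw [Finset.sum_range_succ]
    linarith

end IsRegular

theorem ae_impulses_hist (hν : ν.IsAdmissible) (n : ℕ) : ∃ g : Shocks.History × ℝ≥0 → ℝ,
    Measurable g ∧ ∀ᵐ ω ∂P, ∀ s ≤ X.arrival (n + 1) ω, ν.impulses ω s = g (X.hist n ω, s) := by
  classical
  choose g hg hgeq using ν.exists_hist_impulse n
  refine ⟨fun p => limsup (fun k => ∑ i ∈ Finset.range k, g i p) atTop,
    Measurable.limsup fun k => Finset.measurable_sum _ fun i _ => hg i, ?_⟩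
  filter_upwards [ν.ae_isRegular hν] with ω h s hs
  obtain ⟨c, hc⟩ := h.exists_count s
  rw [h.impulses_eq hc]
  refine (Tendsto.limsup_eq (tendsto_atTop_of_eventually_const (i₀ := c) fun k hk => ?_)).symm
  rw [← Finset.sum_subset (Finset.range_mono hk) fun j _ hj => ?_]
  · refine Finset.sum_congr rfl fun j hj => ?_
    rw [← hgeq j ω s hs, if_pos ((hc j).2 (Finset.mem_range.1 hj))]
  · rw [← hgeq j ω s hs, if_neg]
    rw [hc j]
    simpa using hj

/-- In the `n`-th stage the controlled level is a measurable function of the history and of time;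
continued to the time of the next shock it gives the level that the shock finds. -/
theorem exists_hist_level (hν : ν.IsAdmissible) (n : ℕ) : ∃ ρ : Shocks.History × ℝ≥0 → ℝ,
    Measurable ρ ∧ ∀ᵐ ω ∂P, (∀ s < X.arrival (n + 1) ω, ν.level s ω = ρ (X.hist n ω, s)) ∧
      ν.level (X.arrival (n + 1) ω) ω = ρ (X.hist n ω, X.arrival (n + 1) ω) - X.S n ω := by
  obtain ⟨g, hg, hgeq⟩ := ν.ae_impulses_hist hν n
  have hy : Measurable (Function.uncurry fun (η : Shocks.History) u =>
      r - Shocks.History.damage n η u + g (η, u)) :=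
    (Measurable.const_sub (Shocks.History.measurable_damage n) r).add hg
  refine ⟨fun p => levelPath A.rate (fun u => r - Shocks.History.damage n p.1 u + g (p.1, u)) p.2,
    A.measurable_levelPath_uncurry (y := fun η u => r - Shocks.History.damage n η u + g (η, u)) hy,
    ?_⟩
  filter_upwards [hgeq, ν.ae_isRegular hν] with ω hgω h
  have hyω : Measurable fun u => r - Shocks.History.damage n (X.hist n ω) u + g (X.hist n ω, u) :=
    Measurable.of_uncurry_left hy (x := X.hist n ω)
  have hlt : ∀ s < X.arrival (n + 1) ω, ν.level s ω = levelPath A.rate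
      (fun u => r - Shocks.History.damage n (X.hist n ω) u + g (X.hist n ω, u)) s := by
    intro s hs
    have he : EqOn (fun u => r - X.damage u ω + ν.impulses ω u)
        (fun u => r - Shocks.History.damage n (X.hist n ω) u + g (X.hist n ω, u))
        (Iio (X.arrival (n + 1) ω)) := fun u hu => by
      simp only [X.damage_eq_hist hu, hgω u (le_of_lt hu)]
    have := levelPath_congr (b := A.rate) (isLowerSet_Iio _) he hs
    rw [level_def]
    exact this
  refine ⟨hlt, ?_⟩
  set T := X.arrival (n + 1) ω with hT
  have hint : ∫ s in (0 : ℝ)..T, A.rate (ν.level s.toNNReal ω)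
      = ∫ s in (0 : ℝ)..T, A.rate (levelPath A.rate (fun u =>
        r - Shocks.History.damage n (X.hist n ω) u + g (X.hist n ω, u)) s.toNNReal) := by
    rw [intervalIntegral.integral_of_le (NNReal.coe_nonneg T),
      intervalIntegral.integral_of_le (NNReal.coe_nonneg T), ← integral_Ioc_eq_integral_Ioo.symm,
      ← integral_Ioc_eq_integral_Ioo.symm]
    refine setIntegral_congr_fun measurableSet_Ioo fun s hs => ?_
    have : s.toNNReal < T := (Real.toNNReal_lt_iff_lt_coe hs.1.le).2 hs.2
    simp only [hlt _ this]
  have hdam : X.damage T ω = Shocks.History.damage n (X.hist n ω) T + X.S n ω := by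
    have hN : X.N T ω = n + 1 := X.N_eq le_rfl (h.strictMono_arrival (Nat.lt_succ_self (n + 1)))
    rw [Shocks.damage, hN, Shocks.History.damage, Finset.sum_range_succ]
    congr 1
    refine Finset.sum_congr rfl fun i hi => ?_
    have hi' := Finset.mem_range.1 hi
    rw [X.arrival_hist (by omega), if_pos (X.arrival_mono ω (by omega)), Shocks.hist]
    simp [hi']
  rw [h.level_eq, hint, hdam, hgω T le_rfl, A.levelPath_eq hyω]
  ring

/-- Having survived until time `s` is in the `n`-th stage an event of the history. -/
theorem exists_hist_survival (hν : ν.IsAdmissible) (n : ℕ) :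
    ∃ B : Set (Shocks.History × ℝ≥0), MeasurableSet B ∧ ∀ᵐ ω ∂P, ∀ s ≤ X.arrival (n + 1) ω,
      ((s : WithTop ℝ≥0) ≤ ν.failureTime ω ↔ (X.hist n ω, s) ∈ B) := by
  obtain ⟨ρ, hρ, hρeq⟩ := ν.exists_hist_level hν n
  set u := TopologicalSpace.denseSeq ℝ≥0 with hu
  refine ⟨(⋂ k, {p | u k < p.2 → A.m ≤ ρ (p.1, u k)}) ∩
    ⋂ j ∈ Finset.range (n + 1), {p | Shocks.History.arrival j p.1 < p.2 →
      A.m ≤ ρ (p.1, Shocks.History.arrival j p.1)}, ?_, ?_⟩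
  · refine MeasurableSet.inter (MeasurableSet.iInter fun k => ?_)
      (MeasurableSet.biInter (to_countable _) fun j _ => ?_)
    · refine MeasurableSet.imp ?_ ?_
      · exact measurableSet_lt measurable_const measurable_snd
      · exact measurableSet_le measurable_const (hρ.comp (measurable_fst.prodMk measurable_const))
    · have hj : Measurable fun p : Shocks.History × ℝ≥0 => Shocks.History.arrival j p.1 :=
        (Shocks.History.measurable_arrival j).comp measurable_fst
      refine MeasurableSet.imp ?_ ?_
      · exact measurableSet_lt hj measurable_snd
      · exact measurableSet_le measurable_const (hρ.comp (measurable_fst.prodMk hj))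
  filter_upwards [hρeq, ν.ae_isRegular hν] with ω hω h s hs
  rw [le_failureTime_iff]
  simp only [mem_inter_iff, mem_iInter, mem_ofPred_eq, Finset.mem_range]
  constructor
  · refine fun hsurv => ⟨fun k hk => ?_, fun j hj hjs => ?_⟩
    · rw [← hω.1 _ (hk.trans_le hs)]; exact hsurv _ hk
    · rw [X.arrival_hist (by omega)] at hjs ⊢
      rw [← hω.1 _ (hjs.trans_le hs)]; exact hsurv _ hjs
  · rintro ⟨h1, h2⟩ v hv
    set j := X.N v ω with hj
    have hvT := hv.trans_le hs
    have hjn : j ≤ n := Nat.lt_succ_iff.1 ((X.lt_arrival_iff ω v _).1 hvT)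
    have hTj : X.arrival j ω ≤ v := X.arrival_N_le ω v
    rcases hTj.eq_or_lt with heq | hlt
    · have := h2 j (by omega)
      rw [X.arrival_hist (by omega), heq] at this
      rw [hω.1 _ hvT]
      exact this hv
    -- shortly before `v` the level was not much higher than at `v`
    · by_contra hcon
      rw [not_le] at hcon
      have hc : 0 < A.c A.m := A.c_pos _ A.m_mem
      have hgap : 0 < (A.m - ν.level v ω) / A.c A.m := div_pos (by linarith) hc
      obtain ⟨b, ⟨k, hk⟩, hb1, hb2⟩ := (TopologicalSpace.denseRange_denseSeq ℝ≥0).exists_between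
        (show max (X.arrival j ω) (v - ((A.m - ν.level v ω) / A.c A.m).toNNReal) < v from
          max_lt hlt (tsub_lt_self ((zero_le (a := X.arrival j ω)).trans_lt hlt)
            (Real.toNNReal_pos.2 hgap)))
      have hbj := (le_max_left _ _).trans_lt hb1
      have hbv := (le_max_right _ _).trans_lt hb1
      have hbk : u k = b := hk
      have hlow := h1 k (by rw [hbk]; exact hb2.trans hv)
      rw [hbk, ← hω.1 _ (hb2.trans hvT)] at hlow
      rw [h.level_eq] at hlow hcon
      have hi := fun u v => A.intervalIntegrable_rate h.measurable_level u v
      have hle := A.integral_rate_le (f := fun s => ν.level s ω) (NNReal.coe_le_coe.2 hb2.le)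
      rw [← intervalIntegral.integral_interval_sub_left (hi 0 v) (hi 0 b)] at hle
      have himp := h.impulses_mono hb2.le
      have hd : X.damage v ω = X.damage b ω := by
        rw [h.damage_eq hTj (X.lt_arrival_N ω v), h.damage_eq hbj.le
          (hb2.trans (X.lt_arrival_N ω v))]
      have hvb : (v : ℝ) - b < (A.m - ν.level v ω) / A.c A.m := by
        have h3 := NNReal.coe_lt_coe.2 (lt_add_of_tsub_lt_right hbv)
        rw [NNReal.coe_add, Real.coe_toNNReal _ hgap.le] at h3
        linarith
      rw [lt_div_iff₀ hc] at hvb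
      rw [h.level_eq v] at hvb
      linarith

end ImpulseControl

/-! ### The candidate along the drift -/

namespace MaintenanceModel

variable (A : MaintenanceModel)

/-- The discount factor. -/
def discount (s : ℝ) : ℝ≥0∞ := ENNReal.ofReal (Real.exp (-A.δ * s))

/-- Benefit rate plus rate of the value that shocks lead to. -/
def gainRate (W : ℝ → ℝ) (x : ℝ) : ℝ≥0∞ :=
  ENNReal.ofReal (A.G x) + ENNReal.ofReal A.lam * A.shockMean W x

/-- Rate of the value that shocks take away. -/
def lossRate (W : ℝ → ℝ) (x : ℝ) : ℝ≥0∞ := ENNReal.ofReal A.lam * A.aliveValue W x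

/-- Excess of the value over the value of an intervention. -/
def excess (W : ℝ → ℝ) (x : ℝ) : ℝ := W x - (bestTarget A.M A.H W x + A.H x - A.k)

theorem measurable_discount : Measurable A.discount := by
  unfold discount
  fun_prop

namespace IsCandidate

variable {A} {W : ℝ → ℝ}

theorem gainRate_eq (hW : A.IsCandidate W) {x : ℝ} (hx : x ∈ Icc A.m A.M) :
    A.gainRate W x = ENNReal.ofReal (A.runRate W x) := by
  rw [gainRate, runRate, ENNReal.ofReal_add (A.G_nonneg x hx)
    (mul_nonneg A.lam_pos.le ENNReal.toReal_nonneg), ENNReal.ofReal_mul A.lam_pos.le,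
    ENNReal.ofReal_toReal (hW.shockMean_ne_top x)]

theorem lossRate_eq {x : ℝ} (hx : x ∈ Icc A.m A.M) :
    A.lossRate W x = ENNReal.ofReal (A.lam * W x) := by
  rw [lossRate, aliveValue_of_mem hx, ENNReal.ofReal_mul A.lam_pos.le]

/-- Change of variables from time to remaining lifetime. -/
theorem drift_balance (hW : A.IsCandidate W) {ρ : ℝ → ℝ} {a b : ℝ} (hab : a ≤ b)
    (hρ : ContinuousOn ρ (Icc a b))
    (hρeq : ∀ s ∈ Icc a b, ρ s = ρ a - ∫ v in a..s, A.rate (ρ v))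
    (ha : ρ a ≤ A.M) (hb : A.m ≤ ρ b) : ∃ p q : ℝ, 0 ≤ p ∧ 0 ≤ q ∧
      (∫⁻ s in Ioo a b, A.discount s * A.gainRate W (ρ s)) = ENNReal.ofReal p ∧
      (∫⁻ s in Ioo a b, A.discount s * A.lossRate W (ρ s)) = ENNReal.ofReal q ∧
      Real.exp (-A.δ * b) * W (ρ b) + p ≤ Real.exp (-A.δ * a) * W (ρ a) + q ∧
      ((∀ s ∈ Ioo a b, 0 < A.excess W (ρ s)) →
        Real.exp (-A.δ * b) * W (ρ b) + p = Real.exp (-A.δ * a) * W (ρ a) + q) ∧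
      ρ a ∈ Icc A.m A.M ∧ ρ b ∈ Icc A.m A.M := by
  set u := A.lifetime (ρ a) with hu
  have hlife : ∀ s ∈ Icc a b, A.lifetime (ρ s) = u + a - s := fun s hs => by
    rw [A.lifetime_drift hab hρ hρeq s hs]
    ring
  have hρl : ∀ s ∈ Icc a b, ρ s = A.levelAt (u + a - s) := fun s hs => by
    rw [← hlife s hs, A.levelAt_lifetime]
  set y := u + a - b with hy
  have hyb : A.lifetime (ρ b) = y := hlife b ⟨hab, le_rfl⟩
  have hy0 : 0 ≤ y := by
    rw [← hyb, ← A.lifetime_m]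
    exact A.strictMono_lifetime.monotone hb
  have huL : u ≤ A.lifetime A.M := A.strictMono_lifetime.monotone ha
  have hyu : y ≤ u := by linarith
  have huI : u ∈ Icc 0 (A.lifetime A.M) := ⟨hy0.trans hyu, huL⟩
  have hmem : ∀ s ∈ Icc a b, u + a - s ∈ Icc 0 (A.lifetime A.M) := fun s hs =>
    ⟨by linarith [hs.2], by linarith [hs.1]⟩
  have hρm : ∀ s ∈ Icc a b, ρ s ∈ Icc A.m A.M := fun s hs => by
    rw [hρl s hs]; exact A.levelAt_mem (hmem s hs)
  have hg0 : ∀ t ∈ Icc 0 (A.lifetime A.M), 0 ≤ A.runRate W (A.levelAt t) := fun t ht =>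
    runRate_nonneg (A.levelAt_mem ht)
  have hgi := hW.intervalIntegrable_runRate
  have hgi' : IntervalIntegrable (fun t => A.runRate W (A.levelAt t)) volume y u :=
    hgi.mono_set (by
      rw [uIcc_of_le hyu, uIcc_of_le A.lifetime_M_pos.le]; exact Icc_subset_Icc hy0 huL)
  have hWc : ContinuousOn (fun t => W (A.levelAt t)) (uIcc y u) := by
    rw [uIcc_of_le hyu]
    exact (IsObstacleSolution.continuousOn hW).mono (Icc_subset_Icc hy0 huL)
  have hexp : Continuous fun t => Real.exp (A.δ * t) := by fun_prop
  have hP : IntervalIntegrable (fun t => Real.exp (A.δ * t) * A.runRate W (A.levelAt t))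
      volume y u := hgi'.continuousOn_mul hexp.continuousOn
  have hQ : IntervalIntegrable (fun t => Real.exp (A.δ * t) * (A.lam * W (A.levelAt t)))
      volume y u := (hexp.continuousOn.mul (continuousOn_const.mul hWc)).intervalIntegrable
  have hle := IsObstacleSolution.loss_nonneg hW A.lam_pos.le hg0 hgi huI ⟨hy0, hyu⟩
  have heq := IsObstacleSolution.loss_eq_zero hW hg0 hgi huI ⟨hy0, hyu⟩
  simp only [bestTarget_levelAt] at hle heq
  have hsplit : ∫ t in y..u, Real.exp (A.δ * t)
        * (A.runRate W (A.levelAt t) - A.lam * W (A.levelAt t))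
      = (∫ t in y..u, Real.exp (A.δ * t) * A.runRate W (A.levelAt t))
        - ∫ t in y..u, Real.exp (A.δ * t) * (A.lam * W (A.levelAt t)) := by
    rw [← intervalIntegral.integral_sub hP hQ]
    simp only [mul_sub]
  rw [hsplit] at hle heq
  -- the substitution `t = u + a - s`
  have hconv : ∀ f : ℝ → ℝ, IntervalIntegrable (fun t => Real.exp (A.δ * t) * f (A.levelAt t))
      volume y u → (∀ x ∈ Icc A.m A.M, 0 ≤ f x) →
      ∫⁻ s in Ioo a b, A.discount s * ENNReal.ofReal (f (ρ s))
        = ENNReal.ofReal (Real.exp (-A.δ * (u + a))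
          * ∫ t in y..u, Real.exp (A.δ * t) * f (A.levelAt t)) := by
    intro f hf hf0
    have hfi : IntervalIntegrable (fun s => Real.exp (-A.δ * (u + a))
        * (Real.exp (A.δ * (u + a - s)) * f (A.levelAt (u + a - s)))) volume a b := by
      refine IntervalIntegrable.const_mul ?_ _
      have := (hf.comp_sub_left (u + a)).symm
      simpa [hy] using this
    have h1 : Real.exp (-A.δ * (u + a)) * ∫ t in y..u, Real.exp (A.δ * t) * f (A.levelAt t)
        = ∫ s in a..b, Real.exp (-A.δ * (u + a))
          * (Real.exp (A.δ * (u + a - s)) * f (A.levelAt (u + a - s))) := by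
      rw [intervalIntegral.integral_const_mul, intervalIntegral.integral_comp_sub_left
        (fun t => Real.exp (A.δ * t) * f (A.levelAt t))]
      simp [hy]
    rw [h1, intervalIntegral.integral_of_le hab, integral_Ioc_eq_integral_Ioo,
      ofReal_integral_eq_lintegral_ofReal]
    · refine setLIntegral_congr_fun measurableSet_Ioo fun s hs => ?_
      have hsI := Ioo_subset_Icc_self hs
      have e : Real.exp (-A.δ * (u + a)) * (Real.exp (A.δ * (u + a - s))
          * f (A.levelAt (u + a - s))) = Real.exp (-A.δ * s) * f (ρ s) := by
        rw [← mul_assoc, ← Real.exp_add, hρl s hsI]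
        congr 2
        ring
      rw [e, discount, ENNReal.ofReal_mul (Real.exp_pos _).le]
    · exact ((intervalIntegrable_iff_integrableOn_Ioc_of_le hab).1 hfi).mono_set Ioo_subset_Ioc_self
    · refine (ae_restrict_iff' measurableSet_Ioo).2 (ae_of_all _ fun s hs => ?_)
      have := hf0 _ (A.levelAt_mem (hmem s (Ioo_subset_Icc_self hs)))
      simp only [Pi.zero_apply]
      positivity
  have hint0 : ∀ f : ℝ → ℝ, (∀ x ∈ Icc A.m A.M, 0 ≤ f x) → 0 ≤ Real.exp (-A.δ * (u + a))
      * ∫ t in y..u, Real.exp (A.δ * t) * f (A.levelAt t) := fun f hf0 =>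
    mul_nonneg (Real.exp_pos _).le (intervalIntegral.integral_nonneg hyu fun t ht =>
      mul_nonneg (Real.exp_pos _).le (hf0 _ (A.levelAt_mem ⟨hy0.trans ht.1, ht.2.trans huL⟩)))
  have hr0 : ∀ x ∈ Icc A.m A.M, 0 ≤ A.runRate W x := fun x hx => runRate_nonneg hx
  have hl0 : ∀ x ∈ Icc A.m A.M, 0 ≤ A.lam * W x := fun x hx =>
    mul_nonneg A.lam_pos.le (hW.nonneg hx)
  have hWb : Real.exp (-A.δ * b) * W (ρ b)
      = Real.exp (-A.δ * (u + a)) * (Real.exp (A.δ * y) * W (A.levelAt y)) := by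
    rw [hρl b ⟨hab, le_rfl⟩, ← mul_assoc, ← Real.exp_add]
    congr 2
    rw [hy]
    ring
  have hWa : Real.exp (-A.δ * a) * W (ρ a)
      = Real.exp (-A.δ * (u + a)) * (Real.exp (A.δ * u) * W (A.levelAt u)) := by
    rw [hu, A.levelAt_lifetime, ← hu, ← mul_assoc, ← Real.exp_add]
    congr 2
    ring
  refine ⟨_, _, hint0 _ hr0, hint0 _ hl0, ?_, ?_, ?_, ?_, hρm a ⟨le_rfl, hab⟩, hρm b ⟨hab, le_rfl⟩⟩
  · rw [← hconv _ hP hr0]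
    refine setLIntegral_congr_fun measurableSet_Ioo fun s hs => ?_
    simp only [hW.gainRate_eq (hρm s (Ioo_subset_Icc_self hs))]
  · rw [← hconv (fun x => A.lam * W x) hQ hl0]
    refine setLIntegral_congr_fun measurableSet_Ioo fun s hs => ?_
    simp only [lossRate_eq (hρm s (Ioo_subset_Icc_self hs))]
  · have := mul_le_mul_of_nonneg_left hle (Real.exp_pos (-A.δ * (u + a))).le
    rw [hWa, hWb]
    linarith
  · intro hpos
    have := heq fun z hz => by
      have hs : u + a - z ∈ Ioo a b := ⟨by linarith [hz.2], by linarith [hz.1]⟩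
      have := hpos _ hs
      rw [hρl _ (Ioo_subset_Icc_self hs), excess, sub_sub_cancel] at this
      linarith
    rw [hWa, hWb]
    linear_combination Real.exp (-A.δ * (u + a)) * this

/-- Along the drift the discounted value plus the collected gains does not exceed the value at the
start plus the losses. -/
theorem drift_le (hW : A.IsCandidate W) {ρ : ℝ → ℝ} {a b : ℝ} (hab : a ≤ b)
    (hρ : ContinuousOn ρ (Icc a b))
    (hρeq : ∀ s ∈ Icc a b, ρ s = ρ a - ∫ v in a..s, A.rate (ρ v))
    (ha : ρ a ≤ A.M) (hb : A.m ≤ ρ b) :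
    A.discount b * A.aliveValue W (ρ b) + ∫⁻ s in Ioo a b, A.discount s * A.gainRate W (ρ s)
      ≤ A.discount a * A.aliveValue W (ρ a)
        + ∫⁻ s in Ioo a b, A.discount s * A.lossRate W (ρ s) := by
  obtain ⟨p, q, hp, hq, ep, eq, hle, -, hma, hmb⟩ := hW.drift_balance hab hρ hρeq ha hb
  have h1 : 0 ≤ Real.exp (-A.δ * b) * W (ρ b) := mul_nonneg (Real.exp_pos _).le (hW.nonneg hmb)
  have h2 : 0 ≤ Real.exp (-A.δ * a) * W (ρ a) := mul_nonneg (Real.exp_pos _).le (hW.nonneg hma)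
  rw [ep, eq, aliveValue_of_mem hma, aliveValue_of_mem hmb, discount, discount,
    ← ENNReal.ofReal_mul (Real.exp_pos _).le, ← ENNReal.ofReal_mul (Real.exp_pos _).le,
    ← ENNReal.ofReal_add h1 hp, ← ENNReal.ofReal_add h2 hq]
  exact ENNReal.ofReal_le_ofReal hle

/-- Where the value exceeds that of an intervention nothing is lost. -/
theorem drift_eq (hW : A.IsCandidate W) {ρ : ℝ → ℝ} {a b : ℝ} (hab : a ≤ b)
    (hρ : ContinuousOn ρ (Icc a b))
    (hρeq : ∀ s ∈ Icc a b, ρ s = ρ a - ∫ v in a..s, A.rate (ρ v))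
    (ha : ρ a ≤ A.M) (hb : A.m ≤ ρ b) (hpos : ∀ s ∈ Ioo a b, 0 < A.excess W (ρ s)) :
    A.discount b * A.aliveValue W (ρ b) + ∫⁻ s in Ioo a b, A.discount s * A.gainRate W (ρ s)
      = A.discount a * A.aliveValue W (ρ a)
        + ∫⁻ s in Ioo a b, A.discount s * A.lossRate W (ρ s) := by
  obtain ⟨p, q, hp, hq, ep, eq, -, heq, hma, hmb⟩ := hW.drift_balance hab hρ hρeq ha hb
  have h1 : 0 ≤ Real.exp (-A.δ * b) * W (ρ b) := mul_nonneg (Real.exp_pos _).le (hW.nonneg hmb)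
  have h2 : 0 ≤ Real.exp (-A.δ * a) * W (ρ a) := mul_nonneg (Real.exp_pos _).le (hW.nonneg hma)
  rw [ep, eq, aliveValue_of_mem hma, aliveValue_of_mem hmb, discount, discount,
    ← ENNReal.ofReal_mul (Real.exp_pos _).le, ← ENNReal.ofReal_mul (Real.exp_pos _).le,
    ← ENNReal.ofReal_add h1 hp, ← ENNReal.ofReal_add h2 hq, heq hpos]

end IsCandidate
end MaintenanceModel

/-! ### The balance of the candidate over one stage -/

/-- `x ≤ y`, with equality if `p` holds. -/
def LeOrEq (p : Prop) (x y : ℝ≥0∞) : Prop := x ≤ y ∧ (p → x = y)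

namespace LeOrEq

variable {p : Prop} {x y z u v : ℝ≥0∞}

theorem refl (p : Prop) (x : ℝ≥0∞) : LeOrEq p x x := ⟨le_rfl, fun _ => rfl⟩

theorem trans (h1 : LeOrEq p x y) (h2 : LeOrEq p y z) : LeOrEq p x z :=
  ⟨h1.1.trans h2.1, fun h => (h1.2 h).trans (h2.2 h)⟩

theorem add_right (h : LeOrEq p x y) (z : ℝ≥0∞) : LeOrEq p (x + z) (y + z) :=
  ⟨add_le_add_left h.1 z, fun hp => by rw [h.2 hp]⟩

end LeOrEq

theorem setLIntegral_Ioo_add {a b c : ℝ} (hab : a ≤ b) (hbc : b ≤ c) (f : ℝ → ℝ≥0∞) :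
    (∫⁻ s in Ioo a b, f s) + ∫⁻ s in Ioo b c, f s = ∫⁻ s in Ioo a c, f s := by
  rw [setLIntegral_congr Ioo_ae_eq_Ioc, setLIntegral_congr Ioo_ae_eq_Ioc,
    setLIntegral_congr Ioo_ae_eq_Ioc, ← Ioc_union_Ioc_eq_Ioc hab hbc,
    lintegral_union measurableSet_Ioc]
  rw [Set.disjoint_left]
  exact fun x hx hx' => absurd hx.2 (not_le.2 hx'.1)

namespace ImpulseControl

variable {Ω : Type*} [mΩ : MeasurableSpace Ω] {A : MaintenanceModel} {P : Measure Ω}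
  {X : Shocks A P} {r : ℝ} (ν : ImpulseControl X r)

/-- Discounted cost of the `i`-th intervention. -/
def interventionCost (i : ℕ) (ω : Ω) : ℝ≥0∞ :=
  ENNReal.ofReal (Real.exp (-A.δ * ((ν.τ i ω).untopD 0 : ℝ≥0))
    * A.cost (ν.levelBefore i ω) (ν.ζ i ω))

open Classical in
/-- Discounted cost of the `i`-th intervention if it takes place in the `n`-th stage, before
failure. -/
def stageCost (n i : ℕ) (ω : Ω) : ℝ≥0∞ :=
  if (X.arrival n ω : WithTop ℝ≥0) ≤ ν.τ i ω ∧ ν.τ i ω < X.arrival (n + 1) ω ∧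
    ν.τ i ω < ν.failureTime ω then ν.interventionCost i ω else 0

open Classical in
/-- Discounted candidate value at the beginning of the `n`-th stage. -/
def stageValue (W : ℝ → ℝ) (n : ℕ) (ω : Ω) : ℝ≥0∞ :=
  if (X.arrival n ω : WithTop ℝ≥0) ≤ ν.failureTime ω then
    A.discount (X.arrival n ω) * A.aliveValue W (ν.level (X.arrival n ω) ω) else 0

open Classical in
/-- Discounted candidate value at the end of the `n`-th stage, just before the shock. -/
def stageEnd (W : ℝ → ℝ) (n : ℕ) (ω : Ω) : ℝ≥0∞ :=
  if (X.arrival (n + 1) ω : WithTop ℝ≥0) ≤ ν.failureTime ω then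
    A.discount (X.arrival (n + 1) ω)
      * A.aliveValue W (ν.level (X.arrival (n + 1) ω) ω + X.S n ω) else 0

open Classical in
/-- Integral of a discounted rate over the part of the `n`-th stage before failure. -/
def stageIntegral (f : ℝ → ℝ≥0∞) (n : ℕ) (ω : Ω) : ℝ≥0∞ :=
  ∫⁻ s in Ioo (X.arrival n ω : ℝ) (X.arrival (n + 1) ω),
    if (s.toNNReal : WithTop ℝ≥0) ≤ ν.failureTime ω then
      A.discount s * f (ν.level s.toNNReal ω) else 0

/-- The properties by which the candidate value is lost nowhere: interventions bring their costs,
take place wherever the candidate value does not exceed that of an intervention, and failure not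
caused by a shock happens at a level of value `0`. -/
structure IsLossless (W : ℝ → ℝ) (ω : Ω) : Prop where
  excess_pos : ∀ s : ℝ≥0, (∀ j, ν.τ j ω ≠ s) → (s : WithTop ℝ≥0) < ν.failureTime ω →
    0 < A.excess W (ν.level s ω)
  value_eq : ∀ i, ν.τ i ω < ν.failureTime ω →
    W (ν.levelBefore i ω + ν.ζ i ω)
      = W (ν.levelBefore i ω) + A.cost (ν.levelBefore i ω) (ν.ζ i ω)
  failure_value : ∀ s : ℝ≥0, ν.failureTime ω = s → A.aliveValue W (ν.level s ω) = 0

variable {ν} {W : ℝ → ℝ} {ω : Ω}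

theorem le_level_of_lt {s : ℝ≥0} (hs : (s : WithTop ℝ≥0) < ν.failureTime ω) :
    A.m ≤ ν.level s ω := by
  by_contra hlt
  have : ν.failureTime ω ≤ s := sInf_le ⟨s, not_le.1 hlt, rfl⟩
  exact absurd this (not_le.2 hs)

/-- Balance over a period of a stage without interventions. -/
theorem IsRegular.drift_balance (h : ν.IsRegular ω) (hW : A.IsCandidate W) {n i : ℕ} {a b : ℝ≥0}
    (hab : a ≤ b) (hna : X.arrival n ω ≤ a) (hbn : b ≤ X.arrival (n + 1) ω)
    (hb : (b : WithTop ℝ≥0) ≤ ν.failureTime ω) (hlt : ∀ j < i, ν.τ j ω ≤ a)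
    (hge : ∀ j, i ≤ j → (b : WithTop ℝ≥0) ≤ ν.τ j ω) (hM : ν.stageLevel n i a ω ≤ A.M) :
    LeOrEq (ν.IsLossless W ω)
      (A.discount b * A.aliveValue W (ν.stageLevel n i b ω)
        + ∫⁻ s in Ioo (a : ℝ) b, A.discount s * A.gainRate W (ν.level s.toNNReal ω))
      (A.discount a * A.aliveValue W (ν.stageLevel n i a ω)
        + ∫⁻ s in Ioo (a : ℝ) b, A.discount s * A.lossRate W (ν.level s.toNNReal ω)) := by
  rcases hab.eq_or_lt with rfl | hab'
  · simp [LeOrEq.refl]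
  have hcount : ∀ s : ℝ≥0, a < s → s < b → ∀ j, ν.τ j ω < (s : WithTop ℝ≥0) ↔ j < i := by
    intro s h1 h2 j
    constructor
    · intro hj
      by_contra hij
      exact absurd ((hge j (not_lt.1 hij)).trans_lt hj) (not_lt.2 (WithTop.coe_le_coe.2 h2.le))
    · exact fun hj => (hlt j hj).trans_lt (WithTop.coe_lt_coe.2 h1)
  have hR : ∀ s : ℝ≥0, a < s → s < b → ν.level s ω = ν.stageLevel n i s ω := fun s h1 h2 =>
    h.level_eq_stageLevel (hna.trans h1.le) (h2.trans_le hbn) (hcount s h1 h2)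
  have hR' : ∀ s ∈ Ioo (a : ℝ) b, ν.level s.toNNReal ω = ν.stageLevel n i s.toNNReal ω := by
    intro s hs
    have h0 : 0 ≤ s := (NNReal.coe_nonneg a).trans hs.1.le
    exact hR _ (Real.lt_toNNReal_iff_coe_lt.2 hs.1) ((Real.toNNReal_lt_iff_lt_coe h0).2 hs.2)
  have habR : (a : ℝ) < b := NNReal.coe_lt_coe.2 hab'
  set ρ : ℝ → ℝ := fun s => ν.stageLevel n i s.toNNReal ω with hρ
  have hρa : ρ a = ν.stageLevel n i a ω := by rw [hρ]; simp only [Real.toNNReal_coe]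
  have hρb : ρ b = ν.stageLevel n i b ω := by rw [hρ]; simp only [Real.toNNReal_coe]
  have hi := fun u v => A.intervalIntegrable_rate h.measurable_level u v
  have hρc : ContinuousOn ρ (Icc a b) := by
    have h1 : Continuous fun t : ℝ≥0 => ν.stageLevel n i t ω :=
      continuous_const.sub ((intervalIntegral.continuous_primitive hi 0).comp NNReal.continuous_coe)
    exact (h1.comp continuous_real_toNNReal).continuousOn
  have hρeq : ∀ s ∈ Icc (a : ℝ) b, ρ s = ρ a - ∫ v in (a : ℝ)..s, A.rate (ρ v) := by
    intro s hs
    have hs0 : 0 ≤ s := (NNReal.coe_nonneg a).trans hs.1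
    rw [hρa, hρ]
    simp only
    rw [h.stageLevel_sub n i a, Real.coe_toNNReal _ hs0, intervalIntegral.integral_of_le hs.1,
      intervalIntegral.integral_of_le hs.1, integral_Ioc_eq_integral_Ioo,
      integral_Ioc_eq_integral_Ioo]
    congr 1
    refine setIntegral_congr_fun measurableSet_Ioo fun v hv => ?_
    simp only [hR' v ⟨hv.1, hv.2.trans_le hs.2⟩]
  have hmb : A.m ≤ ρ b := by
    have hne := right_nhdsWithin_Ioo_neBot habR
    have ht : Tendsto ρ (𝓝[Ioo (a : ℝ) b] b) (𝓝 (ρ b)) :=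
      (hρc b ⟨habR.le, le_rfl⟩).mono_left (nhdsWithin_mono _ Ioo_subset_Icc_self)
    refine ge_of_tendsto ht ?_
    filter_upwards [self_mem_nhdsWithin] with s hs
    simp only [hρ]
    rw [← hR' s hs]
    have h0 : 0 ≤ s := (NNReal.coe_nonneg a).trans hs.1.le
    exact le_level_of_lt ((WithTop.coe_lt_coe.2
      ((Real.toNNReal_lt_iff_lt_coe h0).2 hs.2)).trans_le hb)
  have e : ∀ f : ℝ → ℝ≥0∞, ∫⁻ s in Ioo (a : ℝ) b, A.discount s * f (ν.level s.toNNReal ω)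
      = ∫⁻ s in Ioo (a : ℝ) b, A.discount s * f (ρ s) := fun f =>
    setLIntegral_congr_fun measurableSet_Ioo fun s hs => by simp only [hR' s hs, hρ]
  rw [e, e, ← hρa, ← hρb]
  rw [← hρa] at hM
  refine ⟨hW.drift_le habR.le hρc hρeq hM hmb, fun hl => hW.drift_eq habR.le hρc hρeq hM hmb
    fun s hs => ?_⟩
  have h0 : 0 ≤ s := (NNReal.coe_nonneg a).trans hs.1.le
  have h1 := Real.lt_toNNReal_iff_coe_lt.2 hs.1
  have h2 := (Real.toNNReal_lt_iff_lt_coe h0).2 hs.2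
  have := hl.excess_pos s.toNNReal (fun j hj => ?_) ((WithTop.coe_lt_coe.2 h2).trans_le hb)
  · rwa [hR' s hs] at this
  · by_cases hji : j < i
    · have := (hcount _ h1 h2 j).2 hji
      rw [hj] at this
      exact lt_irrefl _ this
    · have := hge j (not_lt.1 hji)
      rw [hj, WithTop.coe_le_coe] at this
      exact absurd this (not_le.2 h2)

/-- Balance of an intervention. -/
theorem IsRegular.intervention_balance (h : ν.IsRegular ω) (hW : A.IsCandidate W) {n i : ℕ}
    {t : ℝ≥0} (ht : ν.τ i ω = t) (h1 : X.arrival n ω ≤ t) (h2 : t < X.arrival (n + 1) ω)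
    (hκ : (t : WithTop ℝ≥0) < ν.failureTime ω) :
    ν.stageLevel n (i + 1) t ω ≤ A.M ∧ LeOrEq (ν.IsLossless W ω)
      (A.discount t * A.aliveValue W (ν.stageLevel n (i + 1) t ω))
      (A.discount t * A.aliveValue W (ν.stageLevel n i t ω) + ν.stageCost n i ω) := by
  have hb := h.levelBefore_eq ht h1 h2
  have hz := h.ζ_mem i (by rw [ht]; exact WithTop.coe_ne_top)
  have hx : A.m ≤ ν.levelBefore i ω := by
    refine (le_level_of_lt hκ).trans ?_
    rw [levelBefore, ht, WithTop.untopD_coe]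
    refine le_add_of_nonneg_right (Finset.sum_nonneg fun j hj => ?_)
    split_ifs with hj'
    · exact (h.ζ_mem j (by rw [hj']; exact WithTop.coe_ne_top)).1
    · exact le_rfl
  have hcost : ν.stageCost n i ω = ENNReal.ofReal (Real.exp (-A.δ * t)
      * A.cost (ν.levelBefore i ω) (ν.ζ i ω)) := by
    rw [stageCost, if_pos ⟨by rw [ht]; exact WithTop.coe_le_coe.2 h1,
      by rw [ht]; exact WithTop.coe_lt_coe.2 h2, by rw [ht]; exact hκ⟩, interventionCost, ht,
      WithTop.untopD_coe]
  rw [hcost, ν.stageLevel_succ, ← hb]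
  set x := ν.levelBefore i ω with hxdef
  set z := ν.ζ i ω with hzdef
  have hxM : x ∈ Icc A.m A.M := ⟨hx, by linarith [hz.1, hz.2]⟩
  have hyM : x + z ∈ Icc A.m A.M := ⟨by linarith [hz.1], by linarith [hz.2]⟩
  have hc0 : 0 ≤ A.cost x z := by
    have := A.H_monotone hxM hyM (by linarith [hz.1])
    rw [MaintenanceModel.cost]
    linarith [A.k_pos]
  refine ⟨hyM.2, ?_⟩
  rw [MaintenanceModel.aliveValue_of_mem hxM, MaintenanceModel.aliveValue_of_mem hyM,
    ENNReal.ofReal_mul (Real.exp_pos _).le, MaintenanceModel.discount, ← mul_add,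
    ← ENNReal.ofReal_add (hW.nonneg hxM) hc0]
  constructor
  · gcongr
    have h3 := hW.le_bestTarget' hxM (y := x + z) ⟨by linarith [hz.1], hyM.2⟩
    have h4 := hW.obstacle_le' hxM
    rw [MaintenanceModel.cost]
    linarith
  · intro hl
    rw [hl.value_eq i (by rw [ht]; exact hκ)]

/-- Balance of the candidate value over one stage: along any regular path the value, together with
the gains, can only decrease; along a lossless path it is preserved. -/
theorem IsRegular.stage_balance (h : ν.IsRegular ω) (hW : A.IsCandidate W) (hr : r ≤ A.M) (n : ℕ) :
    LeOrEq (ν.IsLossless W ω)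
      (ν.stageEnd W n ω + ν.stageIntegral (A.gainRate W) n ω)
      (ν.stageValue W n ω + (∑' i, ν.stageCost n i ω) + ν.stageIntegral (A.lossRate W) n ω) := by
  have hTT := h.strictMono_arrival (Nat.lt_succ_self n)
  simp only [Nat.succ_eq_add_one] at hTT
  have hcost0 : ∀ i, ν.failureTime ω ≤ ν.τ i ω → ν.stageCost n i ω = 0 := fun i hi => by
    rw [stageCost, if_neg fun h' => absurd h'.2.2 (not_lt.2 hi)]
  by_cases hκn : (X.arrival n ω : WithTop ℝ≥0) ≤ ν.failureTime ω
  swap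
  · have hκ := not_le.1 hκn
    have h1 : ∀ f, ν.stageIntegral f n ω = 0 := fun f => by
      rw [stageIntegral]
      refine (setLIntegral_congr_fun measurableSet_Ioo fun s hs => ?_).trans lintegral_zero
      rw [if_neg]
      have := Real.lt_toNNReal_iff_coe_lt.2 hs.1
      exact not_le.2 (hκ.trans (WithTop.coe_lt_coe.2 this))
    have h2 : ν.stageEnd W n ω = 0 := by
      rw [stageEnd, if_neg (not_le.2 (hκ.trans (WithTop.coe_lt_coe.2 hTT)))]
    have h3 : ν.stageValue W n ω = 0 := by rw [stageValue, if_neg hκn]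
    have h4 : ∀ i, ν.stageCost n i ω = 0 := fun i => by
      rw [stageCost, if_neg]
      rintro ⟨h5, -, h6⟩
      exact absurd (h5.trans_lt (h6.trans hκ)) (lt_irrefl _)
    simp [h1, h2, h3, h4, LeOrEq.refl]
  -- the end of the stage or the failure, whichever comes first
  obtain ⟨ϑ, hϑ⟩ : ∃ ϑ : ℝ≥0, (ϑ : WithTop ℝ≥0) = min (ν.failureTime ω) (X.arrival (n + 1) ω) :=
    WithTop.ne_top_iff_exists.1 (ne_top_of_le_ne_top WithTop.coe_ne_top (min_le_right _ _))
  have hϑκ : (ϑ : WithTop ℝ≥0) ≤ ν.failureTime ω := hϑ ▸ min_le_left _ _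
  have hϑT : ϑ ≤ X.arrival (n + 1) ω := WithTop.coe_le_coe.1 (hϑ ▸ min_le_right _ _)
  have hTϑ : X.arrival n ω ≤ ϑ := WithTop.coe_le_coe.1
    (hϑ ▸ le_min hκn (WithTop.coe_le_coe.2 hTT.le))
  obtain ⟨i₀, hi₀⟩ := h.exists_count (X.arrival n ω)
  obtain ⟨i₁, hi₁⟩ := h.exists_count ϑ
  have hi01 : i₀ ≤ i₁ := by
    by_contra hlt
    have := ((hi₀ i₁).2 (not_le.1 hlt)).trans_le (WithTop.coe_le_coe.2 hTϑ)
    exact lt_irrefl _ ((hi₁ i₁).1 this)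
  set T := X.arrival n ω with hT
  set gain := fun s : ℝ => A.discount s * A.gainRate W (ν.level s.toNNReal ω) with hgain
  set loss := fun s : ℝ => A.discount s * A.lossRate W (ν.level s.toNNReal ω) with hloss
  set V := A.discount T * A.aliveValue W (ν.level T ω) with hV
  set C : ℕ → ℝ≥0∞ := fun i => ν.stageCost n i ω with hC
  have hbefore : ∀ i < i₀, C i = 0 := fun i hi => by
    rw [hC]
    simp only [stageCost]
    rw [if_neg fun h' => absurd h'.1 (not_le.2 ((hi₀ i).2 hi))]
  have key : ∀ i, i₀ ≤ i → i ≤ i₁ → ∃ a : ℝ≥0, T ≤ a ∧ a ≤ ϑ ∧ (∀ j < i, ν.τ j ω ≤ a) ∧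
      (∀ j, i ≤ j → (a : WithTop ℝ≥0) ≤ ν.τ j ω) ∧ ν.stageLevel n i a ω ≤ A.M ∧
      LeOrEq (ν.IsLossless W ω)
        (A.discount a * A.aliveValue W (ν.stageLevel n i a ω) + ∫⁻ s in Ioo (T : ℝ) a, gain s)
        (V + (∑ j ∈ Finset.range i, C j) + ∫⁻ s in Ioo (T : ℝ) a, loss s) := by
    intro i hi
    induction i, hi using Nat.le_induction with
    | base =>
      intro _
      have hlev : ν.stageLevel n i₀ T ω = ν.level T ω :=
        (h.level_eq_stageLevel le_rfl hTT hi₀).symm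
      refine ⟨T, le_rfl, hTϑ, fun j hj => ((hi₀ j).2 hj).le, fun j hj => ?_, ?_, ?_⟩
      · by_contra hlt
        exact absurd ((hi₀ j).1 (not_le.1 hlt)) (not_lt.2 hj)
      · rw [hlev]; exact h.level_le hr T
      · rw [hlev, Finset.sum_eq_zero fun j hj => hbefore j (Finset.mem_range.1 hj)]
        simp [hV, LeOrEq.refl]
    | succ i hi ih =>
      intro hi1
      obtain ⟨a, hTa, haϑ, ha1, ha2, haM, hrel⟩ := ih (by omega)
      have hτϑ := (hi₁ i).2 (by omega)
      obtain ⟨t, ht⟩ := WithTop.ne_top_iff_exists.1 (ne_top_of_lt hτϑ)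
      have hat : a ≤ t := by
        have := ha2 i le_rfl
        rwa [← ht, WithTop.coe_le_coe] at this
      have htϑ : t < ϑ := by rwa [← ht, WithTop.coe_lt_coe] at hτϑ
      have hdr := h.drift_balance hW (n := n) (i := i) hat hTa (htϑ.le.trans hϑT)
        ((WithTop.coe_le_coe.2 htϑ.le).trans hϑκ) ha1 (fun j hj => by rw [ht]; exact h.τ_mono hj)
        haM
      obtain ⟨hM', himp⟩ := h.intervention_balance hW (n := n) ht.symm (hTa.trans hat)
        (htϑ.trans_le hϑT) ((WithTop.coe_lt_coe.2 htϑ).trans_le hϑκ)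
      refine ⟨t, hTa.trans hat, htϑ.le, fun j hj => ?_, fun j hj => ?_, hM', ?_⟩
      · rw [ht]; exact h.τ_mono (Nat.lt_succ_iff.1 hj)
      · rw [ht]; exact h.τ_mono (by omega)
      · rw [← setLIntegral_Ioo_add (NNReal.coe_le_coe.2 hTa) (NNReal.coe_le_coe.2 hat) gain,
          ← setLIntegral_Ioo_add (NNReal.coe_le_coe.2 hTa) (NNReal.coe_le_coe.2 hat) loss,
          Finset.sum_range_succ]
        have s1 := himp.add_right ((∫⁻ s in Ioo (T : ℝ) a, gain s) + ∫⁻ s in Ioo (a : ℝ) t, gain s)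
        have s2 := hdr.add_right (C i + ∫⁻ s in Ioo (T : ℝ) a, gain s)
        have s3 := hrel.add_right (C i + ∫⁻ s in Ioo (a : ℝ) t, loss s)
        refine s1.trans ?_
        convert s2.trans ?_ using 1
        · simp only [hC, hgain]; ring
        convert s3 using 1
        · simp only [hloss]; ring
        · ring
  obtain ⟨a, hTa, haϑ, ha1, -, haM, hrel⟩ := key i₁ hi01 le_rfl
  have hdr := h.drift_balance hW (n := n) (i := i₁) haϑ hTa hϑT hϑκ ha1 (fun j hj => by
    by_contra hlt
    exact absurd ((hi₁ j).1 (not_le.1 hlt)) (not_lt.2 hj)) haM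
  have hsum : ∑' i, ν.stageCost n i ω = ∑ j ∈ Finset.range i₁, C j := by
    rw [tsum_eq_sum]
    intro j hj
    rw [stageCost, if_neg]
    rintro ⟨-, h5, h6⟩
    have : ν.τ j ω < (ϑ : WithTop ℝ≥0) := hϑ ▸ lt_min h6 h5
    exact hj (Finset.mem_range.2 ((hi₁ j).1 this))
  have hint : ∀ f, ν.stageIntegral f n ω
      = ∫⁻ s in Ioo (T : ℝ) ϑ, A.discount s * f (ν.level s.toNNReal ω) := by
    intro f
    rw [stageIntegral, ← setLIntegral_Ioo_add (NNReal.coe_le_coe.2 hTϑ) (NNReal.coe_le_coe.2 hϑT)]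
    have h1 : ∫⁻ s in Ioo (ϑ : ℝ) (X.arrival (n + 1) ω),
        (if (s.toNNReal : WithTop ℝ≥0) ≤ ν.failureTime ω then
          A.discount s * f (ν.level s.toNNReal ω) else 0) = 0 := by
      refine (setLIntegral_congr_fun measurableSet_Ioo fun s hs => ?_).trans lintegral_zero
      rw [if_neg]
      intro hs'
      have h0 : 0 ≤ s := (NNReal.coe_nonneg _).trans hs.1.le
      have h3 : (s.toNNReal : WithTop ℝ≥0) ≤ ϑ := by
        rw [hϑ]
        exact le_min hs' (WithTop.coe_le_coe.2 ((Real.toNNReal_lt_iff_lt_coe h0).2 hs.2).le)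
      rw [WithTop.coe_le_coe, Real.toNNReal_le_iff_le_coe] at h3
      exact absurd hs.1 (not_lt.2 h3)
    rw [h1, add_zero]
    refine setLIntegral_congr_fun measurableSet_Ioo fun s hs => ?_
    rw [if_pos]
    have h0 : 0 ≤ s := (NNReal.coe_nonneg _).trans hs.1.le
    exact (WithTop.coe_le_coe.2 ((Real.toNNReal_lt_iff_lt_coe h0).2 hs.2).le).trans hϑκ
  have hval : ν.stageValue W n ω = V := by rw [stageValue, if_pos hκn]
  have hend : LeOrEq (ν.IsLossless W ω) (ν.stageEnd W n ω)
      (A.discount ϑ * A.aliveValue W (ν.stageLevel n i₁ ϑ ω)) := by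
    by_cases hκ : (X.arrival (n + 1) ω : WithTop ℝ≥0) ≤ ν.failureTime ω
    · have hϑe : ϑ = X.arrival (n + 1) ω := by
        rw [min_eq_right hκ] at hϑ
        exact WithTop.coe_injective hϑ
      rw [hϑe] at hi₁
      rw [stageEnd, if_pos hκ, h.level_arrival hi₁, sub_add_cancel, hϑe]
      exact LeOrEq.refl _ _
    · rw [stageEnd, if_neg hκ]
      have hκ' := not_le.1 hκ
      rw [min_eq_left hκ'.le] at hϑ
      refine ⟨zero_le, fun hl => ?_⟩
      have hϑlt : ϑ < X.arrival (n + 1) ω := by rwa [← hϑ, WithTop.coe_lt_coe] at hκ'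
      rw [← h.level_eq_stageLevel hTϑ hϑlt hi₁, hl.failure_value ϑ hϑ.symm, mul_zero]
  rw [hint, hint, hval, hsum, ← setLIntegral_Ioo_add (NNReal.coe_le_coe.2 hTa)
    (NNReal.coe_le_coe.2 haϑ), ← setLIntegral_Ioo_add (NNReal.coe_le_coe.2 hTa)
    (NNReal.coe_le_coe.2 haϑ)]
  have s1 := hend.add_right ((∫⁻ s in Ioo (T : ℝ) a, gain s) + ∫⁻ s in Ioo (a : ℝ) ϑ, gain s)
  have s2 := hdr.add_right (∫⁻ s in Ioo (T : ℝ) a, gain s)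
  have s3 := hrel.add_right (∫⁻ s in Ioo (a : ℝ) ϑ, loss s)
  refine s1.trans ?_
  convert s2.trans ?_ using 1
  · simp only [hgain]; ring
  convert s3 using 1
  · simp only [hloss]; ring
  · simp only [hloss]; ring

end ImpulseControl

/-! ### The expected balance -/

namespace ImpulseControl

variable {Ω : Type*} [mΩ : MeasurableSpace Ω] {A : MaintenanceModel} {P : Measure Ω}
  {X : Shocks A P} {r : ℝ} (ν : ImpulseControl X r) {W : ℝ → ℝ}

theorem aemeasurable_stageIntegral (hν : ν.IsAdmissible) {f : ℝ → ℝ≥0∞} (hf : Measurable f)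
    (n : ℕ) : AEMeasurable (ν.stageIntegral f n) P := by
  classical
  obtain ⟨ρ, hρ, hρeq⟩ := ν.exists_hist_level hν n
  obtain ⟨B, hB, hBeq⟩ := ν.exists_hist_survival hν n
  set φ : Shocks.History × ℝ≥0 → ℝ≥0∞ := fun p => if p ∈ B then A.discount p.2 * f (ρ p) else 0
    with hφ
  have hφm : Measurable φ := Measurable.ite hB ((A.measurable_discount.comp
    (measurable_coe_nnreal_real.comp measurable_snd)).mul (hf.comp hρ)) measurable_const
  have hm : Measurable fun q : Ω × ℝ => (Ioo (X.arrival n q.1 : ℝ) (X.arrival (n + 1) q.1)).indicator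
      (fun s => φ (X.hist n q.1, s.toNNReal)) q.2 := by
    have hs : MeasurableSet {q : Ω × ℝ | (X.arrival n q.1 : ℝ) < q.2 ∧ q.2 < X.arrival (n + 1) q.1} :=
      (measurableSet_lt ((X.measurable_arrival n).coe_nnreal_real.comp measurable_fst)
        measurable_snd).inter (measurableSet_lt measurable_snd
          ((X.measurable_arrival (n + 1)).coe_nnreal_real.comp measurable_fst))
    exact (hφm.comp (((X.measurable_hist n).comp measurable_fst).prodMk
      (measurable_real_toNNReal.comp measurable_snd))).indicator hs
  refine ⟨_, hm.lintegral_prod_right' (ν := (volume : Measure ℝ)), ?_⟩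
  filter_upwards [hρeq, hBeq] with ω h1 h2
  rw [lintegral_indicator measurableSet_Ioo, stageIntegral]
  refine setLIntegral_congr_fun measurableSet_Ioo fun s hs => ?_
  have h0 : 0 ≤ s := (NNReal.coe_nonneg _).trans hs.1.le
  have h3 := (Real.toNNReal_lt_iff_lt_coe h0).2 hs.2
  simp only [hφ]
  rw [h1.1 _ h3, Real.coe_toNNReal _ h0]
  exact if_congr (h2 _ h3.le) rfl rfl

/-- The compensation formula for a function of the level before a shock and of its size. -/
theorem lintegral_stage [IsProbabilityMeasure P] (hν : ν.IsAdmissible) {f : ℝ × ℝ → ℝ≥0∞}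
    (hf : Measurable f) (n : ℕ) :
    ∫⁻ ω, (if (X.arrival (n + 1) ω : WithTop ℝ≥0) ≤ ν.failureTime ω then
        A.discount (X.arrival (n + 1) ω)
          * f (ν.level (X.arrival (n + 1) ω) ω + X.S n ω, X.S n ω) else 0) ∂P
      = ∫⁻ ω, ν.stageIntegral (fun y => ENNReal.ofReal A.lam * ∫⁻ x, f (y, x) ∂A.F) n ω ∂P := by
  classical
  have := A.isProbabilityMeasure_F
  obtain ⟨ρ, hρ, hρeq⟩ := ν.exists_hist_level hν n
  obtain ⟨B, hB, hBeq⟩ := ν.exists_hist_survival hν n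
  set φ : Shocks.History × ℝ≥0 × ℝ → ℝ≥0∞ := fun p =>
    if (p.1, p.2.1) ∈ B then A.discount p.2.1 * f (ρ (p.1, p.2.1), p.2.2) else 0 with hφ
  have hq : Measurable fun p : Shocks.History × ℝ≥0 × ℝ => (p.1, p.2.1) := by fun_prop
  have hφm : Measurable φ := Measurable.ite (hq hB) ((A.measurable_discount.comp
    (measurable_coe_nnreal_real.comp (measurable_fst.comp measurable_snd))).mul
      (hf.comp ((hρ.comp hq).prodMk (measurable_snd.comp measurable_snd)))) measurable_const
  refine Eq.trans (lintegral_congr_ae ?_) ((X.lintegral_next_shock n hφm).trans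
    (lintegral_congr_ae ?_))
  · filter_upwards [hρeq, hBeq] with ω h1 h2
    simp only [hφ]
    rw [h1.2, sub_add_cancel]
    exact if_congr (h2 _ le_rfl) rfl rfl
  · filter_upwards [hρeq, hBeq] with ω h1 h2
    rw [stageIntegral]
    refine setLIntegral_congr_fun measurableSet_Ioo fun s hs => ?_
    have h0 : 0 ≤ s := (NNReal.coe_nonneg _).trans hs.1.le
    have h3 := (Real.toNNReal_lt_iff_lt_coe h0).2 hs.2
    simp only [hφ]
    by_cases hb : (X.hist n ω, s.toNNReal) ∈ B
    · have hm : Measurable fun x => f (ρ (X.hist n ω, s.toNNReal), x) :=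
        hf.comp measurable_prodMk_left
      simp only [if_pos hb, if_pos ((h2 _ h3.le).2 hb), h1.1 _ h3, Real.coe_toNNReal _ h0]
      rw [lintegral_const_mul _ hm]
      ring
    · simp only [if_neg hb, if_neg (fun h => hb ((h2 _ h3.le).1 h)), lintegral_zero, mul_zero]

theorem lintegral_stageEnd [IsProbabilityMeasure P] (hν : ν.IsAdmissible) (hW : A.IsCandidate W)
    (n : ℕ) : ∫⁻ ω, ν.stageEnd W n ω ∂P = ∫⁻ ω, ν.stageIntegral (A.lossRate W) n ω ∂P := by
  have := A.isProbabilityMeasure_F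
  have := ν.lintegral_stage hν (f := fun q => A.aliveValue W q.1)
    (hW.measurable_aliveValue.comp measurable_fst) n
  simpa only [lintegral_const, measure_univ, mul_one] using! this

theorem lintegral_stageValue_succ [IsProbabilityMeasure P] (hν : ν.IsAdmissible)
    (hW : A.IsCandidate W) (n : ℕ) : ∫⁻ ω, ν.stageValue W (n + 1) ω ∂P
      = ∫⁻ ω, ν.stageIntegral (fun y => ENNReal.ofReal A.lam * A.shockMean W y) n ω ∂P := by
  have := ν.lintegral_stage hν (f := fun q => A.aliveValue W (q.1 - q.2))
    (hW.measurable_aliveValue.comp (measurable_fst.sub measurable_snd)) n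
  simpa only [add_sub_cancel_right] using! this

variable {ν}

theorem measurableSet_before_failure (ω : Ω) :
    MeasurableSet {s : ℝ | (s.toNNReal : WithTop ℝ≥0) ≤ ν.failureTime ω} := by
  refine OrdConnected.measurableSet ⟨fun x hx y hy z hz => ?_⟩
  exact (WithTop.coe_le_coe.2 (Real.toNNReal_le_toNNReal hz.2)).trans hy

theorem IsRegular.stageIntegral_gainRate {ω : Ω} (h : ν.IsRegular ω) (hW : A.IsCandidate W)
    (n : ℕ) : ν.stageIntegral (A.gainRate W) n ω
      = ν.stageIntegral (fun x => ENNReal.ofReal (A.G x)) n ω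
        + ν.stageIntegral (fun y => ENNReal.ofReal A.lam * A.shockMean W y) n ω := by
  rw [stageIntegral, stageIntegral, stageIntegral, ← lintegral_add_right]
  · refine lintegral_congr fun s => ?_
    split_ifs
    · rw [MaintenanceModel.gainRate, mul_add]
    · simp
  · refine Measurable.ite (measurableSet_before_failure ω) (A.measurable_discount.mul
      ((hW.measurable_shockMean.comp ?_).const_mul _)) measurable_const
    exact h.measurable_level.comp measurable_real_toNNReal

theorem stageEnd_le (hW : A.IsCandidate W) (n : ℕ) (ω : Ω) :
    ν.stageEnd W n ω ≤ ENNReal.ofReal A.valueBound := by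
  rw [stageEnd]
  split_ifs
  · calc _ ≤ 1 * ENNReal.ofReal A.valueBound := by
          gcongr
          · rw [MaintenanceModel.discount, ENNReal.ofReal_le_one, Real.exp_le_one_iff]
            have := A.δ_pos
            have := NNReal.coe_nonneg (X.arrival (n + 1) ω)
            nlinarith
          · exact hW.aliveValue_le _
      _ = _ := one_mul _
  · exact zero_le

theorem stageValue_le (hW : A.IsCandidate W) (n : ℕ) (ω : Ω) :
    ν.stageValue W n ω ≤ A.discount (X.arrival n ω) * ENNReal.ofReal A.valueBound := by
  rw [stageValue]
  split_ifs
  · gcongr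
    exact hW.aliveValue_le _
  · exact zero_le

/-- This finiteness allows cancelling the loss in the expected balance. -/
theorem lintegral_loss_ne_top [IsProbabilityMeasure P] (hν : ν.IsAdmissible) (hW : A.IsCandidate W)
    (n : ℕ) : ∫⁻ ω, ν.stageIntegral (A.lossRate W) n ω ∂P ≠ ⊤ := by
  rw [← ν.lintegral_stageEnd hν hW]
  refine ne_top_of_le_ne_top ENNReal.ofReal_ne_top (b := ENNReal.ofReal A.valueBound) ?_
  calc ∫⁻ ω, ν.stageEnd W n ω ∂P ≤ ∫⁻ _, ENNReal.ofReal A.valueBound ∂P :=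
        lintegral_mono fun ω => stageEnd_le hW n ω
    _ = _ := by simp

theorem aemeasurable_stageEnd (hν : ν.IsAdmissible) (hW : A.IsCandidate W) (n : ℕ) :
    AEMeasurable (ν.stageEnd W n) P := by
  classical
  obtain ⟨ρ, hρ, hρeq⟩ := ν.exists_hist_level hν n
  obtain ⟨B, hB, hBeq⟩ := ν.exists_hist_survival hν n
  have hq : Measurable fun ω => (X.hist n ω, X.arrival (n + 1) ω) :=
    (X.measurable_hist n).prodMk (X.measurable_arrival (n + 1))
  refine ⟨fun ω => if (X.hist n ω, X.arrival (n + 1) ω) ∈ B then A.discount (X.arrival (n + 1) ω)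
    * A.aliveValue W (ρ (X.hist n ω, X.arrival (n + 1) ω)) else 0,
    Measurable.ite (hq hB) ((A.measurable_discount.comp
      (X.measurable_arrival (n + 1)).coe_nnreal_real).mul
        (hW.measurable_aliveValue.comp (hρ.comp hq))) measurable_const, ?_⟩
  filter_upwards [hρeq, hBeq] with ω h1 h2
  rw [stageEnd, h1.2, sub_add_cancel]
  exact if_congr (h2 _ le_rfl) rfl rfl

theorem stageValue_zero {ω : Ω} (h : ν.IsRegular ω) (hr : r ∈ Icc A.m A.M) :
    ν.stageValue W 0 ω = ENNReal.ofReal (W r) := by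
  rw [stageValue, if_pos (by simp), X.arrival_zero, h.level_zero,
    MaintenanceModel.aliveValue_of_mem hr, MaintenanceModel.discount]
  simp

theorem aemeasurable_stageValue (hν : ν.IsAdmissible) (hW : A.IsCandidate W)
    (hr : r ∈ Icc A.m A.M) (n : ℕ) : AEMeasurable (ν.stageValue W n) P := by
  classical
  cases n with
  | zero =>
    refine ⟨fun _ => ENNReal.ofReal (W r), measurable_const, ?_⟩
    filter_upwards [ν.ae_isRegular hν] with ω h
    exact stageValue_zero h hr
  | succ n =>
    obtain ⟨ρ, hρ, hρeq⟩ := ν.exists_hist_level hν n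
    obtain ⟨B, hB, hBeq⟩ := ν.exists_hist_survival hν n
    have hq : Measurable fun ω => (X.hist n ω, X.arrival (n + 1) ω) :=
      (X.measurable_hist n).prodMk (X.measurable_arrival (n + 1))
    refine ⟨fun ω => if (X.hist n ω, X.arrival (n + 1) ω) ∈ B then A.discount (X.arrival (n + 1) ω)
      * A.aliveValue W (ρ (X.hist n ω, X.arrival (n + 1) ω) - X.S n ω) else 0,
      Measurable.ite (hq hB) ((A.measurable_discount.comp
        (X.measurable_arrival (n + 1)).coe_nnreal_real).mul
          (hW.measurable_aliveValue.comp ((hρ.comp hq).sub (X.measurable_S n))))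
          measurable_const, ?_⟩
    filter_upwards [hρeq, hBeq] with ω h1 h2
    rw [stageValue, h1.2]
    exact if_congr (h2 _ le_rfl) rfl rfl

/-- Expected balance of one stage: gains and value at the next stage do not exceed value and
costs of this stage, with equality for a lossless control. -/
theorem lintegral_stage_balance [IsProbabilityMeasure P] (hν : ν.IsAdmissible)
    (hW : A.IsCandidate W) (hr : r ∈ Icc A.m A.M) (n : ℕ) :
    LeOrEq (∀ᵐ ω ∂P, ν.IsLossless W ω)
      ((∫⁻ ω, ν.stageIntegral (fun x => ENNReal.ofReal (A.G x)) n ω ∂P)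
        + ∫⁻ ω, ν.stageValue W (n + 1) ω ∂P)
      ((∫⁻ ω, ν.stageValue W n ω ∂P) + ∫⁻ ω, ∑' i, ν.stageCost n i ω ∂P) := by
  have hl : Measurable (A.lossRate W) := hW.measurable_aliveValue.const_mul _
  have hs : Measurable fun y => ENNReal.ofReal A.lam * A.shockMean W y :=
    hW.measurable_shockMean.const_mul _
  have e1 : ∫⁻ ω, ((ν.stageEnd W n ω
        + ν.stageIntegral (fun y => ENNReal.ofReal A.lam * A.shockMean W y) n ω)
        + ν.stageIntegral (fun x => ENNReal.ofReal (A.G x)) n ω) ∂P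
      = ((∫⁻ ω, ν.stageIntegral (fun x => ENNReal.ofReal (A.G x)) n ω ∂P)
        + ∫⁻ ω, ν.stageValue W (n + 1) ω ∂P)
        + ∫⁻ ω, ν.stageIntegral (A.lossRate W) n ω ∂P := by
    have a1 : AEMeasurable (fun ω => ν.stageEnd W n ω
        + ν.stageIntegral (fun y => ENNReal.ofReal A.lam * A.shockMean W y) n ω) P :=
      (aemeasurable_stageEnd hν hW n).add (ν.aemeasurable_stageIntegral hν hs n)
    rw [lintegral_add_left' a1, lintegral_add_left' (aemeasurable_stageEnd hν hW n),
      ν.lintegral_stageEnd hν hW, ν.lintegral_stageValue_succ hν hW]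
    ring
  have e2 : ∫⁻ ω, ((ν.stageIntegral (A.lossRate W) n ω + ν.stageValue W n ω)
        + ∑' i, ν.stageCost n i ω) ∂P
      = ((∫⁻ ω, ν.stageValue W n ω ∂P) + ∫⁻ ω, ∑' i, ν.stageCost n i ω ∂P)
        + ∫⁻ ω, ν.stageIntegral (A.lossRate W) n ω ∂P := by
    have a1 : AEMeasurable (fun ω => ν.stageIntegral (A.lossRate W) n ω + ν.stageValue W n ω) P :=
      (ν.aemeasurable_stageIntegral hν hl n).add (aemeasurable_stageValue hν hW hr n)
    rw [lintegral_add_left' a1, lintegral_add_left' (ν.aemeasurable_stageIntegral hν hl n)]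
    ring
  have hbal : ∀ᵐ ω ∂P, LeOrEq (ν.IsLossless W ω)
      ((ν.stageEnd W n ω + ν.stageIntegral (fun y => ENNReal.ofReal A.lam * A.shockMean W y) n ω)
        + ν.stageIntegral (fun x => ENNReal.ofReal (A.G x)) n ω)
      ((ν.stageIntegral (A.lossRate W) n ω + ν.stageValue W n ω)
        + ∑' i, ν.stageCost n i ω) := by
    filter_upwards [ν.ae_isRegular hν] with ω h
    have := h.stage_balance hW hr.2 n
    rw [h.stageIntegral_gainRate hW] at this
    convert this using 1 <;> ring
  have hfin := lintegral_loss_ne_top hν hW n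
  constructor
  · refine (ENNReal.add_le_add_iff_right hfin).1 ?_
    rw [← e1, ← e2]
    refine lintegral_mono_ae ?_
    filter_upwards [hbal] with ω h
    exact h.1
  · intro hL
    refine (ENNReal.add_left_inj hfin).1 ?_
    rw [← e1, ← e2]
    refine lintegral_congr_ae ?_
    filter_upwards [hbal, hL] with ω h h'
    exact h.2 h'

/-- The costs of a stage are measurable for a lossless control, as they balance the other terms. -/
theorem aemeasurable_stageCost [IsProbabilityMeasure P] (hν : ν.IsAdmissible)
    (hW : A.IsCandidate W) (hr : r ∈ Icc A.m A.M) (hL : ∀ᵐ ω ∂P, ν.IsLossless W ω)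
    (hG : ∀ n, AEMeasurable (ν.stageIntegral (fun x => ENNReal.ofReal (A.G x)) n) P) (n : ℕ) :
    AEMeasurable (fun ω => ∑' i, ν.stageCost n i ω) P := by
  have hl : Measurable (A.lossRate W) := hW.measurable_aliveValue.const_mul _
  have hs : Measurable fun y => ENNReal.ofReal A.lam * A.shockMean W y :=
    hW.measurable_shockMean.const_mul _
  have hm : AEMeasurable (fun ω => (ν.stageEnd W n ω
      + (ν.stageIntegral (fun x => ENNReal.ofReal (A.G x)) n ω
        + ν.stageIntegral (fun y => ENNReal.ofReal A.lam * A.shockMean W y) n ω))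
      - (ν.stageValue W n ω + ν.stageIntegral (A.lossRate W) n ω)) P :=
    ((aemeasurable_stageEnd hν hW n).add ((hG n).add (ν.aemeasurable_stageIntegral hν hs n))).sub
      ((aemeasurable_stageValue hν hW hr n).add (ν.aemeasurable_stageIntegral hν hl n))
  refine hm.congr ?_
  filter_upwards [ν.ae_isRegular hν, hL, ae_lt_top' (ν.aemeasurable_stageIntegral hν hl n)
    (lintegral_loss_ne_top hν hW n)] with ω h h' hfin
  have hv : ν.stageValue W n ω ≠ ⊤ := ne_top_of_le_ne_top
    (ENNReal.mul_ne_top ENNReal.ofReal_ne_top ENNReal.ofReal_ne_top) (stageValue_le hW n ω)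
  rw [← h.stageIntegral_gainRate hW, (h.stage_balance hW hr.2 n).2 h', add_right_comm,
    ENNReal.add_sub_cancel_left (ENNReal.add_ne_top.2 ⟨hv, hfin.ne⟩)]

/-- The benefit rate may be replaced by a measurable function. -/
theorem aemeasurable_stageIntegral_G (hν : ν.IsAdmissible) (hr : r ≤ A.M) (n : ℕ) :
    AEMeasurable (ν.stageIntegral (fun x => ENNReal.ofReal (A.G x)) n) P := by
  classical
  have hG : Measurable ((Icc A.m A.M).piecewise (fun x => ENNReal.ofReal (A.G x)) fun _ => 0) := by
    have := (ENNReal.continuous_ofReal.comp_continuousOn A.G_continuous).measurable_piecewise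
      (g := fun _ => 0) continuousOn_const measurableSet_Icc
    exact this
  refine (ν.aemeasurable_stageIntegral hν hG n).congr ?_
  filter_upwards [ν.ae_isRegular hν] with ω h
  rw [stageIntegral, stageIntegral]
  refine lintegral_congr_ae ((ae_restrict_iff' measurableSet_Ioo).2 ?_)
  have h0 : ∀ᵐ s : ℝ, s ≠ ((ν.failureTime ω).untopD 0 : ℝ≥0) := by simp [ae_iff]
  filter_upwards [h0] with s hs hs'
  have hs0 : 0 ≤ s := (NNReal.coe_nonneg _).trans hs'.1.le
  split_ifs with hκ
  · have hlt : (s.toNNReal : WithTop ℝ≥0) < ν.failureTime ω := by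
      refine lt_of_le_of_ne hκ fun he => hs ?_
      rw [← he, WithTop.untopD_coe, Real.coe_toNNReal _ hs0]
    rw [piecewise_eq_of_mem _ _ _ (show ν.level s.toNNReal ω ∈ Icc A.m A.M from
      ⟨le_level_of_lt hlt, h.level_le hr _⟩)]
  · rfl

theorem totalCost_eq (ω : Ω) :
    ν.totalCost ω = ∑' n, ∑' i, ν.stageCost n i ω := by
  rw [ENNReal.tsum_comm, totalCost]
  refine tsum_congr fun i => ?_
  by_cases hi : ν.τ i ω < ν.failureTime ω
  · obtain ⟨t, ht⟩ := WithTop.ne_top_iff_exists.1 (ne_top_of_lt hi)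
    rw [if_pos hi, tsum_eq_single (X.N t ω), stageCost, if_pos, interventionCost]
    · refine ⟨?_, ?_, hi⟩
      · rw [← ht]; exact WithTop.coe_le_coe.2 (X.arrival_N_le ω t)
      · rw [← ht]; exact WithTop.coe_lt_coe.2 (X.lt_arrival_N ω t)
    · intro n hn
      rw [stageCost, if_neg]
      rintro ⟨h1, h2, -⟩
      rw [← ht, WithTop.coe_le_coe] at h1
      rw [← ht, WithTop.coe_lt_coe] at h2
      exact hn (X.N_eq h1 h2).symm
  · rw [if_neg hi]
    refine (ENNReal.tsum_eq_zero.2 fun n => ?_).symm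
    rw [stageCost, if_neg fun h' => hi h'.2.2]

/-- The strict and the weak inequality between time and failure time, and the endpoints of the
stages, differ by null sets of times. -/
theorem benefit_eq (ω : Ω) :
    ν.benefit ω = ∑' n, ν.stageIntegral (fun x => ENNReal.ofReal (A.G x)) n ω := by
  set f : ℝ → ℝ≥0∞ := fun s => if (s.toNNReal : WithTop ℝ≥0) ≤ ν.failureTime ω then
    A.discount s * ENNReal.ofReal (A.G (ν.level s.toNNReal ω)) else 0 with hf
  have hmono : Monotone fun n => (X.arrival n ω : ℝ) := fun a b hab =>
    NNReal.coe_le_coe.2 (X.arrival_mono ω hab)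
  have hd : Pairwise (Function.onFun Disjoint fun n =>
      Ico (X.arrival n ω : ℝ) (X.arrival (n + 1) ω)) := hmono.pairwise_disjoint_on_Ico_succ
  have hU : ⋃ n, Ico (X.arrival n ω : ℝ) (X.arrival (n + 1) ω) = Ici 0 := by
    ext s
    simp only [mem_iUnion, mem_Ico, mem_Ici]
    constructor
    · rintro ⟨n, hn, -⟩
      exact (NNReal.coe_nonneg _).trans hn
    · intro hs
      lift s to ℝ≥0 using hs
      exact ⟨X.N s ω, NNReal.coe_le_coe.2 (X.arrival_N_le ω s),
        NNReal.coe_lt_coe.2 (X.lt_arrival_N ω s)⟩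
  have e1 : ∑' n, ν.stageIntegral (fun x => ENNReal.ofReal (A.G x)) n ω = ∫⁻ s in Ici 0, f s := by
    rw [← hU, lintegral_iUnion (fun _ => measurableSet_Ico) hd]
    exact tsum_congr fun n => setLIntegral_congr Ioo_ae_eq_Ico
  have hlt : MeasurableSet {s : ℝ | (s.toNNReal : WithTop ℝ≥0) < ν.failureTime ω} := by
    refine OrdConnected.measurableSet ⟨fun x hx y hy z hz => ?_⟩
    exact (WithTop.coe_le_coe.2 (Real.toNNReal_le_toNNReal hz.2)).trans_lt hy
  have hset : MeasurableSet {s : ℝ | 0 ≤ s ∧ (s.toNNReal : WithTop ℝ≥0) < ν.failureTime ω} :=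
    measurableSet_Ici.inter hlt
  rw [e1, benefit, ← lintegral_indicator hset,
    ← lintegral_indicator measurableSet_Ici]
  refine lintegral_congr_ae ?_
  have h0 : ∀ᵐ s : ℝ, s ≠ ((ν.failureTime ω).untopD 0 : ℝ≥0) := by simp [ae_iff]
  filter_upwards [h0] with s hs
  by_cases hs0 : 0 ≤ s
  · rw [indicator_of_mem (show s ∈ Ici (0 : ℝ) from hs0)]
    by_cases hκ : (s.toNNReal : WithTop ℝ≥0) < ν.failureTime ω
    · rw [indicator_of_mem (show s ∈ {s : ℝ | 0 ≤ s ∧ (s.toNNReal : WithTop ℝ≥0) < ν.failureTime ω}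
        from ⟨hs0, hκ⟩), hf]
      simp only
      rw [if_pos hκ.le, MaintenanceModel.discount, ENNReal.ofReal_mul (Real.exp_pos _).le]
    · rw [indicator_of_notMem (fun h' => hκ h'.2), hf]
      simp only
      rw [if_neg]
      refine fun hle => hκ (lt_of_le_of_ne hle fun he => hs ?_)
      rw [← he, WithTop.untopD_coe, Real.coe_toNNReal _ hs0]
  · rw [indicator_of_notMem (show s ∉ Ici (0 : ℝ) from hs0), indicator_of_notMem fun h' => hs0 h'.1]

theorem lintegral_benefit_ne_top [IsProbabilityMeasure P] (hν : ν.IsAdmissible) (hr : r ≤ A.M) :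
    ∫⁻ ω, ν.benefit ω ∂P ≠ ⊤ := by
  have hfin : ∫⁻ s in Ici (0 : ℝ), ENNReal.ofReal (Real.exp (-A.δ * s) * A.G A.M) ≠ ⊤ := by
    have h1 : IntegrableOn (fun s => Real.exp (-A.δ * s) * A.G A.M) (Ici 0) :=
      ((integrableOn_Ici_iff_integrableOn_Ioi).2 (exp_neg_integrableOn_Ioi 0 A.δ_pos)).mul_const _
    exact h1.lintegral_lt_top.ne
  refine ne_top_of_le_ne_top hfin ?_
  calc ∫⁻ ω, ν.benefit ω ∂P
      ≤ ∫⁻ _, (∫⁻ s in Ici (0 : ℝ), ENNReal.ofReal (Real.exp (-A.δ * s) * A.G A.M)) ∂P := by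
        refine lintegral_mono_ae ?_
        filter_upwards [ν.ae_isRegular hν] with ω h
        rw [benefit]
        have hlt : MeasurableSet {s : ℝ | (s.toNNReal : WithTop ℝ≥0) < ν.failureTime ω} := by
          refine OrdConnected.measurableSet ⟨fun x hx y hy z hz => ?_⟩
          exact (WithTop.coe_le_coe.2 (Real.toNNReal_le_toNNReal hz.2)).trans_lt hy
        refine (setLIntegral_mono' (measurableSet_Ici.inter hlt) fun s hs => ?_).trans
          (lintegral_mono_set fun s hs => hs.1)
        refine ENNReal.ofReal_le_ofReal (mul_le_mul_of_nonneg_left ?_ (Real.exp_pos _).le)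
        exact A.G_monotone ⟨le_level_of_lt hs.2, h.level_le hr _⟩ A.M_mem (h.level_le hr _)
    _ = _ := by simp

/-- Summing the expected balance over the first `K` stages. -/
theorem sum_stage_balance [IsProbabilityMeasure P] (hν : ν.IsAdmissible)
    (hW : A.IsCandidate W) (hr : r ∈ Icc A.m A.M) (K : ℕ) :
    LeOrEq (∀ᵐ ω ∂P, ν.IsLossless W ω)
      ((∑ n ∈ Finset.range K, ∫⁻ ω, ν.stageIntegral (fun x => ENNReal.ofReal (A.G x)) n ω ∂P)
        + ∫⁻ ω, ν.stageValue W K ω ∂P)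
      (ENNReal.ofReal (W r) + ∑ n ∈ Finset.range K, ∫⁻ ω, ∑' i, ν.stageCost n i ω ∂P) := by
  induction K with
  | zero =>
    have : ∫⁻ ω, ν.stageValue W 0 ω ∂P = ENNReal.ofReal (W r) := by
      rw [lintegral_congr_ae (g := fun _ => ENNReal.ofReal (W r))]
      · simp
      · filter_upwards [ν.ae_isRegular hν] with ω h
        exact stageValue_zero h hr
    simp [this, LeOrEq.refl]
  | succ K ih =>
    rw [Finset.sum_range_succ, Finset.sum_range_succ]
    have s1 := (lintegral_stage_balance hν hW hr K).add_right
      (∑ n ∈ Finset.range K, ∫⁻ ω, ν.stageIntegral (fun x => ENNReal.ofReal (A.G x)) n ω ∂P)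
    have s2 := ih.add_right (∫⁻ ω, ∑' i, ν.stageCost K i ω ∂P)
    convert s1.trans ?_ using 1
    · ring
    convert s2 using 1 <;> ring

/-- No admissible control earns more than the candidate value. -/
theorem lintegral_benefit_le [IsProbabilityMeasure P] (hν : ν.IsAdmissible)
    (hW : A.IsCandidate W) (hr : r ∈ Icc A.m A.M) :
    ∫⁻ ω, ν.benefit ω ∂P ≤ ENNReal.ofReal (W r) + ∫⁻ ω, ν.totalCost ω ∂P := by
  have e1 : ∫⁻ ω, ν.benefit ω ∂P
      = ∑' n, ∫⁻ ω, ν.stageIntegral (fun x => ENNReal.ofReal (A.G x)) n ω ∂P := by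
    rw [← lintegral_tsum fun n => aemeasurable_stageIntegral_G hν hr.2 n]
    exact lintegral_congr benefit_eq
  rw [e1]
  refine ENNReal.tsum_le_of_sum_range_le fun K => ?_
  refine (le_self_add.trans (sum_stage_balance hν hW hr K).1).trans ?_
  gcongr
  calc ∑ n ∈ Finset.range K, ∫⁻ ω, ∑' i, ν.stageCost n i ω ∂P
      ≤ ∫⁻ ω, ∑ n ∈ Finset.range K, ∑' i, ν.stageCost n i ω ∂P := by
        induction K with
        | zero => simp
        | succ K ih =>
          simp only [Finset.sum_range_succ]
          exact (add_le_add_left ih _).trans (le_lintegral_add _ _)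
    _ ≤ ∫⁻ ω, ν.totalCost ω ∂P := by
        refine lintegral_mono fun ω => ?_
        rw [totalCost_eq]
        exact ENNReal.sum_le_tsum _

/-- The value left after many shocks vanishes in the limit, since it is bounded and discounted. -/
theorem tendsto_lintegral_stageValue [IsProbabilityMeasure P] (hW : A.IsCandidate W) :
    Tendsto (fun n => ∫⁻ ω, ν.stageValue W n ω ∂P) atTop (𝓝 0) := by
  have harr : ∀ ω, Tendsto (fun n => (X.arrival n ω : ℝ)) atTop atTop := by
    intro ω
    refine NNReal.tendsto_coe_atTop.2 (tendsto_atTop_atTop_of_monotone (X.arrival_mono ω) fun t => ?_)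
    obtain ⟨n, hn⟩ := X.exists_lt_arrival ω t
    exact ⟨n, hn.le⟩
  have hmain : Tendsto (fun n => ∫⁻ ω, A.discount (X.arrival n ω) * ENNReal.ofReal A.valueBound ∂P)
      atTop (𝓝 (∫⁻ _, 0 ∂P)) := by
    refine tendsto_lintegral_of_dominated_convergence (fun _ => ENNReal.ofReal A.valueBound)
      (fun n => (A.measurable_discount.comp (X.measurable_arrival n).coe_nnreal_real).mul_const _)
      (fun n => ae_of_all _ fun ω => ?_) (by simp) (ae_of_all _ fun ω => ?_)
    · calc A.discount (X.arrival n ω) * ENNReal.ofReal A.valueBound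
          ≤ 1 * ENNReal.ofReal A.valueBound := by
            gcongr
            rw [MaintenanceModel.discount, ENNReal.ofReal_le_one, Real.exp_le_one_iff]
            have := A.δ_pos
            have := NNReal.coe_nonneg (X.arrival n ω)
            nlinarith
        _ = _ := one_mul _
    · have h1 : Tendsto (fun n => Real.exp (-A.δ * X.arrival n ω)) atTop (𝓝 0) :=
        Real.tendsto_exp_atBot.comp ((harr ω).const_mul_atTop_of_neg (by linarith [A.δ_pos]))
      have h2 := ENNReal.tendsto_ofReal h1
      rw [ENNReal.ofReal_zero] at h2
      have := ENNReal.Tendsto.mul_const (b := ENNReal.ofReal A.valueBound) h2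
        (Or.inr ENNReal.ofReal_ne_top)
      rwa [zero_mul] at this
  rw [lintegral_zero] at hmain
  exact tendsto_of_tendsto_of_tendsto_of_le_of_le tendsto_const_nhds hmain (fun _ => zero_le)
    fun n => lintegral_mono fun ω => stageValue_le hW n ω

/-- A lossless control earns at least the candidate value. -/
theorem IsAdmissible.le_lintegral_benefit [IsProbabilityMeasure P] (hν : ν.IsAdmissible)
    (hW : A.IsCandidate W) (hr : r ∈ Icc A.m A.M) (hL : ∀ᵐ ω ∂P, ν.IsLossless W ω) :
    ENNReal.ofReal (W r) + ∫⁻ ω, ν.totalCost ω ∂P ≤ ∫⁻ ω, ν.benefit ω ∂P := by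
  have hG := fun n => aemeasurable_stageIntegral_G hν hr.2 n
  have e1 : ∫⁻ ω, ν.benefit ω ∂P
      = ∑' n, ∫⁻ ω, ν.stageIntegral (fun x => ENNReal.ofReal (A.G x)) n ω ∂P := by
    rw [← lintegral_tsum hG]
    exact lintegral_congr benefit_eq
  have e2 : ∫⁻ ω, ν.totalCost ω ∂P = ∑' n, ∫⁻ ω, ∑' i, ν.stageCost n i ω ∂P := by
    rw [← lintegral_tsum fun n => aemeasurable_stageCost hν hW hr hL hG n]
    exact lintegral_congr totalCost_eq
  rw [e1, e2]
  have t1 := (ENNReal.tendsto_nat_tsum fun n => ∫⁻ ω, ∑' i, ν.stageCost n i ω ∂P).const_add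
    (ENNReal.ofReal (W r))
  have t2 := (ENNReal.tendsto_nat_tsum fun n =>
    ∫⁻ ω, ν.stageIntegral (fun x => ENNReal.ofReal (A.G x)) n ω ∂P).add
      (tendsto_lintegral_stageValue (ν := ν) hW)
  rw [add_zero] at t2
  exact le_of_tendsto_of_tendsto' t1 t2 fun K => ((sum_stage_balance hν hW hr K).2 hL).ge

/-- Upper bound for the value function. -/
theorem IsAdmissible.profit_le [IsProbabilityMeasure P] (hν : ν.IsAdmissible)
    (hW : A.IsCandidate W) (hr : r ∈ Icc A.m A.M) : ν.profit ≤ (W r : EReal) := by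
  have h := lintegral_benefit_le hν hW hr
  rw [profit]
  by_cases hC : ∫⁻ ω, ν.totalCost ω ∂P = ⊤
  · rw [hC]
    simp
  refine EReal.sub_le_of_le_add ?_
  have h2 : ((∫⁻ ω, ν.benefit ω ∂P : ℝ≥0∞) : EReal)
      ≤ ((ENNReal.ofReal (W r) + ∫⁻ ω, ν.totalCost ω ∂P : ℝ≥0∞) : EReal) :=
    EReal.coe_ennreal_le_coe_ennreal_iff.2 h
  rwa [EReal.coe_ennreal_add, EReal.coe_ennreal_ofReal, max_eq_left (hW.nonneg hr)] at h2

/-- A lossless control attains the candidate value. -/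
theorem IsAdmissible.le_profit [IsProbabilityMeasure P] (hν : ν.IsAdmissible)
    (hW : A.IsCandidate W) (hr : r ∈ Icc A.m A.M) (hL : ∀ᵐ ω ∂P, ν.IsLossless W ω) :
    (W r : EReal) ≤ ν.profit := by
  have h := hν.le_lintegral_benefit hW hr hL
  have hB := lintegral_benefit_ne_top hν hr.2
  have hC : ∫⁻ ω, ν.totalCost ω ∂P ≠ ⊤ := ne_top_of_le_ne_top hB (le_add_self.trans h)
  rw [profit]
  refine EReal.le_sub_iff_add_le (Or.inl ?_) (Or.inl ?_) |>.2 ?_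
  · simp
  · simpa using hC
  have h2 := EReal.coe_ennreal_le_coe_ennreal_iff.2 h
  rwa [EReal.coe_ennreal_add, EReal.coe_ennreal_ofReal, max_eq_left (hW.nonneg hr)] at h2

end ImpulseControl

/-! ### Target levels -/

namespace MaintenanceModel

variable (A : MaintenanceModel)

/-- The nearest level in `[m, M]`. -/
def clamp (x : ℝ) : ℝ := max A.m (min x A.M)

/-- The largest optimal target level of an intervention at level `x`. -/
def target (W : ℝ → ℝ) (x : ℝ) : ℝ :=
  sSup {y | y ∈ Icc x A.M ∧ W y - A.H y = bestTarget A.M A.H W x}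

/-- The excess of the value over the value of an intervention, extended by constants. -/
def excessAt (W : ℝ → ℝ) (x : ℝ) : ℝ := A.excess W (A.clamp x)

/-- The improvement that takes the level from `x` to the optimal target. -/
def improvement (W : ℝ → ℝ) (x : ℝ) : ℝ := A.target W (A.clamp x) - x

theorem clamp_of_mem {x : ℝ} (hx : x ∈ Icc A.m A.M) : A.clamp x = x := by
  rw [clamp, min_eq_left hx.2, max_eq_right hx.1]

theorem clamp_mem' (x : ℝ) : A.clamp x ∈ Icc A.m A.M := A.clamp_mem x

theorem continuous_clamp : Continuous A.clamp := by
  unfold clamp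
  fun_prop

theorem monotone_clamp : Monotone A.clamp := fun _ _ h => max_le_max_left _ (min_le_min_right _ h)

theorem le_clamp {x : ℝ} (hx : x ≤ A.M) : x ≤ A.clamp x := by
  rw [clamp, min_eq_left hx]
  exact le_max_right _ _

namespace IsCandidate

variable {A} {W : ℝ → ℝ}

theorem continuousOn_excess (hW : A.IsCandidate W) : ContinuousOn (A.excess W) (Icc A.m A.M) :=
  hW.continuousOn.sub ((hW.continuousOn_bestTarget.add A.H_continuous).sub continuousOn_const)

theorem continuous_excessAt (hW : A.IsCandidate W) : Continuous (A.excessAt W) :=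
  hW.continuousOn_excess.comp_continuous A.continuous_clamp A.clamp_mem'

theorem excessAt_nonneg (hW : A.IsCandidate W) (x : ℝ) : 0 ≤ A.excessAt W x := by
  have := hW.obstacle_le' (A.clamp_mem' x)
  rw [excessAt, excess]
  linarith

/-- The largest optimal target is an optimal target. -/
theorem target_mem (hW : A.IsCandidate W) {x : ℝ} (hx : x ∈ Icc A.m A.M) :
    A.target W x ∈ Icc x A.M ∧ W (A.target W x) - A.H (A.target W x) = bestTarget A.M A.H W x := by
  have hc : ContinuousOn (fun y => W y - A.H y) (Icc x A.M) :=
    (hW.continuousOn.sub A.H_continuous).mono (Icc_subset_Icc_left hx.1)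
  have hcl : IsClosed {y | y ∈ Icc x A.M ∧ W y - A.H y = bestTarget A.M A.H W x} :=
    hc.preimage_isClosed_of_isClosed isClosed_Icc (isClosed_singleton)
  have hcp : IsCompact {y | y ∈ Icc x A.M ∧ W y - A.H y = bestTarget A.M A.H W x} :=
    isCompact_Icc.of_isClosed_subset hcl fun y hy => hy.1
  obtain ⟨y, hy, hy'⟩ := hW.exists_target hx
  exact hcp.sSup_mem ⟨y, hy, hy'⟩

theorem le_target {x y : ℝ} (hy : y ∈ Icc x A.M)
    (h : W y - A.H y = bestTarget A.M A.H W x) : y ≤ A.target W x :=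
  le_csSup ⟨A.M, fun _ hz => hz.1.2⟩ ⟨hy, h⟩

theorem bestTarget_le (hW : A.IsCandidate W) {x y : ℝ} (hx : x ∈ Icc A.m A.M) (hy : y ∈ Icc x A.M) :
    bestTarget A.M A.H W y ≤ bestTarget A.M A.H W x := by
  obtain ⟨z, hz, hz'⟩ := hW.exists_target (x := y) ⟨hx.1.trans hy.1, hy.2⟩
  rw [← hz']
  exact hW.le_bestTarget' hx ⟨hy.1.trans hz.1, hz.2⟩

theorem monotoneOn_target (hW : A.IsCandidate W) : MonotoneOn (A.target W) (Icc A.m A.M) := by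
  intro x hx x' hx' hxx'
  obtain ⟨h1, h2⟩ := hW.target_mem hx
  rcases le_total x' (A.target W x) with h | h
  · refine le_target ⟨h, h1.2⟩ (le_antisymm (hW.le_bestTarget' hx' ⟨h, h1.2⟩) ?_)
    rw [h2]
    exact hW.bestTarget_le hx ⟨hxx', hx'.2⟩
  · exact h.trans (hW.target_mem hx').1.1

theorem measurable_improvement (hW : A.IsCandidate W) : Measurable (A.improvement W) := by
  have : Monotone fun x => A.target W (A.clamp x) := fun x y h =>
    hW.monotoneOn_target (A.clamp_mem' x) (A.clamp_mem' y) (A.monotone_clamp h)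
  exact this.measurable.sub measurable_id

/-- At a target level the value exceeds that of an intervention by the fixed cost. -/
theorem excess_target (hW : A.IsCandidate W) {x : ℝ} (hx : x ∈ Icc A.m A.M) :
    A.excess W (A.target W x) = A.k := by
  obtain ⟨h1, h2⟩ := hW.target_mem hx
  have hm : A.target W x ∈ Icc A.m A.M := ⟨hx.1.trans h1.1, h1.2⟩
  have h3 := hW.bestTarget_le hx h1
  have h4 := hW.le_bestTarget' hm ⟨le_rfl, h1.2⟩
  rw [excess]
  linarith

/-- Within a fixed distance below the target levels, interventions are not worth their cost. -/
theorem exists_gap (hW : A.IsCandidate W) : ∃ h > 0, ∀ x ∈ Icc A.m A.M,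
    ∀ y ∈ Icc (A.target W x - A.c A.m * h) (A.target W x), A.k / 2 ≤ A.excessAt W y := by
  have hu := isCompact_Icc.uniformContinuousOn_of_continuous hW.continuousOn_excess
  obtain ⟨η, hη, hd⟩ := Metric.uniformContinuousOn_iff.1 hu (A.k / 2) (half_pos A.k_pos)
  have hc := A.c_pos _ A.m_mem
  refine ⟨η / 2 / A.c A.m, by positivity, fun x hx y hy => ?_⟩
  have hm : A.target W x ∈ Icc A.m A.M :=
    ⟨hx.1.trans (hW.target_mem hx).1.1, (hW.target_mem hx).1.2⟩
  rw [mul_div_cancel₀ _ hc.ne'] at hy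
  have hle : A.clamp y ≤ A.target W x := by
    rw [← A.clamp_of_mem hm]; exact A.monotone_clamp hy.2
  have hge : y ≤ A.clamp y := A.le_clamp (hy.2.trans hm.2)
  have := hd (A.clamp y) (A.clamp_mem' y) _ hm (by
    rw [Real.dist_eq, abs_sub_lt_iff]
    constructor <;> linarith [hy.1])
  rw [hW.excess_target hx, Real.dist_eq, abs_sub_lt_iff] at this
  rw [excessAt]
  linarith [this.2]

/-- Where an intervention is optimal, it brings its cost. -/
theorem value_target (hW : A.IsCandidate W) {x : ℝ} (hx : x ∈ Icc A.m A.M)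
    (h : A.excess W x = 0) : W (A.target W x) = W x + A.cost x (A.target W x - x) := by
  have := (hW.target_mem hx).2
  rw [excess] at h
  rw [cost, add_sub_cancel]
  linarith

/-- If an intervention at the threshold is not optimal, the candidate value is `0` there, as the
drift causes failure at once. -/
theorem value_threshold (hW : A.IsCandidate W) (h : 0 < A.excess W A.m) : W A.m = 0 := by
  have := IsObstacleSolution.boundary hW
  simp only [bestTarget_levelAt, A.levelAt_zero] at this
  rw [excess] at h
  exact this (by linarith)

end IsCandidate
end MaintenanceModel

/-! ### Intervening at the first time at which it is optimal -/

/-- A finite number of interventions: `impulses` is the sum of the improvements made before a time,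
and `enabled` says that the last of the interventions took place strictly before a time (which is
always the case if there is none). -/
structure Plan (Ω : Type*) where
  impulses : Ω → ℝ≥0 → ℝ
  enabled : Ω → ℝ≥0 → Prop

namespace Plan

variable {Ω : Type*} [mΩ : MeasurableSpace Ω] {A : MaintenanceModel} {P : Measure Ω}
  (X : Shocks A P) (r : ℝ) (W : ℝ → ℝ) (p : Plan Ω)

/-- The level under the interventions of a plan. -/
def level (ω : Ω) (t : ℝ≥0) : ℝ :=
  levelPath A.rate (fun s => r - X.damage s ω + p.impulses ω s) t

/-- The first time after the interventions of the plan at which an intervention is optimal. -/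
def nextTime (ω : Ω) : WithTop ℝ≥0 :=
  sInf ((fun t : ℝ≥0 => (t : WithTop ℝ≥0)) ''
    {t | p.enabled ω t ∧ A.excessAt W (p.level X r ω t) = 0})

open Classical in
/-- The improvement at the next intervention. -/
def nextImprovement (ω : Ω) : ℝ :=
  if p.nextTime X r W ω = ⊤ then 0
  else A.improvement W (p.level X r ω ((p.nextTime X r W ω).untopD 0))

open Classical in
/-- The plan with the next intervention added. -/
def next : Plan Ω where
  impulses ω s := p.impulses ω s
    + if p.nextTime X r W ω < (s : WithTop ℝ≥0) then p.nextImprovement X r W ω else 0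
  enabled ω s := p.nextTime X r W ω < (s : WithTop ℝ≥0)

/-- The plan without interventions. -/
def empty (Ω : Type*) : Plan Ω where
  impulses _ _ := 0
  enabled _ _ := True

/-- A plan that depends on the past of the level only, and after whose last intervention no further
one is due immediately. -/
structure IsValid : Prop where
  enabled_le : ∀ ω, ∀ s t : ℝ≥0, s ≤ t → p.enabled ω s →
    p.enabled ω t ∧ p.impulses ω t = p.impulses ω s
  measurable_path : ∀ ω, Measurable (p.impulses ω)
  measurable_stopped : ∀ t : ℝ≥0, Measurable[(X.filtration r t).prod inferInstance]
    fun q : Ω × ℝ≥0 => p.impulses q.1 (min q.2 t)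
  measurableSet_enabled : ∀ t : ℝ≥0, MeasurableSet[X.filtration r t] {ω | p.enabled ω t}
  excess_after : ∀ ω, ∀ t : ℝ≥0, ¬ p.enabled ω t → (∀ s > t, p.enabled ω s) →
    ∃ u > t, ∀ s ∈ Ioo t u, A.k / 2 ≤ A.excessAt W (p.level X r ω s)

variable {X r W p}

theorem isValid_empty : (Plan.empty Ω).IsValid X r W where
  enabled_le _ _ _ _ _ := ⟨trivial, rfl⟩
  measurable_path _ := measurable_const
  measurable_stopped _ := measurable_const
  measurableSet_enabled _ := MeasurableSet.univ
  excess_after _ _ h := absurd trivial h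

namespace IsValid

theorem measurable_input (hp : p.IsValid X r W) (ω : Ω) :
    Measurable fun s => r - X.damage s ω + p.impulses ω s :=
  (measurable_const.sub (X.measurable_damage_path ω)).add (hp.measurable_path ω)

theorem level_rightContinuous (hp : p.IsValid X r W) {ω : Ω} {t : ℝ≥0} (ht : p.enabled ω t) :
    ContinuousWithinAt (p.level X r ω) (Ici t) t := by
  refine A.levelPath_rightContinuous (hp.measurable_input ω) ?_
  refine (continuousWithinAt_const.sub (X.damage_rightContinuous ω t)).add ?_
  refine (continuousWithinAt_const (b := p.impulses ω t)).congr (fun s hs => ?_) rfl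
  exact (hp.enabled_le ω t s hs ht).2

/-- Without shocks and interventions the level is continuous. -/
theorem level_continuousOn (hp : p.IsValid X r W) {ω : Ω} {a b : ℝ≥0} (ha : p.enabled ω a)
    (hd : ∀ s ∈ Icc a b, X.damage s ω = X.damage b ω) :
    ContinuousOn (p.level X r ω) (Icc a b) := by
  have hc : Continuous fun t : ℝ≥0 => r - X.damage b ω + p.impulses ω a
      - ∫ s in (0 : ℝ)..t, A.rate (p.level X r ω s.toNNReal) :=
    continuous_const.sub ((intervalIntegral.continuous_primitive (fun u v =>
      A.intervalIntegrable_rate (A.measurable_levelPath (hp.measurable_input ω)) u v) 0).comp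
        NNReal.continuous_coe)
  refine hc.continuousOn.congr fun s hs => ?_
  rw [level, A.levelPath_eq (hp.measurable_input ω), hd s hs, (hp.enabled_le ω a s hs.1 ha).2]
  rfl

/-- Times at which an intervention is optimal can only accumulate from the right at such a time. -/
theorem of_tendsto_right (hp : p.IsValid X r W) (hW : A.IsCandidate W) {ω : Ω} {q : ℕ → ℝ≥0}
    {t : ℝ≥0} (hq : Tendsto q atTop (𝓝 t)) (hle : ∀ᶠ n in atTop, t ≤ q n)
    (he : ∀ n, p.enabled ω (q n))
    (h0 : Tendsto (fun n => A.excessAt W (p.level X r ω (q n))) atTop (𝓝 0)) :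
    p.enabled ω t ∧ A.excessAt W (p.level X r ω t) = 0 := by
  have hen : p.enabled ω t := by
    by_contra hne
    have hlt : ∀ᶠ n in atTop, t < q n := hle.mono fun n hn =>
      lt_of_le_of_ne hn fun h => hne (h ▸ he n)
    obtain ⟨u, hu, hgap⟩ := hp.excess_after ω t hne fun s hs => by
      obtain ⟨n, hn⟩ := (hq.eventually (gt_mem_nhds hs)).exists
      exact (hp.enabled_le ω _ _ hn.le (he n)).1
    obtain ⟨n, h1, h2, h3⟩ := (hlt.and ((hq.eventually (gt_mem_nhds hu)).and
      (h0.eventually (gt_mem_nhds (half_pos A.k_pos))))).exists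
    exact absurd h3 (not_lt.2 (hgap _ ⟨h1, h2⟩))
  refine ⟨hen, tendsto_nhds_unique ?_ h0⟩
  exact (hW.continuous_excessAt.continuousAt.comp_continuousWithinAt
    (hp.level_rightContinuous hen)).tendsto.comp (tendsto_nhdsWithin_iff.2 ⟨hq, hle⟩)

/-- The first time at which an intervention is optimal is attained. -/
theorem nextTime_spec (hp : p.IsValid X r W) (hW : A.IsCandidate W) {ω : Ω} {t : ℝ≥0}
    (ht : p.nextTime X r W ω = t) : p.enabled ω t ∧ A.excessAt W (p.level X r ω t) = 0 := by
  set Z := {t | p.enabled ω t ∧ A.excessAt W (p.level X r ω t) = 0} with hZ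
  have hlb : ∀ s ∈ Z, t ≤ s := fun s hs => by
    have : p.nextTime X r W ω ≤ s := sInf_le ⟨s, hs, rfl⟩
    rwa [ht, WithTop.coe_le_coe] at this
  have hex : ∀ u > t, ∃ s ∈ Z, s < u := by
    intro u hu
    by_contra! hcon
    have : (u : WithTop ℝ≥0) ≤ p.nextTime X r W ω := by
      refine le_sInf ?_
      rintro _ ⟨s, hs, rfl⟩
      exact WithTop.coe_le_coe.2 (hcon s hs)
    rw [ht, WithTop.coe_le_coe] at this
    exact absurd hu (not_lt.2 this)
  have hn : ∀ n : ℕ, ∃ s ∈ Z, s < t + 1 / (n + 1) := fun n =>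
    hex _ (lt_add_of_pos_right t (by positivity))
  choose q hq hqlt using hn
  refine hp.of_tendsto_right hW (q := q) ?_ (Eventually.of_forall fun n => hlb _ (hq n))
    (fun n => (hq n).1) ?_
  · refine tendsto_of_tendsto_of_tendsto_of_le_of_le tendsto_const_nhds ?_
      (fun n => hlb _ (hq n)) (fun n => (hqlt n).le)
    have : Tendsto (fun n : ℕ => 1 / ((n : ℝ≥0) + 1)) atTop (𝓝 0) :=
      tendsto_one_div_add_atTop_nhds_zero_nat
    simpa using this.const_add t
  · simp only [fun n => (hq n).2]
    exact tendsto_const_nhds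

theorem nextTime_le_iff (hp : p.IsValid X r W) (hW : A.IsCandidate W) {ω : Ω} {t : ℝ≥0} :
    p.nextTime X r W ω ≤ t ↔ ∃ s ≤ t, p.enabled ω s ∧ A.excessAt W (p.level X r ω s) = 0 := by
  constructor
  · intro h
    obtain ⟨s, hs⟩ := WithTop.ne_top_iff_exists.1 (ne_top_of_le_ne_top WithTop.coe_ne_top h)
    refine ⟨s, ?_, hp.nextTime_spec hW hs.symm⟩
    rwa [← hs, WithTop.coe_le_coe] at h
  · rintro ⟨s, hs, h⟩
    have : p.nextTime X r W ω ≤ s := sInf_le ⟨s, h, rfl⟩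
    exact this.trans (WithTop.coe_le_coe.2 hs)

/-- A description of `nextTime ≤ t` by countably many times. A time at which an intervention is
optimal is recognized at later times before the next shock, by approximation from the right. -/
theorem nextTime_le_iff_countable (hp : p.IsValid X r W) (hW : A.IsCandidate W) {ω : Ω} {t : ℝ≥0}
    {u : ℕ → ℝ≥0} (hu : DenseRange u) : p.nextTime X r W ω ≤ t ↔
      ∃ n, ∀ k : ℕ, ∃ l, p.enabled ω (min (u l) (min (u n) t)) ∧
        A.excessAt W (p.level X r ω (min (u l) (min (u n) t))) < 1 / ((k : ℝ) + 1) ∧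
        ∀ j, min (u l) (min (u n) t) ≤ min (u j) (min (u n) t) →
          X.damage (min (u j) (min (u n) t)) ω = X.damage (min (u n) t) ω := by
  have hbig : ∃ n, t ≤ u n := by
    obtain ⟨b, ⟨n, rfl⟩, hb⟩ := hu.exists_between (show t < t + 1 from lt_add_one t)
    exact ⟨n, hb.1.le⟩
  rw [hp.nextTime_le_iff hW]
  constructor
  · rintro ⟨s, hst, hes, hs0⟩
    rcases hst.eq_or_lt with rfl | hlt
    · obtain ⟨n, hn⟩ := hbig
      refine ⟨n, fun k => ⟨n, ?_, ?_, fun j hj => ?_⟩⟩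
      · rwa [min_eq_right hn, min_eq_right hn]
      · rw [min_eq_right hn, min_eq_right hn, hs0]
        positivity
      · rw [min_eq_right hn, min_eq_right hn] at *
        rw [le_antisymm (min_le_right _ _) hj]
    · obtain ⟨_, ⟨n, rfl⟩, hn1, hn2⟩ := hu.exists_between
        (show s < min t (X.arrival (X.N s ω + 1) ω) from lt_min hlt (X.lt_arrival_N ω s))
      have hmin : min (u n) t = u n := min_eq_left (hn2.le.trans (min_le_left _ _))
      have hdam : ∀ v, s ≤ v → v ≤ u n → X.damage v ω = X.damage s ω := fun v h1 h2 =>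
        X.damage_eq_of_lt h1 (h2.trans_lt (hn2.trans_le (min_le_right _ _)))
      rw [← hmin] at hdam
      refine ⟨n, fun k => ?_⟩
      have hc : ContinuousWithinAt (fun v => A.excessAt W (p.level X r ω v)) (Ici s) s :=
        hW.continuous_excessAt.continuousAt.comp_continuousWithinAt (hp.level_rightContinuous hes)
      have hev := hc.tendsto.eventually (gt_mem_nhds
        (show A.excessAt W (p.level X r ω s) < 1 / ((k : ℝ) + 1) by rw [hs0]; positivity))
      obtain ⟨v, hv, hv'⟩ := (mem_nhdsGE_iff_exists_Ico_subset' hn1).1 hev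
      obtain ⟨_, ⟨l, rfl⟩, hl1, hl2⟩ := hu.exists_between (show s < min v (u n) from lt_min hv hn1)
      have hmin' : min (u l) (min (u n) t) = u l := by
        rw [hmin]; exact min_eq_left (hl2.le.trans (min_le_right _ _))
      refine ⟨l, ?_, ?_, fun j hj => ?_⟩
      · rw [hmin']; exact (hp.enabled_le ω s _ hl1.le hes).1
      · rw [hmin']; exact hv' ⟨hl1.le, hl2.trans_le (min_le_left _ _)⟩
      · rw [hmin'] at hj
        rw [hdam _ (hl1.le.trans hj) (min_le_right _ _), hdam _ (by rw [hmin]; exact hn1.le) le_rfl]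
  · rintro ⟨n, h⟩
    set b := min (u n) t with hb
    choose l hl1 hl2 hl3 using h
    set q : ℕ → ℝ≥0 := fun k => min (u (l k)) b with hq
    -- right-continuity extends the constancy of the damage from countably many times
    have hdam : ∀ k, ∀ s ∈ Icc (q k) b, X.damage s ω = X.damage b ω := by
      intro k s hs
      rcases hs.2.eq_or_lt with rfl | hsb
      · rfl
      obtain ⟨_, ⟨j, rfl⟩, hj1, hj2⟩ := hu.exists_between
        (show s < min b (X.arrival (X.N s ω + 1) ω) from lt_min hsb (X.lt_arrival_N ω s))
      have hmin : min (u j) b = u j := min_eq_left (hj2.le.trans (min_le_left _ _))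
      have := hl3 k j (by rw [hmin]; exact hs.1.trans hj1.le)
      rw [hmin] at this
      rw [← this]
      exact (X.damage_eq_of_lt hj1.le (hj2.trans_le (min_le_right _ _))).symm
    have h0 : Tendsto (fun k => A.excessAt W (p.level X r ω (q k))) atTop (𝓝 0) :=
      squeeze_zero (fun k => hW.excessAt_nonneg _) (fun k => (hl2 k).le)
        tendsto_one_div_add_atTop_nhds_zero_nat
    obtain ⟨s, hs, φ, hφ, hlim⟩ := isCompact_Icc.tendsto_subseq
      (x := q) (s := Icc 0 b) fun k => ⟨zero_le, min_le_right _ _⟩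
    refine ⟨s, hs.2.trans (min_le_right _ _), ?_⟩
    have h0' := h0.comp hφ.tendsto_atTop
    by_cases hlt : ∃ k, q k < s
    · obtain ⟨k, hk⟩ := hlt
      refine ⟨(hp.enabled_le ω _ _ hk.le (hl1 k)).1, tendsto_nhds_unique ?_ h0'⟩
      have hc := hp.level_continuousOn (hl1 k) (hdam k) s ⟨hk.le, hs.2⟩
      refine (hW.continuous_excessAt.continuousAt.comp_continuousWithinAt hc).tendsto.comp
        (tendsto_nhdsWithin_iff.2 ⟨hlim, ?_⟩)
      filter_upwards [hlim.eventually (lt_mem_nhds hk)] with i hi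
      exact ⟨hi.le, min_le_right _ _⟩
    · push Not at hlt
      exact hp.of_tendsto_right hW hlim (Eventually.of_forall fun i => hlt _)
        (fun i => hl1 _) h0'

end IsValid
end Plan

/-! ### The plans are adapted -/

section Stopped

variable {Ω : Type*} {m : MeasurableSpace Ω}

theorem MaintenanceModel.measurable_levelPath_stopped (A : MaintenanceModel) (r : ℝ) (t : ℝ≥0)
    {d i : Ω → ℝ≥0 → ℝ} (hd : Measurable fun q : Ω × ℝ≥0 => d q.1 (min q.2 t))
    (hi : Measurable fun q : Ω × ℝ≥0 => i q.1 (min q.2 t)) :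
    Measurable fun q : Ω × ℝ≥0 =>
      levelPath A.rate (fun s => r - d q.1 s + i q.1 s) (min q.2 t) := by
  have h := A.measurable_levelPath_uncurry
    (y := fun ω s => r - d ω (min s t) + i ω (min s t)) ((hd.const_sub r).add hi)
  have hm : Measurable fun q : Ω × ℝ≥0 => (q.1, min q.2 t) :=
    measurable_fst.prodMk (measurable_snd.min measurable_const)
  have e : (fun q : Ω × ℝ≥0 => levelPath A.rate (fun s => r - d q.1 s + i q.1 s) (min q.2 t))
      = (fun q : Ω × ℝ≥0 => levelPath A.rate
        (fun s => r - d q.1 (min s t) + i q.1 (min s t)) q.2) ∘ fun q => (q.1, min q.2 t) := by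
    funext q
    have hy : EqOn (fun s => r - d q.1 s + i q.1 s)
        (fun s => r - d q.1 (min s t) + i q.1 (min s t)) (Iic t) := fun s hs => by
      simp only [min_eq_left (mem_Iic.1 hs)]
    have := levelPath_congr (b := A.rate) (isLowerSet_Iic t) hy (min_le_right q.2 t)
    exact this
  rw [e]
  exact h.comp hm

/-- The value of a progressively measurable process at a stopping time. -/
theorem measurableSet_stopped_value {τ : Ω → WithTop ℝ≥0} {f : Ω → ℝ≥0 → ℝ} {q : ℝ≥0}
    (hτ : ∀ s : ℝ≥0, s ≤ q → MeasurableSet {ω | τ ω ≤ s})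
    (hf : Measurable fun p : Ω × ℝ≥0 => f p.1 (min p.2 q)) {C : Set ℝ} (hC : MeasurableSet C) :
    MeasurableSet {ω | f ω ((τ ω).untopD 0) ∈ C ∧ τ ω ≤ q} := by
  have hT : Measurable fun ω => (min (τ ω) q).untopD 0 := by
    refine measurable_of_Iic fun s => ?_
    rcases le_or_gt q s with hqs | hsq
    · convert! MeasurableSet.univ
      ext ω
      refine ⟨fun _ => trivial, fun _ => ?_⟩
      obtain ⟨a, ha⟩ := WithTop.ne_top_iff_exists.1
        (ne_top_of_le_ne_top WithTop.coe_ne_top (min_le_right (τ ω) (q : WithTop ℝ≥0)))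
      have := min_le_right (τ ω) (q : WithTop ℝ≥0)
      rw [← ha, WithTop.coe_le_coe] at this
      rw [mem_preimage, ← ha, WithTop.untopD_coe]
      exact this.trans hqs
    · convert! hτ s hsq.le
      ext ω
      obtain ⟨a, ha⟩ := WithTop.ne_top_iff_exists.1
        (ne_top_of_le_ne_top WithTop.coe_ne_top (min_le_right (τ ω) (q : WithTop ℝ≥0)))
      rw [mem_preimage, ← ha, WithTop.untopD_coe, mem_Iic, ← WithTop.coe_le_coe, ha, min_le_iff]
      exact ⟨fun h => h.resolve_right (not_le.2 (WithTop.coe_lt_coe.2 hsq)), Or.inl⟩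
  convert! (hf.comp (measurable_id.prodMk hT) hC).inter (hτ q le_rfl) using 1
  ext ω
  refine and_congr_left fun h => ?_
  obtain ⟨a, ha⟩ := WithTop.ne_top_iff_exists.1 (ne_top_of_le_ne_top WithTop.coe_ne_top h)
  have haq : a ≤ q := by
    have h' : τ ω ≤ q := h
    rwa [← ha, WithTop.coe_le_coe] at h'
  simp only [mem_preimage, Function.comp, id]
  rw [min_eq_left h, ← ha, WithTop.untopD_coe, min_eq_left haq]

open Classical in
/-- An impulse at a stopping time is a progressively measurable process. -/
theorem measurable_impulse_stopped {τ : Ω → WithTop ℝ≥0} {ζ : Ω → ℝ} {t : ℝ≥0}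
    (h : ∀ q ≤ t, ∀ C : Set ℝ, MeasurableSet C → MeasurableSet {ω | ζ ω ∈ C ∧ τ ω ≤ q}) :
    Measurable fun p : Ω × ℝ≥0 =>
      if τ p.1 < ((min p.2 t : ℝ≥0) : WithTop ℝ≥0) then ζ p.1 else 0 := by
  set f : Ω × ℝ≥0 → ℝ := fun p =>
      if τ p.1 < ((min p.2 t : ℝ≥0) : WithTop ℝ≥0) then ζ p.1 else 0 with hf
  have key : ∀ C : Set ℝ, MeasurableSet C → (0 : ℝ) ∉ C → MeasurableSet (f ⁻¹' C) := by
    intro C hC h0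
    set u := TopologicalSpace.denseSeq ℝ≥0 with hu
    have : f ⁻¹' C = ⋃ k, {ω | ζ ω ∈ C ∧ τ ω ≤ (min (u k) t : ℝ≥0)} ×ˢ
        {s | min (u k) t < min s t} := by
      ext ⟨ω, s⟩
      simp only [hf, mem_preimage, mem_iUnion, mem_prod, mem_ofPred_eq]
      constructor
      · intro hC'
        by_cases hlt : τ ω < ((min s t : ℝ≥0) : WithTop ℝ≥0)
        · rw [if_pos hlt] at hC'
          obtain ⟨a, ha⟩ := WithTop.ne_top_iff_exists.1 (ne_top_of_lt hlt)
          rw [← ha, WithTop.coe_lt_coe] at hlt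
          obtain ⟨b, ⟨k, hk⟩, hb⟩ :=
            (TopologicalSpace.denseRange_denseSeq ℝ≥0).exists_between hlt
          have hbk : u k = b := hk
          have hmin : min (u k) t = b := by
            rw [hbk]; exact min_eq_left (hb.2.le.trans (min_le_right _ _))
          refine ⟨k, ⟨hC', ?_⟩, by rw [hmin]; exact hb.2⟩
          rw [hmin, ← ha, WithTop.coe_le_coe]
          exact hb.1.le
        · rw [if_neg hlt] at hC'
          exact absurd hC' h0
      · rintro ⟨k, ⟨h1, h2⟩, h3⟩
        rwa [if_pos (h2.trans_lt (WithTop.coe_lt_coe.2 h3))]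
    rw [this]
    exact MeasurableSet.iUnion fun k => (h _ (min_le_right _ _) C hC).prod
      (measurableSet_lt measurable_const (measurable_id.min measurable_const))
  intro C hC
  by_cases h0 : (0 : ℝ) ∈ C
  · have := (key Cᶜ hC.compl (fun h => h h0)).compl
    rwa [← preimage_compl, compl_compl] at this
  · exact key C hC h0

end Stopped

namespace Plan
namespace IsValid

variable {Ω : Type*} [mΩ : MeasurableSpace Ω] {A : MaintenanceModel} {P : Measure Ω}
  {X : Shocks A P} {r : ℝ} {W : ℝ → ℝ} {p : Plan Ω}

theorem measurable_level_stopped (hp : p.IsValid X r W) (t : ℝ≥0) :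
    Measurable[(X.filtration r t).prod inferInstance]
      fun q : Ω × ℝ≥0 => p.level X r q.1 (min q.2 t) := by
  have := @MaintenanceModel.measurable_levelPath_stopped Ω (X.filtration r t) A r t
    (fun ω s => X.damage s ω) p.impulses (X.measurable_damage_stopped r t) (hp.measurable_stopped t)
  exact this

theorem measurable_level (hp : p.IsValid X r W) {s t : ℝ≥0} (hst : s ≤ t) :
    Measurable[X.filtration r t] fun ω => p.level X r ω s := by
  have h := hp.measurable_level_stopped t
  have h2 : Measurable[X.filtration r t, (X.filtration r t).prod inferInstance]
      fun ω : Ω => (ω, s) := @measurable_prodMk_right Ω ℝ≥0 (X.filtration r t) _ s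
  have := h.comp h2
  simpa only [Function.comp_def, min_eq_left hst] using this

theorem measurableSet_nextTime_le (hp : p.IsValid X r W) (hW : A.IsCandidate W) (t : ℝ≥0) :
    MeasurableSet[X.filtration r t] {ω | p.nextTime X r W ω ≤ t} := by
  simp only [hp.nextTime_le_iff_countable hW (TopologicalSpace.denseRange_denseSeq ℝ≥0),
    ofPred_exists, ofPred_forall, ofPred_and]
  refine MeasurableSet.iUnion fun n => MeasurableSet.iInter fun k => MeasurableSet.iUnion fun l => ?_
  set u := TopologicalSpace.denseSeq ℝ≥0
  have hle : ∀ j, min (u j) (min (u n) t) ≤ t := fun j => (min_le_right _ _).trans (min_le_right _ _)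
  refine MeasurableSet.inter ?_ (MeasurableSet.inter ?_ (MeasurableSet.iInter fun j =>
    MeasurableSet.iInter fun _ => ?_))
  · exact (X.filtration r).mono (hle l) _ (hp.measurableSet_enabled _)
  · exact (hW.continuous_excessAt.measurable.comp (hp.measurable_level (hle l))) measurableSet_Iio
  · have h := Measurable.sub (X.measurable_damage_filtration r (hle j))
      (X.measurable_damage_filtration r (min_le_right (u n) t))
    convert! h (measurableSet_singleton 0) using 1
    ext ω
    simp [sub_eq_zero]

theorem measurableSet_nextImprovement (hp : p.IsValid X r W) (hW : A.IsCandidate W) {q t : ℝ≥0}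
    (hqt : q ≤ t) {C : Set ℝ} (hC : MeasurableSet C) :
    MeasurableSet[X.filtration r t] {ω | p.nextImprovement X r W ω ∈ C ∧ p.nextTime X r W ω ≤ q} := by
  refine (X.filtration r).mono hqt _ ?_
  have h := @measurableSet_stopped_value Ω (X.filtration r q) (p.nextTime X r W)
    (fun ω s => A.improvement W (p.level X r ω s)) q
    (fun s hs => (X.filtration r).mono hs _ (hp.measurableSet_nextTime_le hW s))
    (hW.measurable_improvement.comp (hp.measurable_level_stopped q)) C hC
  convert! h using 1
  ext ω
  refine and_congr_left fun h => ?_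
  rw [nextImprovement, if_neg (ne_top_of_le_ne_top WithTop.coe_ne_top h)]

theorem measurable_next_stopped (hp : p.IsValid X r W) (hW : A.IsCandidate W) (t : ℝ≥0) :
    Measurable[(X.filtration r t).prod inferInstance]
      fun q : Ω × ℝ≥0 => (p.next X r W).impulses q.1 (min q.2 t) := by
  have h := @measurable_impulse_stopped Ω (X.filtration r t) (p.nextTime X r W)
    (p.nextImprovement X r W) t fun q hq C hC => hp.measurableSet_nextImprovement hW hq hC
  exact Measurable.add (hp.measurable_stopped t) h

theorem measurableSet_nextTime_lt (hp : p.IsValid X r W) (hW : A.IsCandidate W) (t : ℝ≥0) :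
    MeasurableSet[X.filtration r t] {ω | p.nextTime X r W ω < t} := by
  set u := TopologicalSpace.denseSeq ℝ≥0
  have : {ω | p.nextTime X r W ω < t}
      = ⋃ k, {ω | u k < t ∧ p.nextTime X r W ω ≤ u k} := by
    ext ω
    simp only [mem_iUnion, mem_ofPred_eq]
    constructor
    · intro h
      obtain ⟨a, ha⟩ := WithTop.ne_top_iff_exists.1 (ne_top_of_lt h)
      rw [← ha, WithTop.coe_lt_coe] at h
      obtain ⟨b, ⟨k, hk⟩, hb⟩ := (TopologicalSpace.denseRange_denseSeq ℝ≥0).exists_between h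
      have hbk : u k = b := hk
      exact ⟨k, hbk ▸ hb.2, by rw [← ha, hbk, WithTop.coe_le_coe]; exact hb.1.le⟩
    · rintro ⟨k, h1, h2⟩
      exact h2.trans_lt (WithTop.coe_lt_coe.2 h1)
  rw [this]
  refine MeasurableSet.iUnion fun k => ?_
  by_cases hk : u k < t
  · simp only [hk, true_and]
    exact (X.filtration r).mono hk.le _ (hp.measurableSet_nextTime_le hW _)
  · simp only [hk, false_and]
    exact @MeasurableSet.empty _ (X.filtration r t)

end IsValid
end Plan

/-! ### The level after an optimal intervention -/

namespace Plan
namespace IsValid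

variable {Ω : Type*} [mΩ : MeasurableSpace Ω] {A : MaintenanceModel} {P : Measure Ω}
  {X : Shocks A P} {r : ℝ} {W : ℝ → ℝ} {p : Plan Ω}

theorem next_enabled_le (hp : p.IsValid X r W) (hW : A.IsCandidate W) (ω : Ω) {s t : ℝ≥0}
    (hst : s ≤ t) (hs : (p.next X r W).enabled ω s) :
    (p.next X r W).enabled ω t ∧ (p.next X r W).impulses ω t = (p.next X r W).impulses ω s := by
  have hs' : p.nextTime X r W ω < (s : WithTop ℝ≥0) := hs
  have ht' : p.nextTime X r W ω < (t : WithTop ℝ≥0) := hs'.trans_le (WithTop.coe_le_coe.2 hst)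
  obtain ⟨a, ha⟩ := WithTop.ne_top_iff_exists.1 (ne_top_of_lt hs')
  have hen := (hp.nextTime_spec hW ha.symm).1
  have has : a ≤ s := by
    rw [← ha, WithTop.coe_lt_coe] at hs'
    exact hs'.le
  refine ⟨ht', ?_⟩
  simp only [next, if_pos hs', if_pos ht']
  rw [(hp.enabled_le ω a s has hen).2, (hp.enabled_le ω a t (has.trans hst) hen).2]

theorem measurable_next_path (hp : p.IsValid X r W) (ω : Ω) :
    Measurable ((p.next X r W).impulses ω) := by
  classical
  refine (hp.measurable_path ω).add (Measurable.ite ?_ measurable_const measurable_const)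
  rcases eq_or_ne (p.nextTime X r W ω) ⊤ with h | h
  · simp only [h, not_top_lt]
    exact MeasurableSet.const _
  · obtain ⟨a, ha⟩ := WithTop.ne_top_iff_exists.1 h
    simp only [← ha, WithTop.coe_lt_coe]
    exact measurableSet_Ioi

theorem measurable_next_input (hp : p.IsValid X r W) (ω : Ω) :
    Measurable fun s => r - X.damage s ω + (p.next X r W).impulses ω s :=
  (measurable_const.sub (X.measurable_damage_path ω)).add (hp.measurable_next_path ω)


/-- Up to its time, the next intervention does not change the level. -/
theorem next_level_of_le {ω : Ω} {s : ℝ≥0} (hs : (s : WithTop ℝ≥0) ≤ p.nextTime X r W ω) :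
    (p.next X r W).level X r ω s = p.level X r ω s := by
  have hy : EqOn (fun u => r - X.damage u ω + (p.next X r W).impulses ω u)
      (fun u => r - X.damage u ω + p.impulses ω u) (Iic s) := fun u hu => by
    have : ¬ p.nextTime X r W ω < (u : WithTop ℝ≥0) :=
      not_lt.2 ((WithTop.coe_le_coe.2 hu).trans hs)
    simp only [next, if_neg this, add_zero]
  have := levelPath_congr (b := A.rate) (isLowerSet_Iic s) hy (mem_Iic.2 le_rfl)
  exact this

/-- The next intervention raises the level to its target. -/
theorem next_level_eq (hp : p.IsValid X r W) (hW : A.IsCandidate W) {ω : Ω} {t s : ℝ≥0}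
    (ht : p.nextTime X r W ω = t) (hts : t < s) : (p.next X r W).level X r ω s
      = A.target W (A.clamp (p.level X r ω t)) - (X.damage s ω - X.damage t ω)
        - ∫ u in (t : ℝ)..s, A.rate ((p.next X r W).level X r ω u.toNNReal) := by
  have h := A.levelPath_sub (hp.measurable_next_input ω) t s
  have hle : (p.next X r W).level X r ω t = p.level X r ω t := next_level_of_le ht.ge
  have himp : (p.next X r W).impulses ω s - (p.next X r W).impulses ω t
      = A.target W (A.clamp (p.level X r ω t)) - p.level X r ω t := by
    have h1 : p.nextTime X r W ω < (s : WithTop ℝ≥0) := by rw [ht]; exact WithTop.coe_lt_coe.2 hts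
    have h2 : ¬ p.nextTime X r W ω < (t : WithTop ℝ≥0) := by rw [ht]; exact lt_irrefl _
    simp only [next, if_pos h1, if_neg h2]
    rw [(hp.enabled_le ω t s hts.le (hp.nextTime_spec hW ht).1).2, nextImprovement,
      if_neg (by rw [ht]; exact WithTop.coe_ne_top), ht, WithTop.untopD_coe,
      MaintenanceModel.improvement]
    ring
  rw [← hle] at himp ⊢
  simp only [level] at himp ⊢
  linarith

theorem next_level_mem (hp : p.IsValid X r W) (hW : A.IsCandidate W) {ω : Ω} {t s : ℝ≥0}
    (ht : p.nextTime X r W ω = t) (hts : t < s) (hs : s < X.arrival (X.N t ω + 1) ω) :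
    (p.next X r W).level X r ω s
      ∈ Icc (A.target W (A.clamp (p.level X r ω t)) - A.c A.m * (s - t))
        (A.target W (A.clamp (p.level X r ω t))) := by
  rw [hp.next_level_eq hW ht hts, X.damage_eq_of_lt hts.le hs]
  have h1 := A.integral_rate_nonneg (f := (p.next X r W).level X r ω) (NNReal.coe_le_coe.2 hts.le)
  have h2 := A.integral_rate_le (f := (p.next X r W).level X r ω) (NNReal.coe_le_coe.2 hts.le)
  constructor <;> linarith

/-- After an intervention no further one is due within a fixed time, unless there is a shock. -/
theorem exists_delay (hW : A.IsCandidate W) : ∃ h : ℝ≥0, 0 < h ∧ ∀ (p : Plan Ω), p.IsValid X r W →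
    ∀ ω, ∀ t s : ℝ≥0, p.nextTime X r W ω = t → t < s → s < t + h →
      s < X.arrival (X.N t ω + 1) ω → A.k / 2 ≤ A.excessAt W ((p.next X r W).level X r ω s) := by
  obtain ⟨h, hh, hgap⟩ := hW.exists_gap
  refine ⟨⟨h, hh.le⟩, hh, fun p hp ω t s ht hts hsh hs => ?_⟩
  have hm := hp.next_level_mem hW ht hts hs
  refine hgap _ (A.clamp_mem' _) _ ⟨le_trans ?_ hm.1, hm.2⟩
  have hc := A.c_pos _ A.m_mem
  have : (s : ℝ) < t + h := NNReal.coe_lt_coe.2 hsh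
  gcongr
  linarith

theorem next (hp : p.IsValid X r W) (hW : A.IsCandidate W) : (p.next X r W).IsValid X r W where
  enabled_le ω _ _ hst hs := hp.next_enabled_le hW ω hst hs
  measurable_path := hp.measurable_next_path
  measurable_stopped := hp.measurable_next_stopped hW
  measurableSet_enabled := hp.measurableSet_nextTime_lt hW
  excess_after ω t hn hs := by
    have ht : p.nextTime X r W ω = t := by
      have hge : (t : WithTop ℝ≥0) ≤ p.nextTime X r W ω := not_lt.1 hn
      have h1 : p.nextTime X r W ω < ((t + 1 : ℝ≥0) : WithTop ℝ≥0) := hs _ (lt_add_one t)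
      obtain ⟨a, ha⟩ := WithTop.ne_top_iff_exists.1 (ne_top_of_lt h1)
      rw [← ha, WithTop.coe_le_coe] at hge
      rcases hge.eq_or_lt with h | h
      · rw [← ha, h]
      · have h2 : p.nextTime X r W ω < a := hs _ h
        rw [← ha] at h2
        exact absurd h2 (lt_irrefl _)
    obtain ⟨h, hh, hd⟩ := exists_delay (X := X) (r := r) hW
    refine ⟨min (t + h) (X.arrival (X.N t ω + 1) ω),
      lt_min (lt_add_of_pos_right t hh) (X.lt_arrival_N ω t), fun s hs => ?_⟩
    exact hd p hp ω t s ht hs.1 (hs.2.trans_le (min_le_left _ _)) (hs.2.trans_le (min_le_right _ _))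

end IsValid

variable {Ω : Type*} [mΩ : MeasurableSpace Ω] {A : MaintenanceModel} {P : Measure Ω}
  (X : Shocks A P) (r : ℝ) (W : ℝ → ℝ)

/-! ### The control that intervenes whenever it is optimal -/

/-- The first `i` optimal interventions. -/
def optimal (i : ℕ) : Plan Ω := (fun p => p.next X r W)^[i] (Plan.empty Ω)

theorem optimal_succ (i : ℕ) : optimal X r W (i + 1) = (optimal X r W i).next X r W :=
  Function.iterate_succ_apply' _ _ _

variable {W}

theorem isValid_optimal (hW : A.IsCandidate W) (i : ℕ) : (optimal X r W i).IsValid X r W := by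
  induction i with
  | zero => exact isValid_empty
  | succ i ih =>
    rw [optimal_succ]
    exact ih.next hW

variable (W) in
/-- The time of the `i`-th optimal intervention. -/
def hit (i : ℕ) (ω : Ω) : WithTop ℝ≥0 := (optimal X r W i).nextTime X r W ω

variable (W) in
/-- The improvement at the `i`-th optimal intervention. -/
def lift (i : ℕ) (ω : Ω) : ℝ := (optimal X r W i).nextImprovement X r W ω

theorem hit_le_succ (i : ℕ) (ω : Ω) : hit X r W i ω ≤ hit X r W (i + 1) ω := by
  refine le_sInf ?_
  rintro _ ⟨s, hs, rfl⟩
  rw [optimal_succ] at hs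
  exact (show hit X r W i ω < s from hs.1).le

theorem hit_monotone (ω : Ω) : Monotone fun i => hit X r W i ω :=
  monotone_nat_of_le_succ fun i => hit_le_succ X r i ω

theorem hit_lt_succ (hW : A.IsCandidate W) {i : ℕ} {ω : Ω} (h : hit X r W i ω ≠ ⊤) :
    hit X r W i ω < hit X r W (i + 1) ω := by
  rcases eq_or_ne (hit X r W (i + 1) ω) ⊤ with h' | h'
  · rw [h']
    exact lt_top_iff_ne_top.2 h
  · obtain ⟨s, hs⟩ := WithTop.ne_top_iff_exists.1 h'
    have := ((isValid_optimal X r hW (i + 1)).nextTime_spec hW (ω := ω) hs.symm).1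
    rw [optimal_succ] at this
    rw [← hs]
    exact this

/-- Only finitely many interventions take place in a bounded time. -/
theorem tendsto_hit (hW : A.IsCandidate W) (ω : Ω) :
    Tendsto (fun i => hit X r W i ω) atTop (𝓝 ⊤) := by
  obtain ⟨h, hh, hd⟩ := IsValid.exists_delay (X := X) (r := r) hW
  have hh' : (0 : ℝ) < h := hh
  -- two consecutive interventions are separated by a shock or by a time of at least `h`
  have hcount : ∀ i, ∀ t : ℝ≥0, hit X r W i ω = t → (i : ℝ) ≤ t / h + X.N t ω := by
    intro i
    induction i with
    | zero =>
      intro t _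
      rw [Nat.cast_zero]
      positivity
    | succ i ih =>
      intro s hs
      have hne : hit X r W i ω ≠ ⊤ := ne_top_of_le_ne_top (by rw [hs]; exact WithTop.coe_ne_top)
        (hit_le_succ X r i ω)
      have hlt := hit_lt_succ X r hW hne
      obtain ⟨t, ht⟩ := WithTop.ne_top_iff_exists.1 hne
      rw [← ht, hs, WithTop.coe_lt_coe] at hlt
      have hi := ih t ht.symm
      have hspec := ((isValid_optimal X r hW (i + 1)).nextTime_spec hW (ω := ω) hs).2
      rw [optimal_succ] at hspec
      have hlt' : (t : ℝ) < s := NNReal.coe_lt_coe.2 hlt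
      rcases lt_or_ge s (X.arrival (X.N t ω + 1) ω) with hsN | hsN
      · have hsh : t + h ≤ s := by
          by_contra hcon
          have := hd _ (isValid_optimal X r hW i) ω t s ht.symm hlt (not_le.1 hcon) hsN
          rw [hspec] at this
          linarith [A.k_pos]
        have hsh' : (t : ℝ) + h ≤ s := NNReal.coe_le_coe.2 hsh
        have hN : (X.N t ω : ℝ) ≤ X.N s ω := Nat.cast_le.2 (X.N_mono ω hlt.le)
        have : (t : ℝ) / h + 1 ≤ s / h := by
          rw [← div_self hh'.ne', ← add_div]
          gcongr
        push_cast
        linarith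
      · have hN : X.N t ω + 1 ≤ X.N s ω := (X.le_N_iff ω s _).2 hsN
        have hN' : (X.N t ω : ℝ) + 1 ≤ X.N s ω := by exact_mod_cast hN
        have : (t : ℝ) / h ≤ s / h := by gcongr
        push_cast
        linarith
  refine tendsto_order.2 ⟨fun a ha => ?_, fun a ha => absurd ha not_top_lt⟩
  obtain ⟨b, rfl⟩ := WithTop.ne_top_iff_exists.1 ha.ne
  obtain ⟨n, hn⟩ := exists_nat_gt ((b : ℝ) / h + X.N b ω)
  filter_upwards [eventually_ge_atTop n] with i hi
  by_contra hcon
  rw [not_lt] at hcon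
  obtain ⟨t, ht⟩ := WithTop.ne_top_iff_exists.1 (ne_top_of_le_ne_top WithTop.coe_ne_top hcon)
  rw [← ht, WithTop.coe_le_coe] at hcon
  have h1 := hcount i t ht.symm
  have h2 : (t : ℝ) / h ≤ b / h := by
    have : (t : ℝ) ≤ b := NNReal.coe_le_coe.2 hcon
    gcongr
  have h3 : (X.N t ω : ℝ) ≤ X.N b ω := Nat.cast_le.2 (X.N_mono ω hcon)
  have h4 : (n : ℝ) ≤ i := Nat.cast_le.2 hi
  linarith

theorem measurable_lift (hW : A.IsCandidate W) (i : ℕ) :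
    Measurable[⨆ t, X.filtration r t] (lift X r W i) := by
  intro C hC
  have hv := isValid_optimal X r hW i
  -- if the intervention never takes place, the improvement is `0`
  have e : lift X r W i ⁻¹' C = (⋃ n : ℕ, {ω | lift X r W i ω ∈ C ∧ hit X r W i ω ≤ (n : ℝ≥0)}) ∪
      ({ω | (0 : ℝ) ∈ C} ∩ (⋃ n : ℕ, {ω | hit X r W i ω ≤ (n : ℝ≥0)})ᶜ) := by
    ext ω
    simp only [mem_preimage, mem_union, mem_iUnion, mem_ofPred_eq, mem_inter_iff, mem_compl_iff,
      exists_and_left]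
    by_cases h : ∃ n : ℕ, hit X r W i ω ≤ ((n : ℝ≥0) : WithTop ℝ≥0)
    · simp only [h, and_true, not_true_eq_false, and_false, or_false]
    · have htop : hit X r W i ω = ⊤ := by
        by_contra hne
        obtain ⟨t, ht⟩ := WithTop.ne_top_iff_exists.1 hne
        obtain ⟨n, hn⟩ := exists_nat_ge t
        exact h ⟨n, by rw [← ht]; exact WithTop.coe_le_coe.2 hn⟩
      have h0 : lift X r W i ω = 0 := if_pos htop
      simp only [h, h0, and_false, not_false_eq_true, and_true, false_or]
  rw [e]
  refine MeasurableSet.union (MeasurableSet.iUnion fun n => ?_)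
    (MeasurableSet.inter (MeasurableSet.const _) (MeasurableSet.iUnion fun n => ?_).compl)
  · exact le_iSup (fun t => (X.filtration r) t) (n : ℝ≥0) _ (hv.measurableSet_nextImprovement hW le_rfl hC)
  · exact le_iSup (fun t => (X.filtration r) t) (n : ℝ≥0) _ (hv.measurableSet_nextTime_le hW _)

/-- The control that intervenes whenever the candidate value does not exceed that of an
intervention, and then raises the level to the largest optimal target. -/
def control (hW : A.IsCandidate W) : ImpulseControl X r where
  τ := hit X r W
  ζ := lift X r W
  τ_le_succ i := ae_of_all _ (hit_le_succ X r i)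
  isStoppingTime i := (isValid_optimal X r hW i).measurableSet_nextTime_le hW
  measurable_ζ i := fun _ hC => ⟨measurable_lift X r hW i hC, fun _ =>
    (isValid_optimal X r hW i).measurableSet_nextImprovement hW le_rfl hC⟩
  tendsto_τ := ae_of_all _ (tendsto_hit X r hW)

end Plan

/-! ### The optimal control is admissible and lossless -/

theorem eventually_le_of_coe_lt {s : ℝ≥0} {τ : WithTop ℝ≥0} (h : (s : WithTop ℝ≥0) < τ) :
    ∀ᶠ u : ℝ≥0 in 𝓝[>] s, (u : WithTop ℝ≥0) ≤ τ := by
  cases τ with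
  | top => exact Eventually.of_forall fun u => le_top
  | coe v =>
    filter_upwards [Ioo_mem_nhdsGT (WithTop.coe_lt_coe.1 h)] with u hu
    exact WithTop.coe_le_coe.2 hu.2.le

namespace ImpulseControl

variable {Ω : Type*} [mΩ : MeasurableSpace Ω] {A : MaintenanceModel} {P : Measure Ω}
  {X : Shocks A P} {r : ℝ} {ν : ImpulseControl X r}

/-- If the level is not below `m` at the failure time itself, it is so at times just after. -/
theorem frequently_lt_of_failureTime {ω : Ω} {s : ℝ≥0} (hs : ν.failureTime ω = s)
    (hm : A.m ≤ ν.level s ω) : ∃ᶠ u in 𝓝[>] s, ν.level u ω < A.m := by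
  intro hev
  obtain ⟨b, hb, hsub⟩ := (mem_nhdsGT_iff_exists_Ioo_subset' (lt_add_one s)).1 hev
  have hlow := ν.le_failureTime_iff.1 hs.ge
  have : (b : WithTop ℝ≥0) ≤ ν.failureTime ω := ν.le_failureTime_iff.2 fun u hu => by
    rcases lt_trichotomy u s with h | rfl | h
    · exact hlow u h
    · exact hm
    · exact not_lt.1 (hsub ⟨h, hu⟩)
  rw [hs, WithTop.coe_le_coe] at this
  exact absurd hb (not_lt.2 this)

end ImpulseControl

namespace Plan

variable {Ω : Type*} [mΩ : MeasurableSpace Ω] {A : MaintenanceModel} {P : Measure Ω}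
  (X : Shocks A P) (r : ℝ) {W : ℝ → ℝ}

open Classical in
theorem optimal_impulses (i : ℕ) (ω : Ω) (s : ℝ≥0) : (optimal X r W i).impulses ω s
    = ∑ j ∈ Finset.range i, if hit X r W j ω < (s : WithTop ℝ≥0) then lift X r W j ω else 0 := by
  induction i with
  | zero => rfl
  | succ i ih =>
    rw [Finset.sum_range_succ, ← ih, optimal_succ]
    rfl

/-- Up to the `i`-th intervention, the level is that under the interventions before it. -/
theorem control_level (hW : A.IsCandidate W) {i : ℕ} {ω : Ω} {s : ℝ≥0}
    (hs : (s : WithTop ℝ≥0) ≤ hit X r W i ω) :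
    (control X r hW).level s ω = (optimal X r W i).level X r ω s := by
  have hy : EqOn (fun u => r - X.damage u ω + (control X r hW).impulses ω u)
      (fun u => r - X.damage u ω + (optimal X r W i).impulses ω u) (Iic s) := fun u hu => by
    simp only [optimal_impulses, ImpulseControl.impulses]
    congr 1
    refine tsum_eq_sum fun j hj => if_neg (not_lt.2 ?_)
    exact ((WithTop.coe_le_coe.2 hu).trans hs).trans
      (hit_monotone X r ω (by simpa using hj))
  have := levelPath_congr (b := A.rate) (isLowerSet_Iic s) hy (mem_Iic.2 le_rfl)
  exact this

theorem control_levelBefore (hW : A.IsCandidate W) {i : ℕ} {ω : Ω} {t : ℝ≥0}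
    (ht : hit X r W i ω = t) :
    (control X r hW).levelBefore i ω = (optimal X r W i).level X r ω t := by
  have hlt : ∀ j < i, hit X r W j ω < t := by
    intro j hj
    have h1 : hit X r W (j + 1) ω ≤ t := ht ▸ hit_monotone X r ω (Nat.succ_le_of_lt hj)
    have h2 := hit_monotone X r (W := W) ω (Nat.le_succ j)
    exact (hit_lt_succ X r hW (ne_top_of_le_ne_top WithTop.coe_ne_top (h2.trans h1))).trans_le h1
  have hτ : ∀ j, (control X r hW).τ j ω = hit X r W j ω := fun _ => rfl
  rw [ImpulseControl.levelBefore, Finset.sum_eq_zero fun j hj => ?_, add_zero, hτ, ht,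
    WithTop.untopD_coe, control_level X r hW ht.ge]
  rw [if_neg]
  rw [hτ, hτ, ht]
  exact (hlt j (Finset.mem_range.1 hj)).ne

theorem lift_eq {i : ℕ} {ω : Ω} {t : ℝ≥0} (ht : hit X r W i ω = t) : lift X r W i ω
    = A.target W (A.clamp ((optimal X r W i).level X r ω t)) - (optimal X r W i).level X r ω t := by
  have ht' : (optimal X r W i).nextTime X r W ω = t := ht
  rw [lift, nextImprovement, if_neg (by rw [ht']; exact WithTop.coe_ne_top), ht',
    WithTop.untopD_coe, MaintenanceModel.improvement]

/-- Shocks and drift only lower the level, and interventions raise it to targets not above `M`. -/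
theorem optimal_level_le (hW : A.IsCandidate W) (hr : r ≤ A.M) {ω : Ω} (hS : ∀ i, 0 ≤ X.S i ω)
    (i : ℕ) (s : ℝ≥0) : (optimal X r W i).level X r ω s ≤ A.M := by
  have hdam : ∀ a b : ℝ≥0, a ≤ b → X.damage a ω ≤ X.damage b ω := fun a b hab =>
    Finset.sum_le_sum_of_subset_of_nonneg (Finset.range_mono (X.N_mono ω hab)) fun i _ _ => hS i
  have hv := isValid_optimal X r hW
  induction i with
  | zero =>
    have h := A.levelPath_eq ((hv 0).measurable_input ω) s
    have h1 : 0 ≤ X.damage s ω := Finset.sum_nonneg fun i _ => hS i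
    have h2 := A.integral_rate_nonneg (a := 0) (t := s)
      (f := (optimal X r W 0).level X r ω) s.2
    have h3 : (optimal X r W 0).impulses ω s = 0 := rfl
    rw [h3] at h
    rw [level, h]
    simp only [level] at h2
    linarith
  | succ i ih =>
    rw [optimal_succ]
    rcases le_or_gt (s : WithTop ℝ≥0) (hit X r W i ω) with h | h
    · rw [IsValid.next_level_of_le h]
      exact ih
    · obtain ⟨t, ht⟩ := WithTop.ne_top_iff_exists.1 (ne_top_of_lt h)
      rw [← ht, WithTop.coe_lt_coe] at h
      rw [(hv i).next_level_eq hW ht.symm h]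
      have h1 := hdam t s h.le
      have h2 := A.integral_rate_nonneg
        (f := ((optimal X r W i).next X r W).level X r ω) (NNReal.coe_le_coe.2 h.le)
      have h3 := (hW.target_mem (A.clamp_mem' ((optimal X r W i).level X r ω t))).1.2
      linarith

theorem control_isAdmissible (hW : A.IsCandidate W) (hr : r ≤ A.M) :
    (control X r hW).IsAdmissible := by
  filter_upwards [X.S_nonneg] with ω hS i hi
  obtain ⟨t, ht⟩ := WithTop.ne_top_iff_exists.1 hi
  have ht' : hit X r W i ω = t := ht.symm
  have hζ : (control X r hW).ζ i ω = lift X r W i ω := rfl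
  rw [control_levelBefore X r hW ht', hζ, lift_eq X r ht']
  set x := (optimal X r W i).level X r ω t
  have hx : x ≤ A.M := optimal_level_le X r hW hr hS i t
  obtain ⟨h1, h2⟩ := (hW.target_mem (A.clamp_mem' x)).1
  have := A.le_clamp hx
  constructor <;> linarith

/-- At a time without intervention the level is that of a plan whose interventions are over and
whose next intervention is still to come. -/
theorem exists_between_hits (hW : A.IsCandidate W) {ω : Ω} {s : ℝ≥0}
    (hs : ∀ j, hit X r W j ω ≠ s) :
    ∃ i, (optimal X r W i).enabled ω s ∧ (s : WithTop ℝ≥0) < hit X r W i ω := by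
  classical
  have hex : ∃ i, (s : WithTop ℝ≥0) < hit X r W i ω :=
    ((tendsto_hit X r hW ω).eventually (lt_mem_nhds (WithTop.coe_lt_top s))).exists
  refine ⟨Nat.find hex, ?_, Nat.find_spec hex⟩
  rcases h : Nat.find hex with _ | j
  · exact trivial
  · have hj := Nat.find_min hex (m := j) (by omega)
    rw [optimal_succ]
    exact lt_of_le_of_ne (not_lt.1 hj) (hs j)

/-- The interventions take place exactly where they are optimal. Failure not caused by a shock cannot
happen just after an intervention, as targets lie above `m`; it happens when the drift reaches `m`
without an intervention, and there the candidate value is `0`. -/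
theorem control_isLossless (hW : A.IsCandidate W) (hr : r ≤ A.M) :
    ∀ᵐ ω ∂P, (control X r hW).IsLossless W ω := by
  filter_upwards [X.S_nonneg] with ω hS
  have hv := isValid_optimal X r hW
  have hM := optimal_level_le X r hW hr hS
  have hpos : ∀ {i : ℕ} {s : ℝ≥0}, (optimal X r W i).enabled ω s →
      (s : WithTop ℝ≥0) < hit X r W i ω → A.m ≤ (optimal X r W i).level X r ω s →
      0 < A.excess W ((optimal X r W i).level X r ω s) := by
    intro i s hen hs hm
    have hnn := hW.excessAt_nonneg ((optimal X r W i).level X r ω s)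
    have hne : A.excessAt W ((optimal X r W i).level X r ω s) ≠ 0 := fun h0 =>
      absurd ((hv i).nextTime_le_iff hW |>.2 ⟨s, le_rfl, hen, h0⟩) (not_le.2 hs)
    have := lt_of_le_of_ne hnn hne.symm
    rwa [MaintenanceModel.excessAt, A.clamp_of_mem ⟨hm, hM i s⟩] at this
  have hhit : ∀ {i : ℕ} {t : ℝ≥0}, hit X r W i ω = t → A.m ≤ (optimal X r W i).level X r ω t →
      A.excess W ((optimal X r W i).level X r ω t) = 0 := by
    intro i t ht hm
    have := ((hv i).nextTime_spec hW ht).2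
    rwa [MaintenanceModel.excessAt, A.clamp_of_mem ⟨hm, hM i t⟩] at this
  refine ⟨fun s hs hlt => ?_, fun i hi => ?_, fun s hs => ?_⟩
  · obtain ⟨i, hen, hsi⟩ := exists_between_hits X r hW hs
    have hm := ImpulseControl.le_level_of_lt hlt
    rw [control_level X r hW hsi.le] at hm ⊢
    exact hpos hen hsi hm
  · obtain ⟨t, ht⟩ := WithTop.ne_top_iff_exists.1 (ne_top_of_lt hi)
    have ht' : hit X r W i ω = t := ht.symm
    have hζ : (control X r hW).ζ i ω = lift X r W i ω := rfl
    rw [← ht] at hi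
    have hm := ImpulseControl.le_level_of_lt hi
    rw [control_level X r hW ht'.ge] at hm
    have hx : (optimal X r W i).level X r ω t ∈ Icc A.m A.M := ⟨hm, hM i t⟩
    rw [control_levelBefore X r hW ht', hζ, lift_eq X r ht', A.clamp_of_mem hx, add_sub_cancel]
    exact hW.value_target hx (hhit ht' hm)
  · rcases lt_or_ge ((control X r hW).level s ω) A.m with hlt | hm
    · exact A.aliveValue_of_lt hlt
    have hfreq := ImpulseControl.frequently_lt_of_failureTime hs hm
    by_cases hex : ∃ j, hit X r W j ω = s
    -- just after an intervention the level is close to the target, which is above `m`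
    · exfalso
      obtain ⟨i, hi⟩ := hex
      rw [control_level X r hW hi.ge] at hm
      set x := (optimal X r W i).level X r ω s with hx
      have hxm : x ∈ Icc A.m A.M := ⟨hm, hM i s⟩
      have hgt : A.m < A.target W x := by
        have h1 := (hW.target_mem hxm).1.1
        rcases h1.eq_or_lt with h | h
        · have h2 := hW.excess_target hxm
          rw [← h, hhit hi hm] at h2
          exact absurd h2 A.k_pos.ne
        · exact hm.trans_lt h
      have hc := A.c_pos _ A.m_mem
      have hlim : Tendsto (fun u : ℝ≥0 => A.target W x - A.c A.m * ((u : ℝ) - s)) (𝓝[>] s)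
          (𝓝 (A.target W x)) := by
        have : Continuous fun u : ℝ≥0 => A.target W x - A.c A.m * ((u : ℝ) - s) := by fun_prop
        simpa using (this.tendsto s).mono_left nhdsWithin_le_nhds
      have hnext : ∀ᶠ u : ℝ≥0 in 𝓝[>] s, (u : WithTop ℝ≥0) ≤ hit X r W (i + 1) ω := by
        have h1 := hit_lt_succ X r hW (i := i) (ω := ω) (by rw [hi]; exact WithTop.coe_ne_top)
        rw [hi] at h1
        exact eventually_le_of_coe_lt h1
      obtain ⟨u, hu1, hu2, hu3, hu4⟩ := (hfreq.and_eventually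
        ((hlim.eventually (lt_mem_nhds hgt)).and (hnext.and
          (Ioo_mem_nhdsGT (X.lt_arrival_N ω s))))).exists
      have hmem := ((hv i).next_level_mem hW hi hu4.1 hu4.2).1
      rw [← hx, A.clamp_of_mem hxm] at hmem
      rw [control_level X r hW hu3, optimal_succ] at hu1
      linarith
    · push Not at hex
      obtain ⟨i, hen, hsi⟩ := exists_between_hits X r hW hex
      rw [control_level X r hW hsi.le] at hm ⊢
      have hnext : ∀ᶠ u : ℝ≥0 in 𝓝[>] s, (u : WithTop ℝ≥0) ≤ hit X r W i ω :=
        eventually_le_of_coe_lt hsi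
      have hfreq' : ∃ᶠ u in 𝓝[>] s, (optimal X r W i).level X r ω u ∈ Iic A.m := by
        refine (hfreq.and_eventually hnext).mono fun u hu => ?_
        rw [← control_level X r hW hu.2]
        exact hu.1.le
      have hlim : Tendsto ((optimal X r W i).level X r ω) (𝓝[>] s)
          (𝓝 ((optimal X r W i).level X r ω s)) :=
        ((hv i).level_rightContinuous hen).tendsto.mono_left (nhdsWithin_mono _ Ioi_subset_Ici_self)
      have hle := isClosed_Iic.mem_of_frequently_of_tendsto hfreq' hlim
      have heq : (optimal X r W i).level X r ω s = A.m := le_antisymm hle hm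
      have hp := hpos hen hsi hm
      rw [heq] at hp ⊢
      rw [A.aliveValue_of_mem A.m_mem, hW.value_threshold hp, ENNReal.ofReal_zero]

end Plan

/-! ### The value function -/

section Value

variable {Ω : Type*} [mΩ : MeasurableSpace Ω] {A : MaintenanceModel} {P : Measure Ω}
  [IsProbabilityMeasure P] (X : Shocks A P)

/-- The candidate is the value function. -/
theorem Shocks.value_eq {W : ℝ → ℝ} (hW : A.IsCandidate W) {r : ℝ} (hr : r ∈ Icc A.m A.M) :
    X.value r = (W r : EReal) := by
  refine le_antisymm (iSup_le fun ν => ν.2.profit_le hW hr) ?_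
  have hν := Plan.control_isAdmissible X r hW hr.2
  exact (hν.le_profit hW hr (Plan.control_isLossless X r hW hr.2)).trans
    (le_iSup (fun ν : {ν : ImpulseControl X r // ν.IsAdmissible} => ν.1.profit)
      ⟨Plan.control X r hW, hν⟩)

end Value

end ImpulseMaintenance

end

theorem mainTheorem2 {Ω : Type*} [MeasurableSpace Ω] (P : MeasureTheory.Measure Ω)
    [MeasureTheory.IsProbabilityMeasure P]
    (A : ImpulseMaintenance.MaintenanceModel) (X : ImpulseMaintenance.Shocks A P) :
    (∀ r ∈ Set.Icc A.m A.M, X.value r ≠ ⊤ ∧ X.value r ≠ ⊥) ∧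
      A.IsViscositySolution (fun r => (X.value r).toReal) := by
  obtain ⟨W, hW⟩ := A.exists_isCandidate
  refine ⟨fun r hr => ?_, (hW.congr fun r hr => ?_).isViscositySolution⟩
  · rw [X.value_eq hW hr]
    exact ⟨EReal.coe_ne_top _, EReal.coe_ne_bot _⟩
  · simp only [X.value_eq hW hr, EReal.toReal_coe]
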